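/- Let $p$ be a probability distribution on $\mathbb Z^2$ and, for $x\in\mathbb Z^2$, let $\mathbb P^x$ be the law of the random walk $X_k=x+\xi_1+\dots+\xi_k$ with i.i.d. steps $\xi_i$ of law $p$. Assume that $p$ is symmetric ($p(-z)=p(z)$), strongly aperiodic (for each $x$ the set $\{x+z: p(z)>0\}$ generates the group $\mathbb Z^2$), that the covariance matrix of $p$ is the identity, and that for some $\beta>0$ one has $\sum_z |z|^{3+2\beta}p(z)<\infty$, where $|\cdot|$ is the Euclidean norm. Put $D(0,\rho)=\{y\in\mathbb Z^2:|y|<\rho\}$, and for $A\subseteq\mathbb Z^2$ and $s\ge 0$ let $\partial A_s=\{y\in A^c:\inf_{x\in A}|y-x|\le s\}$. Assume also Condition A: either $p$ has finite support, or there are $c>0$ and $s_0$ such that, for all real $s_0\le s\le R$ and all $y\in\mathbb Z^2$ with $R\le|y|\le R+s$, $$\sum_{z\in D(0,R)}p(z-y)\ \ge\ c\,e^{-\beta s^{1/4}} .$$ For $B\subseteq\mathbb Z^2$ let $T_B=\inf\{i\ge 0: X_i\in B\}$ and $H_B(x,y)=\mathbb P^x(T_B<\infty,\ X_{T_B}=y)$.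 Then there are constants $C$ and $n_0$, depending only on $p$ and $\beta$, such that for all integers $n\ge n_0$, all real $r,R$ with $e^n\le r=R/n^3$, all $x,x'\in\partial D(0,R)_{n^4}$ and all $y\in\partial D(0,r)_{n^4}$ the following hold, where $A=D(0,r+n^4)$, $E=D(0,n^3R)^c$, and $a=(1+O(n^{-3}\log n))\,b$ means $|a-b|\le C\,n^{-3}(\log n)\,b$: $$H_{A}(x,y)=\bigl(1+O(n^{-3}\log n)\bigr)\,H_{A}(x',y),$$ $$\mathbb P^{x}\bigl(X_{T_A}=y,\ T_A<T_E\bigr)=\bigl(1+O(n^{-3}\log n)\bigr)\,\mathbb P^{x}(T_A<T_E)\,H_{A}(x,y),$$ $$\mathbb P^{x}\bigl(X_{T_A}=y,\ T_A<T_E\bigr)=\bigl(1+O(n^{-3}\log n)\bigr)\,\mathbb P^{x'}\bigl(X_{T_A}=y,\ T_A<T_E\bigr).$$ -/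

import Mathlib

open MeasureTheory

noncomputable section

namespace LatticeWalk

/-- The Euclidean norm of a point of the lattice `ℤ²`. -/
def enorm2 (z : ℤ × ℤ) : ℝ := Real.sqrt ((z.1 : ℝ) ^ 2 + (z.2 : ℝ) ^ 2)

/-- The open discrete disc `D(x, r) = {y ∈ ℤ² : |y - x| < r}`. -/
def disc (x : ℤ × ℤ) (r : ℝ) : Set (ℤ × ℤ) := {y | enorm2 (y - x) < r}

/-- The `s`-band `∂A_s = {y ∉ A : inf_{x ∈ A} |y - x| ≤ s}` of a set `A ⊆ ℤ²`. Only finitely many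
lattice points lie in a bounded region, so for nonempty `A` the infimum is attained (and the band
of the empty set is empty, the infimum being `+∞` there). -/
def band (A : Set (ℤ × ℤ)) (s : ℝ) : Set (ℤ × ℤ) := {y | y ∉ A ∧ ∃ x ∈ A, enorm2 (y - x) ≤ s}

/-- The step distribution `p` is symmetric: `p(-z) = p(z)`. -/
def IsSymmetric (p : PMF (ℤ × ℤ)) : Prop := ∀ z, p (-z) = p z

/-- Strong aperiodicity (Spitzer): for every `x`, the translate `x + {z : p(z) > 0}` of the support
generates the whole group `ℤ²`. -/
def StronglyAperiodic (p : PMF (ℤ × ℤ)) : Prop :=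
  ∀ x : ℤ × ℤ, AddSubgroup.closure {y | ∃ z ∈ p.support, y = x + z} = ⊤

/-- `E[(X^{(1)})²] = E[(X^{(2)})²] = 1` and `E[X^{(1)} X^{(2)}] = 0` for a step `X` with law `p`;
for a symmetric `p` (mean zero) this says that the covariance matrix is the identity. -/
def HasIdentityCovariance (p : PMF (ℤ × ℤ)) : Prop :=
  HasSum (fun z : ℤ × ℤ => (p z).toReal * (z.1 : ℝ) ^ 2) 1 ∧
  HasSum (fun z : ℤ × ℤ => (p z).toReal * (z.2 : ℝ) ^ 2) 1 ∧
  HasSum (fun z : ℤ × ℤ => (p z).toReal * ((z.1 : ℝ) * (z.2 : ℝ))) 0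

/-- `E|X|^q < ∞` for a step `X` with law `p`. -/
def HasFiniteMoment (p : PMF (ℤ × ℤ)) (q : ℝ) : Prop :=
  Summable fun z : ℤ × ℤ => (p z).toReal * enorm2 z ^ q

/-- Either the walk has finite range, or there are `c > 0` and `s₀` such that for all
`s₀ ≤ s ≤ R` and all `y` with `R ≤ |y| ≤ R + s`, the probability `∑_{z ∈ D(0,R)} p(z - y)` to jump
from `y` into `D(0, R)` is at least `c exp(-β s^{1/4})`. -/
def ConditionA (p : PMF (ℤ × ℤ)) (β : ℝ) : Prop :=
  p.support.Finite ∨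
  ∃ c > 0, ∃ s₀ : ℝ, ∀ s R : ℝ, s₀ ≤ s → s ≤ R →
    ∀ y : ℤ × ℤ, R ≤ enorm2 y → enorm2 y ≤ R + s →
      c * Real.exp (-β * s ^ (1 / 4 : ℝ)) ≤ ∑' z : disc 0 R, (p ((z : ℤ × ℤ) - y)).toReal

/-- The law of an i.i.d. sequence of steps with distribution `p`. -/
def stepsLaw (p : PMF (ℤ × ℤ)) : Measure (ℕ → ℤ × ℤ) :=
  Measure.infinitePi fun _ : ℕ => p.toMeasure

/-- The position `X_k = x + ξ_0 + ⋯ + ξ_{k-1}` at time `k` of the walk started at `x` with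
steps `ξ`. -/
def walk (x : ℤ × ℤ) (ξ : ℕ → ℤ × ℤ) (k : ℕ) : ℤ × ℤ := x + ∑ i ∈ Finset.range k, ξ i

/-- The hitting time `T_B = inf {i ≥ 0 : X_i ∈ B}` of `B` along a path `X` (`⊤` if `B` is never
visited). -/
def hitTime (X : ℕ → ℤ × ℤ) (B : Set (ℤ × ℤ)) : ℕ∞ := ⨅ (i : ℕ) (_ : X i ∈ B), (i : ℕ∞)

/-- The event, for a path `X`, that `T_A < ∞` and `X_{T_A} = y`. -/
def HitsAt (X : ℕ → ℤ × ℤ) (A : Set (ℤ × ℤ)) (y : ℤ × ℤ) : Prop :=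
  ∃ k : ℕ, hitTime X A = k ∧ X k = y

/-- The hitting distribution `H_A(x, y) = P^x(X_{T_A} = y)`. -/
def hitDist (p : PMF (ℤ × ℤ)) (A : Set (ℤ × ℤ)) (x y : ℤ × ℤ) : ℝ :=
  (stepsLaw p).real {ξ | HitsAt (walk x ξ) A y}

/-- `P^x(X_{T_A} = y ; T_A < T_B)`. -/
def hitDistBefore (p : PMF (ℤ × ℤ)) (A B : Set (ℤ × ℤ)) (x y : ℤ × ℤ) : ℝ :=
  (stepsLaw p).real
    {ξ | HitsAt (walk x ξ) A y ∧ hitTime (walk x ξ) A < hitTime (walk x ξ) B}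

/-- `P^x(T_A < T_B)`. -/
def hitBefore (p : PMF (ℤ × ℤ)) (A B : Set (ℤ × ℤ)) (x : ℤ × ℤ) : ℝ :=
  (stepsLaw p).real {ξ | hitTime (walk x ξ) A < hitTime (walk x ξ) B}

end LatticeWalk

end

/-! Let `a = r + n^4` and `A = D(0,a)`, and let `G(z,x)` be the Green function of the walk killed on
entering `A`. The last step before `A`, combined with reversibility, gives `H_A(x,y) = ∑_z p(y-z)
G(z,x)` (`hit_pt_eq_tsum`). The first claim thus concerns walks started near `A`: for two targets
`x`, `x'` of norm at least `R`, the values `G(z,x)` and `G(z,x')` should differ by a factor `1 +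
O(n^{-3} log n)`.

Additive bound. Fourier inversion yields gradient estimates for the heat kernel `p_k`, hence `∑_k
|p_k(x-w) - p_k(x-v)| = O(|w-v|/R)` when `|x| ≥ R` and `|v|, |w| ≤ R/4` (`exists_greenGap_far_le`).
Decomposing the free walk at `T_A` and letting the time horizon grow bounds `G(w,x) - G(w,x')` by
the mean of such sums between `w` and `X_{T_A}` (`green_pt_le`). For `|w|` of order `r` the
difference is `O(r/R) = O(n^{-3})`.

Lower bound. For `3r ≤ |w| ≤ 12r`, the almost harmonic function `log |y|` shows that the walk gets
to distance `4R` before `A` with probability at least of order `1/log n`. The squared distance to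
`D(0,2R)` then shows that the expected time spent in `R ≤ |y| < 4R` is at least of order `R²/log n`.
This annulus has `O(R²)` points and `G(w,·)` is almost constant on it, so `G(w,x) ≥ c/log n`
(`Scales.le_green`).

Transport to the boundary. For `a ≤ |z| < 3r`, stop at the exit from this annulus. Both the additive
error and the lower bound acquire the factor `P^z(leave D(0,3r) before A)`. It cancels, so the ratio
estimate needs no precise knowledge of that probability near `A` (`Scales.green_le_mul`). Overshoots
are controlled by the third moment, at a cost proportional to the same probability.

Long jumps. Terms with `|z| ≥ 3r` contribute `O(r^{-2-2β})`, at most of order `r^{-2} e^{-2βn}`. For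
infinite range, Condition A with `s = n^4` gives `H_A(x,y)` at least of order `e^{-βn}/(r² log n)`,
which is much larger (`Scales.longJumpNegligible`).

The other two claims. By the strong Markov property at the exit from the annulus, `H_A(x,y)` is the
probability of hitting `y` before `E` plus the mean of `H_A(·,y)` over exits into `E`. By the first
claim this mean is nearly `P^x(T_E < T_A) H_A(x,y)`. Optional stopping of the logarithm shows that
`P^x(T_A < T_E)` is at least `1/6` and varies by `O(n^{-3})` over the band. -/

open Filter Set
open scoped ENNReal Topology

noncomputable section

namespace LatticeWalk

/-! ### Operators of the killed walk -/

/-- The transition operator of the walk: `E[f(x + ξ)]`. -/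
def stepOp (p : PMF (ℤ × ℤ)) (f : ℤ × ℤ → ℝ≥0∞) (x : ℤ × ℤ) : ℝ≥0∞ := ∑' z, p z * f (x + z)

/-- `E^x[f(X_n); n < T_S]`. -/
def survive (p : PMF (ℤ × ℤ)) (S : Set (ℤ × ℤ)) : ℕ → (ℤ × ℤ → ℝ≥0∞) → ℤ × ℤ → ℝ≥0∞
  | 0, f => Sᶜ.indicator f
  | n + 1, f => Sᶜ.indicator (stepOp p (survive p S n f))

/-- `E^x[f(X_n); T_S = n]`. -/
def firstHit (p : PMF (ℤ × ℤ)) (S : Set (ℤ × ℤ)) : ℕ → (ℤ × ℤ → ℝ≥0∞) → ℤ × ℤ → ℝ≥0∞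
  | 0, f => S.indicator f
  | n + 1, f => Sᶜ.indicator (stepOp p (firstHit p S n f))

/-- The Green operator of the walk killed on entering `S`. -/
def green (p : PMF (ℤ × ℤ)) (S : Set (ℤ × ℤ)) (f : ℤ × ℤ → ℝ≥0∞) (x : ℤ × ℤ) : ℝ≥0∞ :=
  ∑' n, survive p S n f x

/-- `E^x[f(X_{T_S}); T_S < ∞]`. -/
def hit (p : PMF (ℤ × ℤ)) (S : Set (ℤ × ℤ)) (f : ℤ × ℤ → ℝ≥0∞) (x : ℤ × ℤ) : ℝ≥0∞ :=
  ∑' n, firstHit p S n f x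

/-- The indicator function of a lattice point. -/
abbrev pt (y : ℤ × ℤ) : ℤ × ℤ → ℝ≥0∞ := Pi.single y 1

variable {p : PMF (ℤ × ℤ)} {S : Set (ℤ × ℤ)}

theorem stepOp_mono {f g : ℤ × ℤ → ℝ≥0∞} (h : f ≤ g) : stepOp p f ≤ stepOp p g := fun _ =>
  ENNReal.tsum_le_tsum fun _ => mul_le_mul_right (h _) _

theorem stepOp_add (f g : ℤ × ℤ → ℝ≥0∞) : stepOp p (f + g) = stepOp p f + stepOp p g := by
  ext x; simp [stepOp, mul_add, ENNReal.tsum_add]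

theorem stepOp_const_mul (c : ℝ≥0∞) (f : ℤ × ℤ → ℝ≥0∞) :
    stepOp p (fun x => c * f x) = fun x => c * stepOp p f x := by
  ext x; simp [stepOp, ← ENNReal.tsum_mul_left, mul_left_comm]

theorem stepOp_tsum {ι : Type*} (f : ι → ℤ × ℤ → ℝ≥0∞) :
    stepOp p (fun x => ∑' i, f i x) = fun x => ∑' i, stepOp p (f i) x := by
  ext x
  simp only [stepOp, ← ENNReal.tsum_mul_left]
  exact ENNReal.tsum_comm

theorem stepOp_one : stepOp p 1 = 1 := by
  ext x; simp [stepOp, p.tsum_coe]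

theorem survive_of_mem {x : ℤ × ℤ} (hx : x ∈ S) (n : ℕ) (f) : survive p S n f x = 0 := by
  cases n <;> simp [survive, hx]

theorem survive_zero_of_notMem {x : ℤ × ℤ} (hx : x ∉ S) (f) : survive p S 0 f x = f x := by
  simp [survive, hx]

theorem survive_succ_of_notMem {x : ℤ × ℤ} (hx : x ∉ S) (n : ℕ) (f) :
    survive p S (n + 1) f x = stepOp p (survive p S n f) x := by
  simp [survive, hx]

theorem firstHit_zero_of_mem {x : ℤ × ℤ} (hx : x ∈ S) (f) : firstHit p S 0 f x = f x := by
  simp [firstHit, hx]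

theorem firstHit_zero_of_notMem {x : ℤ × ℤ} (hx : x ∉ S) (f) : firstHit p S 0 f x = 0 := by
  simp [firstHit, hx]

theorem firstHit_succ_of_mem {x : ℤ × ℤ} (hx : x ∈ S) (n : ℕ) (f) :
    firstHit p S (n + 1) f x = 0 := by
  simp [firstHit, hx]

theorem firstHit_succ_of_notMem {x : ℤ × ℤ} (hx : x ∉ S) (n : ℕ) (f) :
    firstHit p S (n + 1) f x = stepOp p (firstHit p S n f) x := by
  simp [firstHit, hx]

theorem green_of_mem {x : ℤ × ℤ} (hx : x ∈ S) (f) : green p S f x = 0 := by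
  simp [green, survive_of_mem hx]

theorem hit_of_mem {x : ℤ × ℤ} (hx : x ∈ S) (f) : hit p S f x = f x := by
  rw [hit, tsum_eq_single 0, firstHit_zero_of_mem hx]
  intro n hn
  obtain ⟨m, rfl⟩ := Nat.exists_eq_succ_of_ne_zero hn
  exact firstHit_succ_of_mem hx m f

theorem survive_mono {f g : ℤ × ℤ → ℝ≥0∞} (h : ∀ x ∉ S, f x ≤ g x) (n : ℕ) (x : ℤ × ℤ) :
    survive p S n f x ≤ survive p S n g x := by
  induction n generalizing x with
  | zero => by_cases hx : x ∈ S <;> simp [survive, hx, h]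
  | succ n ih =>
    by_cases hx : x ∈ S
    · simp [survive, hx]
    · rw [survive_succ_of_notMem hx, survive_succ_of_notMem hx]
      exact stepOp_mono (fun y => ih y) x

theorem firstHit_mono {f g : ℤ × ℤ → ℝ≥0∞} (h : ∀ x ∈ S, f x ≤ g x) (n : ℕ) (x : ℤ × ℤ) :
    firstHit p S n f x ≤ firstHit p S n g x := by
  induction n generalizing x with
  | zero => by_cases hx : x ∈ S <;> simp [firstHit, hx, h]
  | succ n ih =>
    by_cases hx : x ∈ S
    · simp [firstHit, hx]
    · rw [firstHit_succ_of_notMem hx, firstHit_succ_of_notMem hx]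
      exact stepOp_mono (fun y => ih y) x

theorem green_mono {f g : ℤ × ℤ → ℝ≥0∞} (h : ∀ x ∉ S, f x ≤ g x) (x : ℤ × ℤ) :
    green p S f x ≤ green p S g x := ENNReal.tsum_le_tsum fun n => survive_mono h n x

theorem hit_mono {f g : ℤ × ℤ → ℝ≥0∞} (h : ∀ x ∈ S, f x ≤ g x) (x : ℤ × ℤ) :
    hit p S f x ≤ hit p S g x := ENNReal.tsum_le_tsum fun n => firstHit_mono h n x

theorem survive_congr {f g : ℤ × ℤ → ℝ≥0∞} (h : ∀ x ∉ S, f x = g x) (n : ℕ) (x : ℤ × ℤ) :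
    survive p S n f x = survive p S n g x :=
  le_antisymm (survive_mono (fun x hx => (h x hx).le) n x)
    (survive_mono (fun x hx => (h x hx).ge) n x)

theorem firstHit_congr {f g : ℤ × ℤ → ℝ≥0∞} (h : ∀ x ∈ S, f x = g x) (n : ℕ) (x : ℤ × ℤ) :
    firstHit p S n f x = firstHit p S n g x :=
  le_antisymm (firstHit_mono (fun x hx => (h x hx).le) n x)
    (firstHit_mono (fun x hx => (h x hx).ge) n x)

theorem hit_congr {f g : ℤ × ℤ → ℝ≥0∞} (h : ∀ x ∈ S, f x = g x) (x : ℤ × ℤ) :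
    hit p S f x = hit p S g x := tsum_congr fun n => firstHit_congr h n x

theorem survive_add (n : ℕ) (f g : ℤ × ℤ → ℝ≥0∞) :
    survive p S n (f + g) = survive p S n f + survive p S n g := by
  induction n with
  | zero => exact indicator_add _ _ _
  | succ n ih => rw [survive, ih, stepOp_add, indicator_add']; rfl

theorem firstHit_add (n : ℕ) (f g : ℤ × ℤ → ℝ≥0∞) :
    firstHit p S n (f + g) = firstHit p S n f + firstHit p S n g := by
  induction n with
  | zero => exact indicator_add _ _ _
  | succ n ih => rw [firstHit, ih, stepOp_add, indicator_add']; rfl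

theorem survive_const_mul (n : ℕ) (c : ℝ≥0∞) (f : ℤ × ℤ → ℝ≥0∞) (x : ℤ × ℤ) :
    survive p S n (fun y => c * f y) x = c * survive p S n f x := by
  induction n generalizing x with
  | zero => by_cases hx : x ∈ S <;> simp [survive, hx]
  | succ n ih =>
    by_cases hx : x ∈ S
    · simp [survive, hx]
    · rw [survive_succ_of_notMem hx, survive_succ_of_notMem hx,
        ← congrFun (stepOp_const_mul c (survive p S n f)) x, funext ih]

theorem firstHit_const_mul (n : ℕ) (c : ℝ≥0∞) (f : ℤ × ℤ → ℝ≥0∞) (x : ℤ × ℤ) :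
    firstHit p S n (fun y => c * f y) x = c * firstHit p S n f x := by
  induction n generalizing x with
  | zero => by_cases hx : x ∈ S <;> simp [firstHit, hx]
  | succ n ih =>
    by_cases hx : x ∈ S
    · simp [firstHit, hx]
    · rw [firstHit_succ_of_notMem hx, firstHit_succ_of_notMem hx,
        ← congrFun (stepOp_const_mul c (firstHit p S n f)) x, funext ih]

theorem survive_tsum {ι : Type*} (n : ℕ) (f : ι → ℤ × ℤ → ℝ≥0∞) (x : ℤ × ℤ) :
    survive p S n (fun y => ∑' i, f i y) x = ∑' i, survive p S n (f i) x := by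
  induction n generalizing x with
  | zero => by_cases hx : x ∈ S <;> simp [survive, hx]
  | succ n ih =>
    by_cases hx : x ∈ S
    · simp [survive, hx]
    · simp only [survive_succ_of_notMem hx]
      rw [← congrFun (stepOp_tsum fun i => survive p S n (f i)) x, funext ih]

theorem firstHit_tsum {ι : Type*} (n : ℕ) (f : ι → ℤ × ℤ → ℝ≥0∞) (x : ℤ × ℤ) :
    firstHit p S n (fun y => ∑' i, f i y) x = ∑' i, firstHit p S n (f i) x := by
  induction n generalizing x with
  | zero => by_cases hx : x ∈ S <;> simp [firstHit, hx]
  | succ n ih =>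
    by_cases hx : x ∈ S
    · simp [firstHit, hx]
    · simp only [firstHit_succ_of_notMem hx]
      rw [← congrFun (stepOp_tsum fun i => firstHit p S n (f i)) x, funext ih]

theorem green_add (f g : ℤ × ℤ → ℝ≥0∞) : green p S (f + g) = green p S f + green p S g := by
  ext x; simp [green, survive_add, ENNReal.tsum_add]

theorem hit_add (f g : ℤ × ℤ → ℝ≥0∞) : hit p S (f + g) = hit p S f + hit p S g := by
  ext x; simp [hit, firstHit_add, ENNReal.tsum_add]

theorem green_const_mul (c : ℝ≥0∞) (f : ℤ × ℤ → ℝ≥0∞) (x : ℤ × ℤ) :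
    green p S (fun y => c * f y) x = c * green p S f x := by
  simp [green, survive_const_mul, ENNReal.tsum_mul_left]

theorem hit_const_mul (c : ℝ≥0∞) (f : ℤ × ℤ → ℝ≥0∞) (x : ℤ × ℤ) :
    hit p S (fun y => c * f y) x = c * hit p S f x := by
  simp [hit, firstHit_const_mul, ENNReal.tsum_mul_left]

theorem green_tsum {ι : Type*} (f : ι → ℤ × ℤ → ℝ≥0∞) (x : ℤ × ℤ) :
    green p S (fun y => ∑' i, f i y) x = ∑' i, green p S (f i) x := by
  simp only [green, survive_tsum]
  exact ENNReal.tsum_comm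

theorem hit_tsum {ι : Type*} (f : ι → ℤ × ℤ → ℝ≥0∞) (x : ℤ × ℤ) :
    hit p S (fun y => ∑' i, f i y) x = ∑' i, hit p S (f i) x := by
  simp only [hit, firstHit_tsum]
  exact ENNReal.tsum_comm

theorem eq_tsum_pt (f : ℤ × ℤ → ℝ≥0∞) : f = fun x => ∑' y, f y * pt y x := by
  ext x
  rw [tsum_eq_single x]
  · simp
  · intro y hy; simp [hy.symm]

theorem survive_eq_tsum (n : ℕ) (f : ℤ × ℤ → ℝ≥0∞) (x : ℤ × ℤ) :
    survive p S n f x = ∑' y, f y * survive p S n (pt y) x := by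
  conv_lhs => rw [eq_tsum_pt f, survive_tsum]
  simp only [survive_const_mul]

theorem green_eq_tsum (f : ℤ × ℤ → ℝ≥0∞) (x : ℤ × ℤ) :
    green p S f x = ∑' y, f y * green p S (pt y) x := by
  conv_lhs => rw [eq_tsum_pt f, green_tsum]
  simp only [green_const_mul]

/-- Last-step decomposition of `survive`. -/
theorem survive_succ' (n : ℕ) (f : ℤ × ℤ → ℝ≥0∞) (x : ℤ × ℤ) :
    survive p S (n + 1) f x = survive p S n (stepOp p (Sᶜ.indicator f)) x := by
  induction n generalizing x with
  | zero => rfl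
  | succ n ih => rw [survive, funext ih]; rfl

/-- Last-step decomposition of `firstHit`. -/
theorem firstHit_succ' (n : ℕ) (f : ℤ × ℤ → ℝ≥0∞) (x : ℤ × ℤ) :
    firstHit p S (n + 1) f x = survive p S n (stepOp p (S.indicator f)) x := by
  induction n generalizing x with
  | zero => rfl
  | succ n ih => rw [firstHit, funext ih]; rfl

/-- Last-exit decomposition. -/
theorem hit_eq_green {x : ℤ × ℤ} (hx : x ∉ S) (f : ℤ × ℤ → ℝ≥0∞) :
    hit p S f x = green p S (stepOp p (S.indicator f)) x := by
  rw [hit, tsum_eq_zero_add' ENNReal.summable, firstHit_zero_of_notMem hx, zero_add]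
  simp only [firstHit_succ', green]

/-- Reversibility of the killed walk. The induction expands one side at its first step and the other
at its last step; symmetry of `p` matches the two expansions. -/
theorem survive_pt_symm (hp : IsSymmetric p) (n : ℕ) (x y : ℤ × ℤ) :
    survive p S n (pt y) x = survive p S n (pt x) y := by
  induction n generalizing x y with
  | zero =>
    by_cases h : x = y
    · subst h; rfl
    · simp [survive, indicator, h, Ne.symm h]
  | succ n ih =>
    by_cases hx : x ∈ S
    · rw [survive_of_mem hx, survive_succ']
      have : Sᶜ.indicator (pt x) = 0 := by
        ext u; by_cases hu : u = x
        · subst hu; simp [hx]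
        · simp [indicator, hu]
      rw [this]
      have h0 : stepOp p 0 = 0 := by ext; simp [stepOp]
      rw [h0, survive_eq_tsum]; simp
    · rw [survive_succ_of_notMem hx, survive_succ', survive_eq_tsum, stepOp]
      conv_rhs => rw [← (Equiv.addLeft x).tsum_eq]
      refine tsum_congr fun z => ?_
      simp only [Equiv.coe_addLeft]
      rw [ih (x + z) y]
      congr 1
      rw [stepOp, tsum_eq_single (-z)]
      · simp [hx, hp z]
      · intro w hw
        have : x + z + w ≠ x := by
          intro h; apply hw
          rw [add_assoc, add_eq_left] at h
          exact (neg_eq_of_add_eq_zero_right h).symm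
        simp [indicator, this]

theorem green_pt_symm (hp : IsSymmetric p) (x y : ℤ × ℤ) :
    green p S (pt y) x = green p S (pt x) y := tsum_congr fun n => survive_pt_symm hp n x y

/-- Decomposition at the first visit to `S` of a sequence of functions satisfying the backward
equation off `S`. -/
theorem eq_survive_add_sum_firstHit (f : ℕ → ℤ × ℤ → ℝ≥0∞)
    (hf : ∀ n, ∀ x ∉ S, f (n + 1) x = stepOp p (f n) x) (n : ℕ) (x : ℤ × ℤ) :
    f n x = survive p S n (f 0) x
      + ∑ j ∈ Finset.range (n + 1), firstHit p S j (f (n - j)) x := by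
  induction n generalizing x with
  | zero => by_cases hx : x ∈ S <;> simp [survive, firstHit, hx]
  | succ n ih =>
    rw [Finset.sum_range_succ']
    by_cases hx : x ∈ S
    · simp [survive_of_mem hx, firstHit_succ_of_mem hx, firstHit_zero_of_mem hx]
    · simp only [survive_succ_of_notMem hx, firstHit_succ_of_notMem hx,
        firstHit_zero_of_notMem hx, add_zero, Nat.add_sub_add_right]
      rw [hf n x hx]
      conv_lhs => rw [funext ih]
      have h1 : (fun x => survive p S n (f 0) x
          + ∑ j ∈ Finset.range (n + 1), firstHit p S j (f (n - j)) x)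
          = survive p S n (f 0)
            + fun x => ∑' j : Finset.range (n + 1), firstHit p S j (f (n - j)) x := by
        ext y
        simp only [Pi.add_apply]
        rw [Finset.tsum_subtype (Finset.range (n + 1)) fun j => firstHit p S j (f (n - j)) y]
      rw [h1, stepOp_add, stepOp_tsum, Pi.add_apply,
        Finset.tsum_subtype (Finset.range (n + 1)) fun j => stepOp p (firstHit p S j (f (n - j))) x]

theorem tsum_sum_range_eq (a : ℕ → ℕ → ℝ≥0∞) :
    ∑' n, ∑ j ∈ Finset.range (n + 1), a j (n - j) = ∑' j, ∑' m, a j m := by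
  have h (n : ℕ) : ∑ j ∈ Finset.range (n + 1), a j (n - j)
      = ∑' q : Finset.HasAntidiagonal.antidiagonal n, a q.1.1 q.1.2 := by
    rw [← Finset.Nat.sum_antidiagonal_eq_sum_range_succ,
      Finset.tsum_subtype (Finset.HasAntidiagonal.antidiagonal n) fun q => a q.1 q.2]
  simp only [h]
  rw [← ENNReal.tsum_prod, ← Finset.HasAntidiagonal.sigmaAntidiagonalEquivProd.tsum_eq, ENNReal.tsum_sigma']
  rfl

/-- Summation over time of the first-visit decomposition. Both strong Markov identities are
instances, with `f n` the time-`n` term of the Green operator or of the hitting operator of a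
smaller set. -/
theorem tsum_eq_green_add_hit (f : ℕ → ℤ × ℤ → ℝ≥0∞)
    (hf : ∀ n, ∀ x ∉ S, f (n + 1) x = stepOp p (f n) x) (x : ℤ × ℤ) :
    ∑' n, f n x = green p S (f 0) x + hit p S (fun v => ∑' n, f n v) x := by
  rw [tsum_congr fun n => eq_survive_add_sum_firstHit f hf n x, ENNReal.tsum_add,
    tsum_sum_range_eq fun j m => firstHit p S j (f m) x]
  simp only [green, hit, firstHit_tsum]

variable {S' : Set (ℤ × ℤ)}

/-- Strong Markov property for the Green operator. -/
theorem green_eq_green_add_hit (h : S ⊆ S') (g : ℤ × ℤ → ℝ≥0∞) (x : ℤ × ℤ) :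
    green p S g x = green p S' g x + hit p S' (green p S g) x := by
  have := tsum_eq_green_add_hit (p := p) (S := S') (fun n => survive p S n g)
    (fun n y hy => survive_succ_of_notMem (fun h' => hy (h h')) n g) x
  rw [green, this]
  congr 1
  exact tsum_congr fun n => survive_congr
    (fun y hy => survive_zero_of_notMem (fun h' => hy (h h')) g) n x

/-- Strong Markov property for the hitting operator. -/
theorem hit_eq_hit_hit (h : S ⊆ S') (g : ℤ × ℤ → ℝ≥0∞) (x : ℤ × ℤ) :
    hit p S g x = hit p S' (hit p S g) x := by
  have := tsum_eq_green_add_hit (p := p) (S := S') (fun n => firstHit p S n g)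
    (fun n y hy => firstHit_succ_of_notMem (fun h' => hy (h h')) n g) x
  rw [hit, this]
  suffices green p S' (firstHit p S 0 g) x = 0 by rw [this, zero_add]; rfl
  have h0 : ∀ y ∉ S', firstHit p S 0 g y ≤ (0 : ℤ × ℤ → ℝ≥0∞) y := fun y hy =>
    (firstHit_zero_of_notMem (fun h' => hy (h h')) g).le
  refine le_antisymm ((green_mono h0 x).trans ?_) zero_le
  rw [green_eq_tsum]; simp

theorem hit_le_of_le {f : ℤ × ℤ → ℝ≥0∞} {c : ℝ≥0∞} (h : ∀ y ∈ S, f y ≤ c) (x : ℤ × ℤ) :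
    hit p S f x ≤ c * hit p S 1 x := by
  rw [← hit_const_mul]; exact hit_mono (by simpa using h) x

theorem green_le_of_le {f : ℤ × ℤ → ℝ≥0∞} {c : ℝ≥0∞} (h : ∀ y ∉ S, f y ≤ c) (x : ℤ × ℤ) :
    green p S f x ≤ c * green p S 1 x := by
  rw [← green_const_mul]; exact green_mono (by simpa using h) x

/-- Optional stopping for supermartingales, truncated. -/
theorem sum_firstHit_le {F e d : ℤ × ℤ → ℝ≥0∞}
    (h : ∀ x ∉ S, stepOp p F x + e x ≤ F x + d x) (n : ℕ) (x : ℤ × ℤ) :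
    ∑ j ∈ Finset.range (n + 1), firstHit p S j F x + survive p S n F x
        + ∑ j ∈ Finset.range n, survive p S j e x
      ≤ F x + ∑ j ∈ Finset.range n, survive p S j d x := by
  induction n with
  | zero => by_cases hx : x ∈ S <;> simp [survive, firstHit, hx]
  | succ n ih =>
    rw [Finset.sum_range_succ (fun j => firstHit p S j F x) (n + 1),
      Finset.sum_range_succ (fun j => survive p S j e x),
      Finset.sum_range_succ (fun j => survive p S j d x), firstHit_succ', survive_succ']
    have hs : survive p S n (stepOp p (S.indicator F)) x
        + survive p S n (stepOp p (Sᶜ.indicator F)) x = survive p S n (stepOp p F) x := by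
      rw [← Pi.add_apply, ← survive_add, ← stepOp_add, indicator_self_add_compl]
    have hn : survive p S n (stepOp p F) x + survive p S n e x
        ≤ survive p S n F x + survive p S n d x := by
      rw [← Pi.add_apply, ← survive_add, ← Pi.add_apply (survive p S n F), ← survive_add]
      exact survive_mono h n x
    calc _ = ∑ j ∈ Finset.range (n + 1), firstHit p S j F x
          + (survive p S n (stepOp p F) x + survive p S n e x)
          + ∑ j ∈ Finset.range n, survive p S j e x := by rw [← hs]; ring
      _ ≤ ∑ j ∈ Finset.range (n + 1), firstHit p S j F x
          + (survive p S n F x + survive p S n d x)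
          + ∑ j ∈ Finset.range n, survive p S j e x := by gcongr
      _ = (∑ j ∈ Finset.range (n + 1), firstHit p S j F x + survive p S n F x
          + ∑ j ∈ Finset.range n, survive p S j e x) + survive p S n d x := by ring
      _ ≤ _ := by rw [← add_assoc]; gcongr

/-- Optional stopping for supermartingales. -/
theorem hit_add_green_le {F e d : ℤ × ℤ → ℝ≥0∞}
    (h : ∀ x ∉ S, stepOp p F x + e x ≤ F x + d x) (x : ℤ × ℤ) :
    hit p S F x + green p S e x ≤ F x + green p S d x := by
  have h1 := ENNReal.tendsto_nat_tsum fun j => firstHit p S j F x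
  have h2 := ENNReal.tendsto_nat_tsum fun j => survive p S j e x
  refine le_of_tendsto' (h1.add h2) fun n => ?_
  calc _ ≤ ∑ j ∈ Finset.range (n + 1), firstHit p S j F x + survive p S n F x
        + ∑ j ∈ Finset.range n, survive p S j e x := by
        rw [Finset.sum_range_succ]
        gcongr
        exact le_self_add.trans le_self_add
    _ ≤ _ := sum_firstHit_le h n x
    _ ≤ _ := by gcongr; exact ENNReal.sum_le_tsum _

/-- Optional stopping for submartingales, truncated. -/
theorem le_sum_firstHit {F e d : ℤ × ℤ → ℝ≥0∞}
    (h : ∀ x ∉ S, F x + e x ≤ stepOp p F x + d x) (n : ℕ) (x : ℤ × ℤ) :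
    F x + ∑ j ∈ Finset.range n, survive p S j e x ≤
      ∑ j ∈ Finset.range (n + 1), firstHit p S j F x + survive p S n F x
        + ∑ j ∈ Finset.range n, survive p S j d x := by
  induction n with
  | zero => by_cases hx : x ∈ S <;> simp [survive, firstHit, hx]
  | succ n ih =>
    rw [Finset.sum_range_succ (fun j => firstHit p S j F x) (n + 1),
      Finset.sum_range_succ (fun j => survive p S j e x),
      Finset.sum_range_succ (fun j => survive p S j d x), firstHit_succ', survive_succ']
    have hs : survive p S n (stepOp p (S.indicator F)) x
        + survive p S n (stepOp p (Sᶜ.indicator F)) x = survive p S n (stepOp p F) x := by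
      rw [← Pi.add_apply, ← survive_add, ← stepOp_add, indicator_self_add_compl]
    have hn : survive p S n F x + survive p S n e x
        ≤ survive p S n (stepOp p F) x + survive p S n d x := by
      rw [← Pi.add_apply, ← survive_add, ← Pi.add_apply (survive p S n (stepOp p F)),
        ← survive_add]
      exact survive_mono h n x
    calc _ ≤ (∑ j ∈ Finset.range (n + 1), firstHit p S j F x + survive p S n F x
          + ∑ j ∈ Finset.range n, survive p S j d x) + survive p S n e x := by
          rw [← add_assoc]; gcongr
      _ = ∑ j ∈ Finset.range (n + 1), firstHit p S j F x
          + (survive p S n F x + survive p S n e x)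
          + ∑ j ∈ Finset.range n, survive p S j d x := by ring
      _ ≤ ∑ j ∈ Finset.range (n + 1), firstHit p S j F x
          + (survive p S n (stepOp p F) x + survive p S n d x)
          + ∑ j ∈ Finset.range n, survive p S j d x := by gcongr
      _ = _ := by rw [← hs]; ring

/-- Optional stopping for submartingales bounded off `S`, if `E^x[T_S] < ∞`. -/
theorem le_hit_add_green {F e d : ℤ × ℤ → ℝ≥0∞} {B : ℝ≥0∞} (hB : B ≠ ⊤)
    (hF : ∀ x ∉ S, F x ≤ B)
    (h : ∀ x ∉ S, F x + e x ≤ stepOp p F x + d x) {x : ℤ × ℤ} (hfin : green p S 1 x ≠ ⊤) :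
    F x + green p S e x ≤ hit p S F x + green p S d x := by
  have h0 : Tendsto (fun n => survive p S n F x) atTop (𝓝 0) := by
    -- The boundary term is at most `B * P^x(n < T_S)`, and these probabilities are the terms of the
    -- convergent series for `E^x[T_S]`.
    have h1 := ENNReal.Tendsto.const_mul (ENNReal.tendsto_atTop_zero_of_tsum_ne_top hfin)
      (Or.inr hB)
    rw [mul_zero] at h1
    refine tendsto_of_tendsto_of_tendsto_of_le_of_le tendsto_const_nhds h1
      (fun _ => zero_le) fun n => ?_
    simp only [← survive_const_mul]
    exact survive_mono (by simpa using hF) n x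
  have h1 := (ENNReal.tendsto_nat_tsum fun j => survive p S j e x).const_add (F x)
  have h2 := h0.const_add (hit p S F x + green p S d x)
  rw [add_zero] at h2
  refine le_of_tendsto_of_tendsto' h1 h2 fun n => (le_sum_firstHit h n x).trans ?_
  rw [add_right_comm]
  gcongr
  · exact ENNReal.sum_le_tsum _
  · exact ENNReal.sum_le_tsum _

theorem hit_one_le (x : ℤ × ℤ) : hit p S 1 x ≤ 1 := by
  have := hit_add_green_le (p := p) (S := S) (F := 1) (e := 0) (d := 0)
    (fun x _ => by simp [stepOp_one]) x
  refine le_self_add.trans (this.trans ?_)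
  rw [green_eq_tsum]; simp

theorem hit_one_eq_one {x : ℤ × ℤ} (hfin : green p S 1 x ≠ ⊤) : hit p S 1 x = 1 := by
  refine le_antisymm (hit_one_le x) ?_
  have := le_hit_add_green (p := p) (S := S) (F := 1) (e := 0) (d := 0) ENNReal.one_ne_top
    (fun _ _ => le_rfl) (fun x _ => by simp [stepOp_one]) hfin
  refine le_self_add.trans (this.trans ?_)
  rw [green_eq_tsum]; simp

end LatticeWalk

namespace LatticeWalk

/-! ### Path space -/

variable {p : PMF (ℤ × ℤ)} {S : Set (ℤ × ℤ)}

instance : IsProbabilityMeasure (stepsLaw p) := by unfold stepsLaw; infer_instance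

/-- Prepend a step to a sequence of steps. -/
def consStep (q : (ℤ × ℤ) × (ℕ → ℤ × ℤ)) : ℕ → ℤ × ℤ
  | 0 => q.1
  | n + 1 => q.2 n

theorem measurable_consStep : Measurable consStep := by
  refine measurable_pi_lambda _ fun n => ?_
  cases n with
  | zero => exact measurable_fst
  | succ n => exact (measurable_pi_apply n).comp measurable_snd

/-- The Markov property at time one on path space: a fresh step put in front of an i.i.d. sequence
gives an i.i.d. sequence. A product measure is determined by its values on boxes with finitely many
constrained coordinates. -/
theorem stepsLaw_eq_map :
    ((p.toMeasure).prod (stepsLaw p)).map consStep = stepsLaw p := by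
  refine Measure.eq_infinitePi _ fun s t ht => ?_
  classical
  obtain ⟨N, hN⟩ : ∃ N, s ⊆ Finset.range (N + 1) :=
    ⟨s.sup id, fun i hi => Finset.mem_range_succ_iff.2 (Finset.le_sup (f := id) hi)⟩
  -- Padding by `univ` turns the constrained coordinates into an initial segment, so that the
  -- preimage under `consStep` is again a box.
  let t' : ℕ → Set (ℤ × ℤ) := fun i => if i ∈ s then t i else univ
  have ht' : ∀ i, MeasurableSet (t' i) := fun i => by
    by_cases h : i ∈ s <;> simp [t', h, ht]
  have h1 : Set.pi s t = Set.pi (Finset.range (N + 1)) t' := by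
    ext ξ
    simp only [Set.mem_pi, Finset.mem_coe, t']
    refine ⟨fun h i _ => ?_, fun h i hi => ?_⟩
    · by_cases hi : i ∈ s <;> simp [hi, h]
    · simpa [hi] using h i (hN hi)
  have h2 : ∏ i ∈ s, p.toMeasure (t i) = ∏ i ∈ Finset.range (N + 1), p.toMeasure (t' i) := by
    rw [← Finset.prod_subset hN (fun i _ hi => by simp [t', hi])]
    exact Finset.prod_congr rfl fun i hi => by simp [t', hi]
  have h3 : consStep ⁻¹' (Set.pi (Finset.range (N + 1)) t')
      = t' 0 ×ˢ Set.pi (Finset.range N) fun i => t' (i + 1) := by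
    ext ⟨z, ξ⟩
    simp only [mem_preimage, Set.mem_pi, Finset.mem_coe, Finset.mem_range, mem_prod]
    refine ⟨fun h => ⟨h 0 (by omega), fun i hi => h (i + 1) (by omega)⟩, fun h i hi => ?_⟩
    cases i with
    | zero => exact h.1
    | succ i => exact h.2 i (by omega)
  rw [h1, h2, Measure.map_apply measurable_consStep
    (MeasurableSet.pi (Finset.countable_toSet _) fun i _ => ht' i), h3, Measure.prod_prod,
    stepsLaw, Measure.infinitePi_pi _ (fun i _ => ht' (i + 1)), Finset.prod_range_succ', mul_comm]

theorem stepsLaw_apply_eq_tsum {U : Set (ℕ → ℤ × ℤ)} (hU : MeasurableSet U) :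
    stepsLaw p U = ∑' z, p z * stepsLaw p {ξ | consStep (z, ξ) ∈ U} := by
  conv_lhs => rw [← stepsLaw_eq_map]
  rw [Measure.map_apply measurable_consStep hU, Measure.prod_apply (measurable_consStep hU),
    lintegral_countable']
  refine tsum_congr fun z => ?_
  rw [p.toMeasure_apply_singleton _ (measurableSet_singleton z), mul_comm]
  rfl

theorem walk_zero (x : ℤ × ℤ) (ξ) : walk x ξ 0 = x := by simp [walk]

theorem walk_consStep_succ (x z : ℤ × ℤ) (ξ) (k : ℕ) :
    walk x (consStep (z, ξ)) (k + 1) = walk (x + z) ξ k := by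
  simp only [walk, Finset.sum_range_succ', consStep]
  abel

theorem measurable_walk (x : ℤ × ℤ) (k : ℕ) : Measurable fun ξ => walk x ξ k := by
  unfold walk; fun_prop

/-- The path `X` first visits `S` at time `n`, at the point `y`. -/
def FirstVisit (S : Set (ℤ × ℤ)) (y : ℤ × ℤ) (n : ℕ) (X : ℕ → ℤ × ℤ) : Prop :=
  (∀ k < n, X k ∉ S) ∧ X n ∈ S ∧ X n = y

theorem measurableSet_firstVisit (x y : ℤ × ℤ) (n : ℕ) :
    MeasurableSet {ξ | FirstVisit S y n (walk x ξ)} := by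
  have h (k : ℕ) (B : Set (ℤ × ℤ)) : MeasurableSet {ξ : ℕ → ℤ × ℤ | walk x ξ k ∈ B} :=
    measurable_walk x k (MeasurableSet.of_discrete (s := B))
  simp only [FirstVisit, ofPred_and, ofPred_forall]
  exact (MeasurableSet.iInter fun k => MeasurableSet.iInter fun _ => h k Sᶜ).inter
    ((h n S).inter (h n {y}))

/-- The bridge from path space to operators: conditioning on the first step reproduces the recursion
that defines `firstHit`. All estimates are made on the operator side. -/
theorem stepsLaw_firstVisit (n : ℕ) (x y : ℤ × ℤ) :
    stepsLaw p {ξ | FirstVisit S y n (walk x ξ)} = firstHit p S n (pt y) x := by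
  induction n generalizing x with
  | zero =>
    by_cases hx : x ∈ S
    · by_cases hy : x = y
      · subst hy; simp [FirstVisit, walk_zero, firstHit, hx]
      · simp [FirstVisit, walk_zero, firstHit, hx, hy]
    · simp [FirstVisit, walk_zero, firstHit, hx]
  | succ n ih =>
    by_cases hx : x ∈ S
    · have : {ξ | FirstVisit S y (n + 1) (walk x ξ)} = ∅ := by
        ext ξ
        simp only [FirstVisit, mem_ofPred_eq, mem_empty_iff_false, iff_false, not_and]
        intro h
        exact absurd (h 0 (by omega)) (by simpa [walk_zero])
      rw [this, firstHit_succ_of_mem hx, measure_empty]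
    · rw [firstHit_succ_of_notMem hx, stepsLaw_apply_eq_tsum (measurableSet_firstVisit x y _),
        stepOp]
      refine tsum_congr fun z => ?_
      rw [← ih]
      congr 2
      ext ξ
      simp only [FirstVisit, mem_ofPred_eq, walk_consStep_succ]
      refine and_congr_left fun _ => ⟨fun h k hk => ?_, fun h k hk => ?_⟩
      · simpa only [walk_consStep_succ] using h (k + 1) (by omega)
      · cases k with
        | zero => simpa [walk_zero] using hx
        | succ k => simpa only [walk_consStep_succ] using h k (by omega)

/-! ### Hitting times and hitting operators -/

theorem hitTime_eq_iff (X : ℕ → ℤ × ℤ) (k : ℕ) :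
    hitTime X S = k ↔ (∀ j < k, X j ∉ S) ∧ X k ∈ S := by
  constructor
  · intro h
    have hle : ∀ j, X j ∈ S → k ≤ j := by
      have := h.ge
      rw [hitTime, le_iInf₂_iff] at this
      exact fun j hj => by exact_mod_cast this j hj
    have hlt : hitTime X S < ((k + 1 : ℕ) : ℕ∞) := by
      rw [h]; exact_mod_cast Nat.lt_succ_self k
    simp only [hitTime, iInf_lt_iff] at hlt
    obtain ⟨i, hi, hik⟩ := hlt
    have hik' : i < k + 1 := by exact_mod_cast hik
    have : i = k := le_antisymm (by omega) (hle i hi)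
    exact ⟨fun j hj hjS => absurd (hle j hjS) (by omega), this ▸ hi⟩
  · rintro ⟨h1, h2⟩
    refine le_antisymm (iInf₂_le k h2) (le_iInf₂ fun j hj => ?_)
    by_contra! hlt
    exact h1 j (by exact_mod_cast hlt) hj

theorem hitsAt_iff (X : ℕ → ℤ × ℤ) (y : ℤ × ℤ) : HitsAt X S y ↔ ∃ n, FirstVisit S y n X := by
  simp only [HitsAt, hitTime_eq_iff, FirstVisit, and_assoc]

theorem setOf_hitsAt_eq_iUnion (x y : ℤ × ℤ) :
    {ξ | HitsAt (walk x ξ) S y} = ⋃ n, {ξ | FirstVisit S y n (walk x ξ)} := by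
  ext ξ; simp [hitsAt_iff]

theorem measurableSet_hitsAt (x y : ℤ × ℤ) : MeasurableSet {ξ | HitsAt (walk x ξ) S y} := by
  rw [setOf_hitsAt_eq_iUnion]
  exact MeasurableSet.iUnion fun n => measurableSet_firstVisit x y n

theorem stepsLaw_hitsAt (x y : ℤ × ℤ) :
    stepsLaw p {ξ | HitsAt (walk x ξ) S y} = hit p S (pt y) x := by
  rw [setOf_hitsAt_eq_iUnion, measure_iUnion _ fun n => measurableSet_firstVisit x y n]
  · simp only [stepsLaw_firstVisit, hit]
  · intro m n hmn
    rw [Function.onFun, Set.disjoint_left]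
    rintro ξ ⟨h1, h2, -⟩ ⟨h3, h4, -⟩
    rcases lt_or_gt_of_ne hmn with h | h
    · exact h3 m h h2
    · exact h1 n h h4

theorem hitDist_eq (x y : ℤ × ℤ) : hitDist p S x y = (hit p S (pt y) x).toReal := by
  rw [hitDist, Measure.real, stepsLaw_hitsAt]

variable {A B : Set (ℤ × ℤ)}

theorem hitTime_lt_iff (X : ℕ → ℤ × ℤ) {k : ℕ} (hk : hitTime X A = k) :
    hitTime X A < hitTime X B ↔ ∀ j ≤ k, X j ∉ B := by
  rw [hk, ← not_le, hitTime]
  have : (⨅ (i : ℕ) (_ : X i ∈ B), (i : ℕ∞)) ≤ k ↔ ∃ i, X i ∈ B ∧ i ≤ k := by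
    simp only [← ENat.lt_natCast_add_one_iff, iInf_lt_iff]
    refine exists_congr fun i => ?_
    rw [exists_prop, ENat.lt_natCast_add_one_iff, Nat.cast_le]
  rw [this]
  push Not
  exact forall_congr' fun i =>
    ⟨fun h hi hB => absurd (h hB) (by omega), fun h hB => by by_contra! hi; exact h hi hB⟩

/-- Turns a race between two sets into one hitting problem for their union, to which the operator
calculus applies. -/
theorem hitsAt_and_lt_iff (X : ℕ → ℤ × ℤ) {y : ℤ × ℤ} (hAB : Disjoint A B) (hy : y ∈ A) :
    HitsAt X A y ∧ hitTime X A < hitTime X B ↔ HitsAt X (A ∪ B) y := by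
  constructor
  · rintro ⟨⟨k, hk, rfl⟩, hlt⟩
    rw [hitTime_lt_iff X hk] at hlt
    rw [hitTime_eq_iff] at hk
    refine ⟨k, (hitTime_eq_iff X k).2 ⟨fun j hj => ?_, Or.inl hy⟩, rfl⟩
    rintro (h | h)
    · exact hk.1 j hj h
    · exact hlt j hj.le h
  · rintro ⟨k, hk, rfl⟩
    rw [hitTime_eq_iff] at hk
    have hkA : hitTime X A = k :=
      (hitTime_eq_iff X k).2 ⟨fun j hj h => hk.1 j hj (Or.inl h), hy⟩
    refine ⟨⟨k, hkA, rfl⟩, (hitTime_lt_iff X hkA).2 fun j hj h => ?_⟩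
    rcases hj.lt_or_eq with h' | rfl
    · exact hk.1 j h' (Or.inr h)
    · exact Set.disjoint_left.1 hAB hy h

theorem hitTime_lt_iff_exists (X : ℕ → ℤ × ℤ) (hAB : Disjoint A B) :
    hitTime X A < hitTime X B ↔ ∃ y : A, HitsAt X (A ∪ B) y := by
  constructor
  · intro h
    obtain ⟨k, hk⟩ := ENat.ne_top_iff_exists.1 h.ne_top
    have hkA := ((hitTime_eq_iff X k).1 hk.symm).2
    exact ⟨⟨X k, hkA⟩, (hitsAt_and_lt_iff X hAB hkA).1 ⟨⟨k, hk.symm, rfl⟩, h⟩⟩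
  · rintro ⟨y, hy⟩
    exact ((hitsAt_and_lt_iff X hAB y.2).2 hy).2

theorem hitDistBefore_eq (hAB : Disjoint A B) (x : ℤ × ℤ) {y : ℤ × ℤ} (hy : y ∈ A) :
    hitDistBefore p A B x y = (hit p (A ∪ B) (pt y) x).toReal := by
  rw [hitDistBefore, Measure.real, ← stepsLaw_hitsAt]
  simp only [hitsAt_and_lt_iff _ hAB hy]

theorem hitBefore_eq (hAB : Disjoint A B) (x : ℤ × ℤ) :
    hitBefore p A B x = (hit p (A ∪ B) (A.indicator 1) x).toReal := by
  have h1 : {ξ | hitTime (walk x ξ) A < hitTime (walk x ξ) B}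
      = ⋃ y : A, {ξ | HitsAt (walk x ξ) (A ∪ B) y} := by
    ext ξ
    simp [hitTime_lt_iff_exists _ hAB]
  have h2 : (A.indicator 1 : ℤ × ℤ → ℝ≥0∞) = fun x => ∑' y : A, pt (y : ℤ × ℤ) x := by
    ext x
    rw [tsum_subtype A fun y => pt y x, tsum_eq_single x]
    · by_cases h : x ∈ A <;> simp [h]
    · intro y hy; by_cases h : y ∈ A <;> simp [h, hy.symm]
  rw [hitBefore, Measure.real, h1,
    measure_iUnion ?_ fun y : A => measurableSet_hitsAt x (y : ℤ × ℤ), h2, hit_tsum]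
  · simp only [stepsLaw_hitsAt]
  · rintro ⟨y, _⟩ ⟨y', _⟩ hne
    rw [Function.onFun, Set.disjoint_left]
    rintro ξ ⟨k, hk, rfl⟩ ⟨k', hk', rfl⟩
    have : k = k' := by exact_mod_cast hk.symm.trans hk'
    exact hne (by subst this; rfl)

end LatticeWalk

namespace LatticeWalk

/-! ### The Euclidean norm on the lattice -/

/-- The lattice point `z` as a complex number. -/
def toC : ℤ × ℤ →+ ℂ where
  toFun z := ⟨z.1, z.2⟩
  map_zero' := by simp [Complex.ext_iff]
  map_add' x y := by simp [Complex.ext_iff]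

theorem toC_re (z : ℤ × ℤ) : (toC z).re = z.1 := rfl
theorem toC_im (z : ℤ × ℤ) : (toC z).im = z.2 := rfl

theorem enorm2_eq_norm (z : ℤ × ℤ) : enorm2 z = ‖toC z‖ := by
  rw [enorm2, Complex.norm_def, Complex.normSq_apply, toC_re, toC_im, sq, sq]

theorem enorm2_nonneg (z : ℤ × ℤ) : 0 ≤ enorm2 z := Real.sqrt_nonneg _

theorem enorm2_sq (z : ℤ × ℤ) : enorm2 z ^ 2 = (z.1 : ℝ) ^ 2 + (z.2 : ℝ) ^ 2 :=
  Real.sq_sqrt (by positivity)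

theorem enorm2_add_le (x y : ℤ × ℤ) : enorm2 (x + y) ≤ enorm2 x + enorm2 y := by
  simp only [enorm2_eq_norm, map_add]; exact norm_add_le _ _

theorem enorm2_sub_le (x y : ℤ × ℤ) : enorm2 (x - y) ≤ enorm2 x + enorm2 y := by
  simp only [enorm2_eq_norm, map_sub]; exact norm_sub_le _ _

theorem enorm2_neg (x : ℤ × ℤ) : enorm2 (-x) = enorm2 x := by
  simp only [enorm2_eq_norm, map_neg, norm_neg]

theorem enorm2_zero : enorm2 0 = 0 := by simp [enorm2]

theorem enorm2_le_add_sub (x y : ℤ × ℤ) : enorm2 x ≤ enorm2 y + enorm2 (x - y) := by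
  simpa using enorm2_add_le y (x - y)

theorem enorm2_sub_comm (x y : ℤ × ℤ) : enorm2 (x - y) = enorm2 (y - x) := by
  rw [← enorm2_neg, neg_sub]

theorem enorm2_eq_zero {z : ℤ × ℤ} : enorm2 z = 0 ↔ z = 0 := by
  rw [enorm2_eq_norm, norm_eq_zero, Complex.ext_iff, toC_re, toC_im, Prod.ext_iff]
  simp

theorem one_le_enorm2 {z : ℤ × ℤ} (hz : z ≠ 0) : 1 ≤ enorm2 z := by
  have h0 : 0 < enorm2 z := lt_of_le_of_ne (enorm2_nonneg z) fun h => hz (enorm2_eq_zero.1 h.symm)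
  have h1 : (0 : ℝ) < ((z.1 ^ 2 + z.2 ^ 2 : ℤ) : ℝ) := by
    have := pow_pos h0 2
    rw [enorm2_sq] at this
    exact_mod_cast this
  have h2 : (1 : ℝ) ≤ ((z.1 ^ 2 + z.2 ^ 2 : ℤ) : ℝ) := by
    have : 0 < z.1 ^ 2 + z.2 ^ 2 := by exact_mod_cast h1
    exact_mod_cast this
  have h3 : (1 : ℝ) ≤ enorm2 z ^ 2 := by rw [enorm2_sq]; exact_mod_cast h2
  nlinarith

theorem abs_fst_le (z : ℤ × ℤ) : |(z.1 : ℝ)| ≤ enorm2 z := by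
  rw [enorm2_eq_norm, ← toC_re]; exact Complex.abs_re_le_norm _

theorem abs_snd_le (z : ℤ × ℤ) : |(z.2 : ℝ)| ≤ enorm2 z := by
  rw [enorm2_eq_norm, ← toC_im]; exact Complex.abs_im_le_norm _

/-! ### Moments -/

variable {p : PMF (ℤ × ℤ)}

/-- The step distribution with real values. -/
abbrev pr (p : PMF (ℤ × ℤ)) (z : ℤ × ℤ) : ℝ := (p z).toReal

theorem pr_nonneg (z : ℤ × ℤ) : 0 ≤ pr p z := ENNReal.toReal_nonneg

theorem hasSum_pr : HasSum (pr p) 1 := by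
  have h := ENNReal.summable_toReal (f := p) p.tsum_coe_ne_top
  have h2 := ENNReal.tsum_toReal_eq (f := p) (fun z => p.apply_ne_top z)
  rw [p.tsum_coe] at h2
  simpa [← h2] using! h.hasSum

/-- Nonzero lattice points have norm at least `1`, so lower powers are dominated by higher ones;
positivity of the exponents takes care of the origin. -/
theorem summable_moment {a b : ℝ} (hb : 0 < b) (hab : b ≤ a) (h : HasFiniteMoment p a) :
    HasFiniteMoment p b := by
  refine Summable.of_nonneg_of_le (fun z => mul_nonneg (pr_nonneg z)
    (Real.rpow_nonneg (enorm2_nonneg z) _)) (fun z => ?_) h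
  refine mul_le_mul_of_nonneg_left ?_ (pr_nonneg z)
  by_cases hz : z = 0
  · subst hz
    rw [enorm2_zero, Real.zero_rpow hb.ne', Real.zero_rpow (hb.trans_le hab).ne']
  · exact Real.rpow_le_rpow_of_exponent_le (one_le_enorm2 hz) hab

theorem summable_moment_nat {a : ℝ} {k : ℕ} (hk : (k : ℝ) ≤ a) (h : HasFiniteMoment p a) :
    Summable fun z => pr p z * enorm2 z ^ k := by
  rcases Nat.eq_zero_or_pos k with rfl | hk0
  · simpa using hasSum_pr.summable
  · have := summable_moment (by exact_mod_cast hk0) hk h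
    simpa [HasFiniteMoment] using this

theorem hasSum_odd_zero (hs : IsSymmetric p) {g : ℤ × ℤ → ℝ} (hg : ∀ z, g (-z) = -g z)
    (hsum : Summable fun z => pr p z * g z) : HasSum (fun z => pr p z * g z) 0 := by
  have h1 : ∑' z, pr p z * g z = ∑' z, -(pr p z * g z) := by
    conv_lhs => rw [← (Equiv.neg (ℤ × ℤ)).tsum_eq]
    refine tsum_congr fun z => ?_
    simp [hg, pr, hs z]
  rw [tsum_neg] at h1
  have : ∑' z, pr p z * g z = 0 := by linarith
  rw [← this]; exact hsum.hasSum

/-! ### Fourier representation of the heat kernel -/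

/-- The law of the sum of `n` steps. -/
def stepPow (p : PMF (ℤ × ℤ)) : ℕ → ℤ × ℤ → ℝ≥0∞
  | 0 => pt 0
  | n + 1 => fun u => ∑' z, p z * stepPow p n (u - z)

theorem survive_empty_eq (n : ℕ) (x y : ℤ × ℤ) :
    survive p ∅ n (pt y) x = stepPow p n (y - x) := by
  induction n generalizing x with
  | zero => simp [survive, stepPow, Pi.single_apply, sub_eq_zero, eq_comm]
  | succ n ih =>
    rw [survive_succ_of_notMem (by simp), stepOp, stepPow]
    simp only [ih, sub_sub]

theorem stepPow_le_one (n : ℕ) (u : ℤ × ℤ) : stepPow p n u ≤ 1 := by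
  induction n generalizing u with
  | zero => rw [stepPow, pt, Pi.single_apply]; split_ifs <;> simp
  | succ n ih =>
    rw [stepPow, ← p.tsum_coe]
    exact ENNReal.tsum_le_tsum fun z => mul_le_of_le_one_right' (ih _)

theorem stepPow_ne_top (n : ℕ) (u : ℤ × ℤ) : stepPow p n u ≠ ⊤ :=
  ne_top_of_le_ne_top ENNReal.one_ne_top (stepPow_le_one n u)

/-- The law of the sum of `n` steps, with real values. -/
def heat (p : PMF (ℤ × ℤ)) (n : ℕ) (u : ℤ × ℤ) : ℝ := (stepPow p n u).toReal

theorem heat_zero (u : ℤ × ℤ) : heat p 0 u = if u = 0 then 1 else 0 := by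
  rw [heat, stepPow, pt, Pi.single_apply]; split_ifs <;> simp

theorem heat_nonneg (n : ℕ) (u : ℤ × ℤ) : 0 ≤ heat p n u := ENNReal.toReal_nonneg

theorem heat_succ (n : ℕ) (u : ℤ × ℤ) : heat p (n + 1) u = ∑' z, pr p z * heat p n (u - z) := by
  rw [heat, stepPow, ENNReal.tsum_toReal_eq fun z =>
    ENNReal.mul_ne_top (p.apply_ne_top z) (stepPow_ne_top n _)]
  simp only [ENNReal.toReal_mul, heat]

/-- The angle `z · θ`. -/
def ang (z : ℤ × ℤ) (θ : ℝ × ℝ) : ℝ := z.1 * θ.1 + z.2 * θ.2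

/-- The character `exp(i z · θ)`. -/
def chr (z : ℤ × ℤ) (θ : ℝ × ℝ) : ℂ := Complex.exp (ang z θ * Complex.I)

theorem chr_zero (θ : ℝ × ℝ) : chr 0 θ = 1 := by simp [chr, ang]

theorem chr_add (z w : ℤ × ℤ) (θ : ℝ × ℝ) : chr (z + w) θ = chr z θ * chr w θ := by
  rw [chr, chr, chr, ← Complex.exp_add]
  congr 1
  simp only [ang, Prod.fst_add, Prod.snd_add]
  push_cast; ring

theorem norm_chr (z : ℤ × ℤ) (θ : ℝ × ℝ) : ‖chr z θ‖ = 1 := Complex.norm_exp_ofReal_mul_I _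

theorem continuous_ang (z : ℤ × ℤ) : Continuous (ang z) := by unfold ang; fun_prop

theorem continuous_chr (z : ℤ × ℤ) : Continuous (chr z) := by
  have := continuous_ang z
  unfold chr; fun_prop

theorem norm_chr_sub_one_le (z : ℤ × ℤ) (θ : ℝ × ℝ) : ‖chr z θ - 1‖ ≤ |ang z θ| := by
  rw [chr, mul_comm]
  simpa using Real.norm_exp_I_mul_ofReal_sub_one_le (x := ang z θ)

/-- The square `[-π, π]²`. -/
def torus : Set (ℝ × ℝ) := Icc (-Real.pi) Real.pi ×ˢ Icc (-Real.pi) Real.pi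

theorem isCompact_torus : IsCompact torus := isCompact_Icc.prod isCompact_Icc

theorem integral_exp_int (k : ℤ) :
    ∫ t in Icc (-Real.pi) Real.pi, Complex.exp (k * t * Complex.I)
      = if k = 0 then 2 * (Real.pi : ℂ) else 0 := by
  have hle : -Real.pi ≤ Real.pi := by linarith [Real.pi_pos]
  rw [integral_Icc_eq_integral_Ioc, ← intervalIntegral.integral_of_le hle]
  split_ifs with hk
  · subst hk
    simp; ring
  · have hc : (k * Complex.I : ℂ) ≠ 0 := mul_ne_zero (by exact_mod_cast hk) Complex.I_ne_zero
    have h1 : (fun t : ℝ => Complex.exp (k * t * Complex.I))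
        = fun t : ℝ => Complex.exp (k * Complex.I * t) := by
      ext t; ring_nf
    rw [h1, integral_exp_mul_complex hc]
    have h2 : Complex.exp (k * Complex.I * (Real.pi : ℝ))
        = Complex.exp (k * Complex.I * ((-Real.pi : ℝ) : ℂ)) := by
      rw [Complex.exp_eq_exp_iff_exists_int]
      refine ⟨k, ?_⟩
      push_cast; ring
    rw [h2, sub_self, zero_div]

theorem integral_chr (u : ℤ × ℤ) :
    ∫ θ in torus, chr u θ = if u = 0 then (2 * Real.pi : ℂ) ^ 2 else 0 := by
  have h1 : ∀ θ : ℝ × ℝ, chr u θ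
      = Complex.exp (u.1 * θ.1 * Complex.I) * Complex.exp (u.2 * θ.2 * Complex.I) := by
    intro θ
    rw [chr, ← Complex.exp_add, ang]
    congr 1; push_cast; ring
  simp only [h1]
  rw [torus, Measure.volume_eq_prod, setIntegral_prod_mul (fun t : ℝ =>
    Complex.exp (u.1 * t * Complex.I)) (fun t : ℝ => Complex.exp (u.2 * t * Complex.I)),
    integral_exp_int, integral_exp_int]
  by_cases h1 : u.1 = 0 <;> by_cases h2 : u.2 = 0 <;>
    simp [h1, h2, Prod.ext_iff, sq]

/-- The Fourier transform of a summable function on the lattice. -/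
def ft (a : ℤ × ℤ → ℝ) (θ : ℝ × ℝ) : ℂ := ∑' z, (a z : ℂ) * chr z θ

theorem summable_mul_chr {a : ℤ × ℤ → ℝ} (ha : Summable fun z => |a z|) (θ : ℝ × ℝ) :
    Summable fun z => (a z : ℂ) * chr z θ :=
  Summable.of_norm (by simpa [norm_chr] using ha)

theorem continuous_ft {a : ℤ × ℤ → ℝ} (ha : Summable fun z => |a z|) : Continuous (ft a) := by
  refine continuous_tsum (fun z => continuous_const.mul (continuous_chr z)) ha fun z θ => ?_
  simp [norm_chr]

theorem norm_ft_le {a : ℤ × ℤ → ℝ} (ha : Summable fun z => |a z|) (θ : ℝ × ℝ) :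
    ‖ft a θ‖ ≤ ∑' z, |a z| := by
  refine tsum_of_norm_bounded ha.hasSum fun z => ?_
  simp [norm_chr]

/-- `b` is the inverse Fourier transform of the continuous function `K`. -/
def IsInverseFT (K : ℝ × ℝ → ℂ) (b : ℤ × ℤ → ℝ) : Prop :=
  Continuous K ∧ ∀ u, (b u : ℂ) = ∫ θ in torus, K θ * chr (-u) θ

theorem integrableOn_torus {K : ℝ × ℝ → ℂ} (hK : Continuous K) : IntegrableOn K torus :=
  hK.continuousOn.integrableOn_compact isCompact_torus

theorem IsInverseFT.add {K K' : ℝ × ℝ → ℂ} {b b' : ℤ × ℤ → ℝ} (h : IsInverseFT K b)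
    (h' : IsInverseFT K' b') : IsInverseFT (K + K') (b + b') := by
  refine ⟨h.1.add h'.1, fun u => ?_⟩
  simp only [Pi.add_apply, Complex.ofReal_add, h.2, h'.2, add_mul]
  rw [integral_add]
  · exact integrableOn_torus (h.1.mul (continuous_chr _))
  · exact integrableOn_torus (h'.1.mul (continuous_chr _))

theorem IsInverseFT.const_mul {K : ℝ × ℝ → ℂ} {b : ℤ × ℤ → ℝ} (h : IsInverseFT K b) (c : ℝ) :
    IsInverseFT (fun θ => c * K θ) (fun u => c * b u) := by
  refine ⟨continuous_const.mul h.1, fun u => ?_⟩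
  simp only [Complex.ofReal_mul, h.2, mul_assoc]
  rw [integral_const_mul]

/-- Convolution becomes multiplication. Sum and integral may be exchanged because the norms of the
integrands sum to `(∑ |a z|) * ∫ ‖K‖`. -/
theorem IsInverseFT.hasSum_conv {K : ℝ × ℝ → ℂ} {b a : ℤ × ℤ → ℝ} (h : IsInverseFT K b)
    (ha : Summable fun z => |a z|) (u : ℤ × ℤ) :
    HasSum (fun z => ((a z * b (u - z) : ℝ) : ℂ)) (∫ θ in torus, (K θ * ft a θ) * chr (-u) θ) := by
  let F : ℤ × ℤ → ℝ × ℝ → ℂ := fun z θ => (a z : ℂ) * (K θ * chr (-(u - z)) θ)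
  have hF : ∀ z, Integrable (F z) (volume.restrict torus) := fun z =>
    integrableOn_torus (continuous_const.mul (h.1.mul (continuous_chr _)))
  have hn : ∀ z, ∫ θ in torus, ‖F z θ‖ = |a z| * ∫ θ in torus, ‖K θ‖ := fun z => by
    simp only [F, norm_mul, norm_chr, mul_one]
    rw [integral_const_mul]; simp
  have := hasSum_integral_of_summable_integral_norm hF (by simpa only [hn] using ha.mul_right _)
  have e1 : ∀ z, ∫ θ in torus, F z θ = ((a z * b (u - z) : ℝ) : ℂ) := fun z => by
    simp only [F]
    rw [integral_const_mul, ← h.2]; push_cast; rfl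
  have e2 : ∀ θ, ∑' z, F z θ = (K θ * ft a θ) * chr (-u) θ := fun θ => by
    have : ∀ z, F z θ = K θ * chr (-u) θ * ((a z : ℂ) * chr z θ) := fun z => by
      simp only [F]
      rw [show -(u - z) = z + -u by abel, chr_add z (-u)]; ring
    simp only [this]
    rw [tsum_mul_left, ft]; ring
  simpa only [e1, e2] using this

theorem IsInverseFT.conv {K : ℝ × ℝ → ℂ} {b a : ℤ × ℤ → ℝ} (h : IsInverseFT K b)
    (ha : Summable fun z => |a z|) :
    IsInverseFT (fun θ => K θ * ft a θ) (fun u => ∑' z, a z * b (u - z)) := by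
  refine ⟨h.1.mul (continuous_ft ha), fun u => ?_⟩
  rw [← (h.hasSum_conv ha u).tsum_eq, Complex.ofReal_tsum]

theorem IsInverseFT.summable {K : ℝ × ℝ → ℂ} {b a : ℤ × ℤ → ℝ} (h : IsInverseFT K b)
    (ha : Summable fun z => |a z|) (u : ℤ × ℤ) : Summable fun z => a z * b (u - z) := by
  have := (h.hasSum_conv ha u).summable
  exact Complex.summable_ofReal.1 this

theorem IsInverseFT.abs_le {K : ℝ × ℝ → ℂ} {b : ℤ × ℤ → ℝ} (h : IsInverseFT K b) {k : ℝ × ℝ → ℝ}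
    (hk : Continuous k) (hKk : ∀ θ ∈ torus, ‖K θ‖ ≤ k θ) (u : ℤ × ℤ) :
    |b u| ≤ ∫ θ in torus, k θ := by
  rw [← Real.norm_eq_abs, ← Complex.norm_real, h.2]
  refine norm_integral_le_of_norm_le (hk.continuousOn.integrableOn_compact isCompact_torus) ?_
  filter_upwards [ae_restrict_mem isCompact_torus.measurableSet] with θ hθ
  simpa [norm_chr] using hKk θ hθ

/-- A spatial difference inserts a factor `chr (u - v) θ - 1`, of size at most `|ang (u - v) θ|`;
this is the gain of one power of `|θ|` in the gradient bounds. -/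
theorem IsInverseFT.abs_sub_le {K : ℝ × ℝ → ℂ} {b : ℤ × ℤ → ℝ} (h : IsInverseFT K b)
    {k : ℝ × ℝ → ℝ} (hk : Continuous k) (u v : ℤ × ℤ)
    (hKk : ∀ θ ∈ torus, ‖K θ‖ * |ang (u - v) θ| ≤ k θ) :
    |b u - b v| ≤ ∫ θ in torus, k θ := by
  have hi (w : ℤ × ℤ) : IntegrableOn (fun θ => K θ * chr (-w) θ) torus :=
    integrableOn_torus (h.1.mul (continuous_chr _))
  rw [← Real.norm_eq_abs, ← Complex.norm_real, Complex.ofReal_sub, h.2, h.2,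
    ← integral_sub (hi u) (hi v)]
  refine norm_integral_le_of_norm_le (hk.continuousOn.integrableOn_compact isCompact_torus) ?_
  filter_upwards [ae_restrict_mem isCompact_torus.measurableSet] with θ hθ
  have h1 : chr (-v) θ = chr (-u) θ * chr (u - v) θ := by rw [← chr_add]; congr 1; abel
  rw [h1]
  have h2 : K θ * chr (-u) θ - K θ * (chr (-u) θ * chr (u - v) θ)
      = -(K θ * (chr (-u) θ * (chr (u - v) θ - 1))) := by ring
  rw [h2, norm_neg, norm_mul, norm_mul, norm_chr, one_mul]
  exact (mul_le_mul_of_nonneg_left (norm_chr_sub_one_le _ _) (norm_nonneg _)).trans (hKk θ hθ)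

theorem summable_abs_pr : Summable fun z => |pr p z| := hasSum_pr.summable.abs

/-- The normalizing constant of the Fourier inversion formula on `[-π, π]²`. -/
def torusConst : ℝ := ((2 * Real.pi) ^ 2)⁻¹

theorem heat_isInverseFT (n : ℕ) :
    IsInverseFT (fun θ => torusConst * ft (pr p) θ ^ n) (heat p n) := by
  induction n with
  | zero =>
    refine ⟨by simpa using continuous_const, fun u => ?_⟩
    simp only [pow_zero, mul_one]
    rw [integral_const_mul, integral_chr, heat_zero]
    have : (2 * Real.pi : ℂ) ^ 2 ≠ 0 := by
      have := Real.pi_ne_zero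
      exact_mod_cast (by positivity : (2 * Real.pi) ^ 2 ≠ 0)
    by_cases hu : u = 0
    · simp only [hu, neg_zero, if_true, torusConst]; push_cast; rw [inv_mul_cancel₀ this]
    · simp [hu]
  | succ n ih =>
    have := ih.conv (summable_abs_pr (p := p))
    simp only [mul_assoc, ← pow_succ, ← heat_succ] at this
    exact this

/-! ### Fourier transforms of the heat kernel with linear and quadratic weights -/

variable {l : ℤ × ℤ →+ ℝ}

theorem linear_heat_succ (n : ℕ) (h1 : Summable fun z => |pr p z * l z|)
    {K : ℝ × ℝ → ℂ} (hK : IsInverseFT K fun u => l u * heat p n u) (u : ℤ × ℤ) :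
    l u * heat p (n + 1) u
      = ∑' z, (pr p z * l z) * heat p n (u - z) + ∑' z, pr p z * (l (u - z) * heat p n (u - z)) := by
  rw [← ((heat_isInverseFT n).summable h1 u).tsum_add (hK.summable summable_abs_pr u), heat_succ,
    ← tsum_mul_left]
  refine tsum_congr fun z => ?_
  rw [map_sub]; ring

/-- Multiplication by `l` acts as a derivation on convolutions, since `l u = l z + l (u - z)`.
Induction on `n` therefore yields the formula for the derivative of an `n`-th power, with no
differentiation under the integral sign. -/
theorem linear_heat_isInverseFT (h1 : Summable fun z => |pr p z * l z|) (n : ℕ) :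
    IsInverseFT (fun θ => torusConst * (n * ft (pr p) θ ^ (n - 1) * ft (fun z => pr p z * l z) θ))
      (fun u => l u * heat p n u) := by
  induction n with
  | zero =>
    refine ⟨by simpa using continuous_const, fun u => ?_⟩
    by_cases hu : u = 0 <;> simp [heat_zero, hu]
  | succ n ih =>
    have e : (fun u => l u * heat p (n + 1) u) = (fun u => ∑' z, (pr p z * l z) * heat p n (u - z))
        + fun u => ∑' z, pr p z * (l (u - z) * heat p n (u - z)) := by
      ext u; exact linear_heat_succ n h1 ih u
    rw [e]
    convert ((heat_isInverseFT n).conv h1).add (ih.conv (summable_abs_pr (p := p))) using 1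
    ext θ
    simp only [Pi.add_apply, Nat.add_sub_cancel]
    cases n with
    | zero => simp
    | succ m => simp only [Nat.add_sub_cancel]; push_cast; ring

/-- The second-order counterpart, from `l u ^ 2 = l z ^ 2 + 2 * l z * l (u - z) + l (u - z) ^ 2`:
the formula for the second derivative of an `n`-th power. -/
theorem quadratic_heat_isInverseFT (h1 : Summable fun z => |pr p z * l z|)
    (h2 : Summable fun z => |pr p z * l z ^ 2|) (n : ℕ) :
    IsInverseFT (fun θ => torusConst * (n * ft (pr p) θ ^ (n - 1) * ft (fun z => pr p z * l z ^ 2) θ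
        + n * (n - 1 : ℝ) * ft (pr p) θ ^ (n - 2) * ft (fun z => pr p z * l z) θ ^ 2))
      (fun u => l u ^ 2 * heat p n u) := by
  induction n with
  | zero =>
    refine ⟨by simpa using continuous_const, fun u => ?_⟩
    by_cases hu : u = 0 <;> simp [heat_zero, hu]
  | succ n ih =>
    have e : (fun u => l u ^ 2 * heat p (n + 1) u)
        = (fun u => ∑' z, (pr p z * l z ^ 2) * heat p n (u - z))
        + ((fun u => 2 * ∑' z, (pr p z * l z) * (l (u - z) * heat p n (u - z)))
        + fun u => ∑' z, pr p z * (l (u - z) ^ 2 * heat p n (u - z))) := by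
      ext u
      simp only [Pi.add_apply]
      rw [← tsum_mul_left, ← (((linear_heat_isInverseFT h1 n).summable h1 u).mul_left 2).tsum_add
        (ih.summable summable_abs_pr u), ← ((heat_isInverseFT n).summable h2 u).tsum_add
        ((((linear_heat_isInverseFT h1 n).summable h1 u).mul_left 2).add
        (ih.summable summable_abs_pr u)), heat_succ, ← tsum_mul_left]
      refine tsum_congr fun z => ?_
      rw [map_sub]; ring
    rw [e]
    convert ((heat_isInverseFT n).conv h2).add
      ((((linear_heat_isInverseFT h1 n).conv h1).const_mul 2).add
      (ih.conv (summable_abs_pr (p := p)))) using 1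
    ext θ
    simp only [Pi.add_apply, Nat.add_sub_cancel]
    -- The exponents `n - 1` and `n - 2` are truncated for small `n`, where their coefficients
    -- vanish; those cases are checked apart.
    rcases n with _ | _ | m
    · simp
    · simp; ring
    · simp only [show m + 1 + 1 - 1 = m + 1 by omega,
        show m + 1 + 1 + 1 - 2 = m + 1 by omega, show m + 1 + 1 - 2 = m by omega]
      push_cast; ring

end LatticeWalk

namespace LatticeWalk

/-! ### Bounds on the characteristic function -/

variable {p : PMF (ℤ × ℤ)}

/-- The squared Euclidean norm on `ℝ × ℝ`. -/
def sqn (θ : ℝ × ℝ) : ℝ := θ.1 ^ 2 + θ.2 ^ 2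

theorem sqn_nonneg (θ : ℝ × ℝ) : 0 ≤ sqn θ := by unfold sqn; positivity

theorem continuous_sqn : Continuous sqn := by unfold sqn; fun_prop

theorem abs_ang_le (z : ℤ × ℤ) (θ : ℝ × ℝ) : |ang z θ| ≤ enorm2 z * √(sqn θ) := by
  rw [enorm2, ← Real.sqrt_mul (by positivity)]
  refine Real.abs_le_sqrt ?_
  simp only [ang, sqn]
  nlinarith [sq_nonneg ((z.1 : ℝ) * θ.2 - z.2 * θ.1)]

theorem ang_neg (z : ℤ × ℤ) (θ : ℝ × ℝ) : ang (-z) θ = -ang z θ := by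
  simp only [ang, Prod.fst_neg, Prod.snd_neg]; push_cast; ring

/-- The characteristic function of a symmetric step distribution, with real values. -/
def phi (p : PMF (ℤ × ℤ)) (θ : ℝ × ℝ) : ℝ := ∑' z, pr p z * Real.cos (ang z θ)

theorem summable_pr_mul {g : ℤ × ℤ → ℝ} (hg : ∀ z, |g z| ≤ 1) : Summable fun z => pr p z * g z :=
  Summable.of_norm_bounded hasSum_pr.summable fun z => by
    rw [norm_mul, Real.norm_of_nonneg (pr_nonneg z)]
    exact mul_le_of_le_one_right (pr_nonneg z) (hg z)

theorem hasSum_phi (θ : ℝ × ℝ) : HasSum (fun z => pr p z * Real.cos (ang z θ)) (phi p θ) :=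
  (summable_pr_mul fun _ => Real.abs_cos_le_one _).hasSum

theorem ft_pr_eq (hs : IsSymmetric p) (θ : ℝ × ℝ) : ft (pr p) θ = phi p θ := by
  refine HasSum.tsum_eq ?_
  have h1 : HasSum (fun z => pr p z * Real.sin (ang z θ)) 0 :=
    hasSum_odd_zero hs (fun z => by rw [ang_neg, Real.sin_neg])
      (summable_pr_mul fun _ => Real.abs_sin_le_one _)
  rw [Complex.hasSum_iff]
  constructor
  · simpa [chr, Complex.exp_ofReal_mul_I_re] using hasSum_phi (p := p) θ
  · simpa [chr, Complex.exp_ofReal_mul_I_im] using h1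

theorem hasSum_ang_sq (hc : HasIdentityCovariance p) (θ : ℝ × ℝ) :
    HasSum (fun z => pr p z * ang z θ ^ 2) (sqn θ) := by
  have := ((hc.1.mul_left (θ.1 ^ 2)).add (hc.2.1.mul_left (θ.2 ^ 2))).add
    (hc.2.2.mul_left (2 * θ.1 * θ.2))
  rw [show sqn θ = θ.1 ^ 2 * 1 + θ.2 ^ 2 * 1 + 2 * θ.1 * θ.2 * 0 by simp [sqn]]
  have e : (fun z => pr p z * ang z θ ^ 2) = fun z => θ.1 ^ 2 * (pr p z * (z.1 : ℝ) ^ 2)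
      + θ.2 ^ 2 * (pr p z * (z.2 : ℝ) ^ 2) + 2 * θ.1 * θ.2 * (pr p z * ((z.1 : ℝ) * z.2)) := by
    funext z
    simp only [ang]
    ring
  rw [e]
  exact this

theorem one_sub_phi_le (hc : HasIdentityCovariance p) (θ : ℝ × ℝ) :
    1 - sqn θ / 2 ≤ phi p θ := by
  have := (hasSum_pr (p := p)).sub ((hasSum_ang_sq (p := p) hc θ).div_const 2)
  refine hasSum_le (fun z => ?_) this (hasSum_phi θ)
  have h1 := Real.one_sub_sq_div_two_le_cos (x := ang z θ)
  have := mul_le_mul_of_nonneg_left h1 (pr_nonneg (p := p) z)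
  linarith

/-- A cubic error is used because only the third moment is at hand. For `|u| > 1` the cube already
dominates the quadratic term. -/
theorem cos_le_cubic (u : ℝ) : Real.cos u ≤ 1 - u ^ 2 / 2 + |u| ^ 3 := by
  by_cases h : |u| ≤ 1
  · have h1 := (abs_le.1 (Real.cos_bound h)).2
    have h2 : |u| ^ 4 ≤ |u| ^ 3 := pow_le_pow_of_le_one (abs_nonneg u) h (by norm_num)
    have h3 := pow_nonneg (abs_nonneg u) 3
    linarith
  · push Not at h
    have h1 := Real.cos_le_one u
    have h2 : u ^ 2 ≤ |u| ^ 3 := by rw [← sq_abs]; exact pow_le_pow_right₀ h.le (by norm_num)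
    nlinarith [sq_nonneg u]

theorem phi_le_cubic (hc : HasIdentityCovariance p)
    (h3 : Summable fun z => pr p z * enorm2 z ^ 3) (θ : ℝ × ℝ) :
    phi p θ ≤ 1 - sqn θ / 2 + (∑' z, pr p z * enorm2 z ^ 3) * √(sqn θ) ^ 3 := by
  have := ((hasSum_pr (p := p)).sub ((hasSum_ang_sq (p := p) hc θ).div_const 2)).add
    (h3.hasSum.mul_right (√(sqn θ) ^ 3))
  refine hasSum_le (fun z => ?_) (hasSum_phi θ) this
  have h1 := cos_le_cubic (ang z θ)
  have h2 : |ang z θ| ^ 3 ≤ enorm2 z ^ 3 * √(sqn θ) ^ 3 := by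
    rw [← mul_pow]; exact pow_le_pow_left₀ (abs_nonneg _) (abs_ang_le z θ) 3
  have := mul_le_mul_of_nonneg_left (h1.trans (add_le_add_right h2 _)) (pr_nonneg (p := p) z)
  linarith

/-- Equality case of averaging: the nonnegative terms `pr p z * (c - g z)` sum to zero, so each of
them vanishes. -/
theorem eq_of_hasSum_pr {g : ℤ × ℤ → ℝ} {c : ℝ} (hg : ∀ z, g z ≤ c)
    (hsum : HasSum (fun z => pr p z * g z) c) {z : ℤ × ℤ} (hz : z ∈ p.support) : g z = c := by
  have h1 := (hasSum_pr (p := p)).mul_right c |>.sub hsum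
  rw [one_mul, sub_self] at h1
  have h2 := (hasSum_zero_iff_of_nonneg fun w => by
    rw [← mul_sub]; exact mul_nonneg (pr_nonneg w) (sub_nonneg.2 (hg w))).1 h1
  have h3 := congrFun h2 z
  have h4 : pr p z ≠ 0 := (ENNReal.toReal_pos ((p.mem_support_iff z).1 hz) (p.apply_ne_top z)).ne'
  simp only [← mul_sub, Pi.zero_apply, mul_eq_zero, h4, false_or] at h3
  linarith

theorem eq_zero_of_exp_eq_one {t : ℝ} (ht : t ∈ Icc (-Real.pi) Real.pi)
    (h : Complex.exp (t * Complex.I) = 1) : t = 0 := by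
  obtain ⟨n, hn⟩ := Complex.exp_eq_one_iff.1 h
  have h1 : t = n * (2 * Real.pi) := by
    have : ((t : ℝ) : ℂ) * Complex.I = ((n * (2 * Real.pi) : ℝ) : ℂ) * Complex.I := by
      rw [hn]; push_cast; ring
    exact_mod_cast mul_right_cancel₀ Complex.I_ne_zero this
  have hpi := Real.pi_pos
  have h2 : n = 0 := by
    by_contra hne
    rcases lt_or_gt_of_ne hne with hlt | hgt
    · have : (n : ℝ) ≤ -1 := by exact_mod_cast (by omega : n ≤ -1)
      nlinarith [ht.1]
    · have : (1 : ℝ) ≤ n := by exact_mod_cast hgt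
      nlinarith [ht.2]
  rw [h1, h2]; simp

/-- This is the use of strong aperiodicity. A character that is constant on the support is trivial
on the support translated by `-z₀`, hence on the group generated by this translate, which is
everything. -/
theorem eq_zero_of_chr_const (ha : StronglyAperiodic p) {θ : ℝ × ℝ} (hθ : θ ∈ torus) {s : ℂ}
    (hs : ∀ z ∈ p.support, chr z θ = s) : θ = 0 := by
  obtain ⟨z₀, hz₀⟩ := p.support_nonempty
  have h1 : ∀ w : ℤ × ℤ, chr w θ = 1 := by
    intro w
    have hw : w ∈ AddSubgroup.closure {y | ∃ z ∈ p.support, y = -z₀ + z} := by rw [ha]; trivial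
    have hneg : ∀ x : ℤ × ℤ, chr x θ = 1 → chr (-x) θ = 1 := fun x hx => by
      have := chr_add x (-x) θ
      rwa [add_neg_cancel, chr_zero, hx, one_mul, eq_comm] at this
    induction hw using AddSubgroup.closure_induction with
    | mem y hy =>
      obtain ⟨z, hz, rfl⟩ := hy
      have h2 := chr_add (-z₀) z θ
      have h3 := chr_add (-z₀) z₀ θ
      rw [neg_add_cancel, chr_zero, hs z₀ hz₀] at h3
      rw [h2, hs z hz, ← h3]
    | zero => exact chr_zero θ
    | add x y _ _ hx hy => rw [chr_add, hx, hy, one_mul]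
    | neg x _ hx => exact hneg x hx
  have h2 := h1 (1, 0)
  have h3 := h1 (0, 1)
  simp only [chr, ang, Int.cast_one, Int.cast_zero, one_mul, zero_mul, add_zero, zero_add] at h2 h3
  ext
  · exact eq_zero_of_exp_eq_one hθ.1 h2
  · exact eq_zero_of_exp_eq_one hθ.2 h3

/-- If `|phi|` reached `1`, the cosine would equal the same sign `±1` at every point of the support,
the sine would vanish there, and the character would be constant on the support. -/
theorem abs_phi_lt_one (ha : StronglyAperiodic p) {θ : ℝ × ℝ}
    (hθ : θ ∈ torus) (h0 : θ ≠ 0) : |phi p θ| < 1 := by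
  have hexp : ∀ z, chr z θ = Real.cos (ang z θ) + Real.sin (ang z θ) * Complex.I := fun z => by
    rw [chr, Complex.exp_mul_I, Complex.ofReal_cos, Complex.ofReal_sin]
  rw [abs_lt]
  constructor
  · by_contra! hle
    have hge : -1 ≤ phi p θ := by
      have := hasSum_le (fun z => ?_) ((hasSum_pr (p := p)).neg) (hasSum_phi (p := p) θ)
      · exact this
      · have := mul_le_mul_of_nonneg_left (Real.neg_one_le_cos (ang z θ)) (pr_nonneg (p := p) z)
        linarith
    have h1 := (hasSum_phi (p := p) θ).neg
    rw [le_antisymm hle hge, neg_neg] at h1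
    refine h0 (eq_zero_of_chr_const ha hθ (s := -1) fun z hz => ?_)
    have := eq_of_hasSum_pr (p := p) (g := fun z => -Real.cos (ang z θ)) (c := 1)
      (fun z => by linarith [Real.neg_one_le_cos (ang z θ)]) (by simpa using h1) hz
    have hcos : Real.cos (ang z θ) = -1 := by linarith
    have hsin : Real.sin (ang z θ) = 0 := by
      have := Real.sin_sq_add_cos_sq (ang z θ)
      rw [hcos] at this
      exact pow_eq_zero_iff (two_ne_zero) |>.1 (by linarith)
    rw [hexp, hcos, hsin]; simp
  · by_contra! hge
    have hle : phi p θ ≤ 1 := by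
      refine hasSum_le (fun z => ?_) (hasSum_phi (p := p) θ) (hasSum_pr (p := p))
      exact mul_le_of_le_one_right (pr_nonneg z) (Real.cos_le_one _)
    have h1 := hasSum_phi (p := p) θ
    rw [le_antisymm hle hge] at h1
    refine h0 (eq_zero_of_chr_const ha hθ (s := 1) fun z hz => ?_)
    have hcos : Real.cos (ang z θ) = 1 :=
      eq_of_hasSum_pr (p := p) (fun z => Real.cos_le_one (ang z θ)) h1 hz
    have hsin : Real.sin (ang z θ) = 0 := by
      have := Real.sin_sq_add_cos_sq (ang z θ)
      rw [hcos] at this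
      exact pow_eq_zero_iff (two_ne_zero) |>.1 (by linarith)
    rw [hexp, hcos, hsin]; simp

theorem sqn_le_of_mem_torus {θ : ℝ × ℝ} (hθ : θ ∈ torus) : sqn θ ≤ 2 * Real.pi ^ 2 := by
  have h1 : θ.1 ^ 2 ≤ Real.pi ^ 2 := sq_le_sq' hθ.1.1 hθ.1.2
  have h2 : θ.2 ^ 2 ≤ Real.pi ^ 2 := sq_le_sq' hθ.2.1 hθ.2.2
  unfold sqn; linarith

/-- Near the origin the second-order expansion gives `1 - sqn θ / 4`; on the rest of the torus
compactness gives a uniform gap below `1`. Both are converted by `1 - t ≤ exp (-t)`. -/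
theorem exists_abs_phi_le_exp (hs : IsSymmetric p) (ha : StronglyAperiodic p)
    (hc : HasIdentityCovariance p) (h3 : Summable fun z => pr p z * enorm2 z ^ 3) :
    ∃ c > 0, ∀ θ ∈ torus, |phi p θ| ≤ Real.exp (-c * sqn θ) := by
  set m := ∑' z, pr p z * enorm2 z ^ 3 with hm
  have hm0 : 0 ≤ m := tsum_nonneg fun z => mul_nonneg (pr_nonneg z) (pow_nonneg (enorm2_nonneg z) 3)
  -- With this radius the cubic error is at most `sqn θ / 4`, half of the quadratic term.
  let δ : ℝ := 1 / (4 * (m + 1))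
  have hδ : 0 < δ := by positivity
  have hδ1 : δ ≤ 1 := by
    rw [div_le_one (by positivity)]; linarith
  have near : ∀ θ, √(sqn θ) ≤ δ → |phi p θ| ≤ 1 - sqn θ / 4 := by
    intro θ hθ
    have h1 := one_sub_phi_le (p := p) hc θ
    have h2 := phi_le_cubic hc h3 θ
    rw [← hm] at h2
    have h4 : √(sqn θ) ^ 2 = sqn θ := Real.sq_sqrt (sqn_nonneg θ)
    have h5 : 0 ≤ √(sqn θ) := Real.sqrt_nonneg _
    have h6 : m * √(sqn θ) ≤ 1 / 4 := by
      calc m * √(sqn θ) ≤ (m + 1) * δ := by gcongr; linarith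
        _ = 1 / 4 := by simp only [δ]; field_simp
    have h7 : m * √(sqn θ) ^ 3 ≤ sqn θ / 4 := by
      have : m * √(sqn θ) ^ 3 = m * √(sqn θ) * √(sqn θ) ^ 2 := by ring
      rw [this, h4]
      nlinarith [sqn_nonneg θ]
    have h8 : sqn θ ≤ 1 := by rw [← h4]; exact pow_le_one₀ h5 (hθ.trans hδ1)
    rw [abs_le]; constructor <;> linarith
  have hcont : Continuous (phi p) := by
    refine Complex.continuous_re.comp (continuous_ft (summable_abs_pr (p := p))) |>.congr fun θ => ?_
    rw [Function.comp, ft_pr_eq hs, Complex.ofReal_re]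
  have hK : IsCompact (torus ∩ {θ | δ ≤ √(sqn θ)}) :=
    isCompact_torus.inter_right (isClosed_le continuous_const continuous_sqn.sqrt)
  obtain ⟨ε, hε, hε1, far⟩ : ∃ ε > 0, ε ≤ 1 ∧ ∀ θ ∈ torus ∩ {θ | δ ≤ √(sqn θ)}, |phi p θ| ≤ 1 - ε := by
    rcases (torus ∩ {θ | δ ≤ √(sqn θ)}).eq_empty_or_nonempty with he | hne
    · exact ⟨1, one_pos, le_rfl, by simp [he]⟩
    · obtain ⟨θ₀, hθ₀, hmax⟩ := hK.exists_isMaxOn hne hcont.abs.continuousOn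
      refine ⟨1 - |phi p θ₀|, ?_, by linarith [abs_nonneg (phi p θ₀)], fun θ hθ => by
        linarith [show |phi p θ| ≤ |phi p θ₀| from hmax hθ]⟩
      have : θ₀ ≠ 0 := by
        rintro rfl
        have := hθ₀.2
        simp only [mem_ofPred_eq, sqn] at this
        simp at this
        linarith
      linarith [abs_phi_lt_one ha hθ₀.1 this]
  have hpi := Real.pi_pos
  -- The gap `ε` of the far region is spread over the range of `sqn`, which is at most `2 * π ^ 2`
  -- on the torus.
  refine ⟨min (1 / 4) (ε / (2 * Real.pi ^ 2)), by positivity, fun θ hθ => ?_⟩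
  have hexp := Real.add_one_le_exp (-min (1 / 4) (ε / (2 * Real.pi ^ 2)) * sqn θ)
  have h0 := sqn_nonneg θ
  rcases le_total (√(sqn θ)) δ with h | h
  · have := near θ h
    have h1 : min (1 / 4) (ε / (2 * Real.pi ^ 2)) * sqn θ ≤ 1 / 4 * sqn θ := by
      gcongr; exact min_le_left _ _
    linarith
  · have := far θ ⟨hθ, h⟩
    have h1 : min (1 / 4) (ε / (2 * Real.pi ^ 2)) * sqn θ
        ≤ ε / (2 * Real.pi ^ 2) * (2 * Real.pi ^ 2) := by
      gcongr
      · exact min_le_right _ _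
      · exact sqn_le_of_mem_torus hθ
    rw [div_mul_cancel₀ _ (by positivity)] at h1
    linarith

/-- The mean vanishes by symmetry, so `chr` may be replaced by `chr - 1`. This gains a factor `|θ|`
at the cost of one more moment. -/
theorem norm_ft_linear_le (hs : IsSymmetric p) {l : ℤ × ℤ →+ ℝ} (hl : ∀ z, |l z| ≤ enorm2 z)
    (h1 : Summable fun z => |pr p z * l z|)
    (h2 : Summable fun z => pr p z * enorm2 z ^ 2) (θ : ℝ × ℝ) :
    ‖ft (fun z => pr p z * l z) θ‖ ≤ (∑' z, pr p z * enorm2 z ^ 2) * √(sqn θ) := by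
  have h0 : HasSum (fun z => ((pr p z * l z : ℝ) : ℂ)) 0 := by
    have := hasSum_odd_zero hs (g := l) (fun z => map_neg l z) h1.of_abs
    rw [← Complex.ofReal_zero, Complex.hasSum_ofReal]
    exact this
  have h4 : HasSum (fun z => ((pr p z * l z : ℝ) : ℂ) * (chr z θ - 1))
      (ft (fun z => pr p z * l z) θ) := by
    have := (summable_mul_chr h1 θ).hasSum.sub h0
    simpa [mul_sub, ft] using this
  rw [← h4.tsum_eq]
  refine tsum_of_norm_bounded (h2.hasSum.mul_right _) fun z => ?_
  rw [norm_mul, Complex.norm_real, norm_mul, Real.norm_of_nonneg (pr_nonneg z), Real.norm_eq_abs]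
  calc pr p z * |l z| * ‖chr z θ - 1‖
      ≤ pr p z * enorm2 z * (enorm2 z * √(sqn θ)) := by
        gcongr
        · exact mul_nonneg (pr_nonneg z) (enorm2_nonneg z)
        · exact hl z
        · exact (norm_chr_sub_one_le z θ).trans (abs_ang_le z θ)
    _ = _ := by ring

end LatticeWalk

namespace LatticeWalk

/-! ### Gaussian integrals and heat kernel bounds -/

variable {p : PMF (ℤ × ℤ)}

/-- Gaussian moment density. -/
def gm (j : ℕ) (a : ℝ) (θ : ℝ × ℝ) : ℝ := √(sqn θ) ^ j * Real.exp (-a * sqn θ)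

theorem continuous_gm (j : ℕ) (a : ℝ) : Continuous (gm j a) := by
  have := continuous_sqn
  unfold gm; fun_prop

theorem pow_le_exp_half_sq {j : ℕ} (hj : j ≤ 3) {t : ℝ} (_ht : 0 ≤ t) :
    t ^ j ≤ 4 * Real.exp (t ^ 2 / 2) := by
  have h1 := Real.add_one_le_exp (t ^ 2 / 4)
  have h2 : Real.exp (t ^ 2 / 2) = Real.exp (t ^ 2 / 4) * Real.exp (t ^ 2 / 4) := by
    rw [← Real.exp_add]; ring_nf
  rw [h2]
  have h3 : (t ^ 2 / 4 + 1) * (t ^ 2 / 4 + 1) ≤ Real.exp (t ^ 2 / 4) * Real.exp (t ^ 2 / 4) := by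
    gcongr
  refine le_trans ?_ (mul_le_mul_of_nonneg_left h3 (by norm_num))
  interval_cases j
  · nlinarith [sq_nonneg t, sq_nonneg (t ^ 2)]
  · nlinarith [sq_nonneg t, sq_nonneg (t ^ 2), sq_nonneg (t - 1)]
  · nlinarith [sq_nonneg t, sq_nonneg (t ^ 2)]
  · nlinarith [sq_nonneg t, sq_nonneg (t ^ 2), sq_nonneg (t ^ 2 - 2 * t), sq_nonneg (t - 1)]

theorem integrable_exp_sqn {b : ℝ} (hb : 0 < b) :
    Integrable fun θ : ℝ × ℝ => Real.exp (-b * sqn θ) := by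
  have := (integrable_exp_neg_mul_sq hb).mul_prod (integrable_exp_neg_mul_sq hb)
  refine this.congr (Eventually.of_forall fun θ => ?_)
  simp only [sqn, ← Real.exp_add]; ring_nf

theorem integral_exp_sqn {b : ℝ} (hb : 0 < b) :
    ∫ θ : ℝ × ℝ, Real.exp (-b * sqn θ) = Real.pi / b := by
  have h1 : ∀ θ : ℝ × ℝ, Real.exp (-b * sqn θ)
      = Real.exp (-b * θ.1 ^ 2) * Real.exp (-b * θ.2 ^ 2) := fun θ => by
    simp only [sqn, ← Real.exp_add]; ring_nf
  simp only [h1]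
  rw [Measure.volume_eq_prod, integral_prod_mul (fun t : ℝ => Real.exp (-b * t ^ 2))
    (fun t : ℝ => Real.exp (-b * t ^ 2)), integral_gaussian, Real.mul_self_sqrt]
  have := Real.pi_pos
  positivity

/-- Half of the exponent absorbs the power of `√a * |θ|`; the remaining Gaussian is integrated over
the whole plane. Each power of `|θ|` is thus worth `a ^ (-1/2)`. -/
theorem integral_gm_le {j : ℕ} (hj : j ≤ 3) {a : ℝ} (ha : 0 < a) :
    ∫ θ in torus, gm j a θ ≤ 8 * Real.pi / (a * √a ^ j) := by
  have hs : 0 < √a := Real.sqrt_pos.2 ha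
  have h1 : ∀ θ, gm j a θ ≤ 4 / √a ^ j * Real.exp (-(a / 2) * sqn θ) := fun θ => by
    have h2 := pow_le_exp_half_sq hj (t := √a * √(sqn θ)) (by positivity)
    rw [mul_pow, mul_pow, Real.sq_sqrt ha.le, Real.sq_sqrt (sqn_nonneg θ)] at h2
    have h3 : Real.exp (-(a / 2) * sqn θ) = Real.exp (a * sqn θ / 2) * Real.exp (-a * sqn θ) := by
      rw [← Real.exp_add]; ring_nf
    rw [gm, h3, ← mul_assoc]
    refine mul_le_mul_of_nonneg_right ?_ (Real.exp_pos _).le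
    rw [div_mul_eq_mul_div, le_div_iff₀ (by positivity)]
    linarith
  have hint := (integrable_exp_sqn (half_pos ha)).const_mul (4 / √a ^ j)
  calc ∫ θ in torus, gm j a θ ≤ ∫ θ in torus, 4 / √a ^ j * Real.exp (-(a / 2) * sqn θ) :=
        integral_mono ((continuous_gm j a).continuousOn.integrableOn_compact isCompact_torus)
          hint.integrableOn h1
    _ ≤ ∫ θ, 4 / √a ^ j * Real.exp (-(a / 2) * sqn θ) :=
        setIntegral_le_integral hint (Eventually.of_forall fun θ => by positivity)
    _ = 8 * Real.pi / (a * √a ^ j) := by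
        rw [integral_const_mul, integral_exp_sqn (half_pos ha)]
        field_simp; ring

theorem integrableOn_gm (j : ℕ) (a : ℝ) : IntegrableOn (gm j a) torus :=
  (continuous_gm j a).continuousOn.integrableOn_compact isCompact_torus

theorem torusConst_pos : 0 < torusConst := by
  have := Real.pi_pos
  unfold torusConst; positivity

/-- The standing assumptions on the step distribution that give the local limit estimates. -/
structure IsRegular (p : PMF (ℤ × ℤ)) : Prop where
  symm : IsSymmetric p
  aper : StronglyAperiodic p
  cov : HasIdentityCovariance p
  mom : Summable fun z => pr p z * enorm2 z ^ 3

theorem IsRegular.summable_sq (h : IsRegular p) : Summable fun z => pr p z * enorm2 z ^ 2 := by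
  have := h.cov.1.summable.add h.cov.2.1.summable
  refine this.congr fun z => ?_
  rw [enorm2_sq]; ring

theorem IsRegular.summable_one (h : IsRegular p) : Summable fun z => pr p z * enorm2 z := by
  refine Summable.of_nonneg_of_le (fun z => mul_nonneg (pr_nonneg z) (enorm2_nonneg z))
    (fun z => ?_) ((hasSum_pr (p := p)).summable.add h.summable_sq)
  rw [← mul_one_add]
  exact mul_le_mul_of_nonneg_left (by nlinarith [sq_nonneg (enorm2 z - 1)]) (pr_nonneg z)

theorem IsRegular.summable_linear (h : IsRegular p) {l : ℤ × ℤ →+ ℝ} (hl : ∀ z, |l z| ≤ enorm2 z) :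
    Summable fun z => |pr p z * l z| := by
  refine Summable.of_nonneg_of_le (fun z => abs_nonneg _) (fun z => ?_) h.summable_one
  rw [abs_mul, abs_of_nonneg (pr_nonneg z)]
  exact mul_le_mul_of_nonneg_left (hl z) (pr_nonneg z)

theorem IsRegular.summable_quadratic (h : IsRegular p) {l : ℤ × ℤ →+ ℝ}
    (hl : ∀ z, |l z| ≤ enorm2 z) : Summable fun z => |pr p z * l z ^ 2| := by
  refine Summable.of_nonneg_of_le (fun z => abs_nonneg _) (fun z => ?_) h.summable_sq
  rw [abs_mul, abs_of_nonneg (pr_nonneg z), abs_pow]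
  exact mul_le_mul_of_nonneg_left (pow_le_pow_left₀ (abs_nonneg _) (hl z) 2) (pr_nonneg z)

/-- Derivatives of the `n`-th power have exponents `n - 1` and `n - 2`. As `sqn` is bounded on the
torus, up to two missing factors cost only a constant, and one Gaussian of parameter `c * n` serves
everywhere. -/
theorem norm_ft_pow_le (hs : IsSymmetric p) {c : ℝ}
    (hφ : ∀ θ ∈ torus, |phi p θ| ≤ Real.exp (-c * sqn θ)) (hc : 0 < c)
    {m n : ℕ} (hmn : n ≤ m + 2) {θ : ℝ × ℝ} (hθ : θ ∈ torus) :
    ‖ft (pr p) θ‖ ^ m ≤ Real.exp (4 * c * Real.pi ^ 2) * Real.exp (-(c * n) * sqn θ) := by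
  rw [ft_pr_eq hs, Complex.norm_real, Real.norm_eq_abs]
  calc |phi p θ| ^ m ≤ Real.exp (-c * sqn θ) ^ m := pow_le_pow_left₀ (abs_nonneg _) (hφ θ hθ) m
    _ = Real.exp (m * (-c * sqn θ)) := by rw [Real.exp_nat_mul]
    _ ≤ _ := by
      rw [← Real.exp_add]
      refine Real.exp_le_exp.2 ?_
      have h1 : (n : ℝ) ≤ m + 2 := by exact_mod_cast hmn
      have h2 := sqn_le_of_mem_torus hθ
      have h3 : c * ((n : ℝ) - m) * sqn θ ≤ c * 2 * (2 * Real.pi ^ 2) := by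
        calc c * ((n : ℝ) - m) * sqn θ ≤ c * 2 * sqn θ := by
              gcongr
              · exact sqn_nonneg θ
              · linarith
          _ ≤ _ := by gcongr
      linarith

theorem exists_heat_le (h : IsRegular p) :
    ∃ C > 0, ∀ n : ℕ, 0 < n → ∀ u, heat p n u ≤ C / n := by
  obtain ⟨c, hc, hφ⟩ := exists_abs_phi_le_exp h.symm h.aper h.cov h.mom
  have hpi := Real.pi_pos
  have hW := Real.exp_pos (4 * c * Real.pi ^ 2)
  set W := Real.exp (4 * c * Real.pi ^ 2)
  have hT := torusConst_pos
  refine ⟨torusConst * W * (8 * Real.pi / c), by positivity, fun n hn u => ?_⟩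
  have hn' : (0 : ℝ) < n := by exact_mod_cast hn
  have h1 := (heat_isInverseFT (p := p) n).abs_le (k := fun θ => torusConst * W * gm 0 (c * n) θ)
    (continuous_const.mul (continuous_gm _ _)) (fun θ hθ => by
      rw [norm_mul, norm_pow, Complex.norm_real, Real.norm_of_nonneg hT.le, mul_assoc]
      refine mul_le_mul_of_nonneg_left ?_ hT.le
      simpa [gm] using norm_ft_pow_le h.symm hφ hc (by omega : n ≤ n + 2) hθ) u
  rw [integral_const_mul] at h1
  have h2 := integral_gm_le (j := 0) (by norm_num) (mul_pos hc hn')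
  calc heat p n u ≤ |heat p n u| := le_abs_self _
    _ ≤ _ := h1
    _ ≤ torusConst * W * (8 * Real.pi / (c * n * √(c * n) ^ 0)) := by gcongr
    _ = _ := by rw [pow_zero, mul_one]; field_simp

theorem exists_abs_heat_sub_le (h : IsRegular p) :
    ∃ C > 0, ∀ n : ℕ, 0 < n → ∀ u v,
      |heat p n u - heat p n v| ≤ C * enorm2 (u - v) / (n * √n) := by
  obtain ⟨c, hc, hφ⟩ := exists_abs_phi_le_exp h.symm h.aper h.cov h.mom
  have hpi := Real.pi_pos
  have hW := Real.exp_pos (4 * c * Real.pi ^ 2)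
  set W := Real.exp (4 * c * Real.pi ^ 2)
  have hT := torusConst_pos
  refine ⟨torusConst * W * (8 * Real.pi / (c * √c)), by positivity, fun n hn u v => ?_⟩
  have hn' : (0 : ℝ) < n := by exact_mod_cast hn
  have he := enorm2_nonneg (u - v)
  have h1 := (heat_isInverseFT (p := p) n).abs_sub_le
    (k := fun θ => torusConst * W * enorm2 (u - v) * gm 1 (c * n) θ)
    (continuous_const.mul (continuous_gm _ _)) u v (fun θ hθ => by
      rw [norm_mul, norm_pow, Complex.norm_real, Real.norm_of_nonneg hT.le]
      calc _ ≤ torusConst * (W * Real.exp (-(c * n) * sqn θ)) * (enorm2 (u - v) * √(sqn θ)) := by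
            gcongr
            · exact norm_ft_pow_le h.symm hφ hc (by omega : n ≤ n + 2) hθ
            · exact abs_ang_le _ _
        _ = _ := by simp only [gm, pow_one]; ring)
  rw [integral_const_mul] at h1
  have h2 := integral_gm_le (j := 1) (by norm_num) (mul_pos hc hn')
  calc _ ≤ _ := h1
    _ ≤ torusConst * W * enorm2 (u - v) * (8 * Real.pi / (c * n * √(c * n) ^ 1)) := by gcongr
    _ = _ := by rw [pow_one, Real.sqrt_mul hc.le]; field_simp

/-- The weight `l u ^ 2` gives decay in space. In Fourier space the two terms have sizes `n |θ|` and
`n² |θ|³` times the Gaussian, and each integrates to order `n ^ (-1/2)`. -/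
theorem exists_sq_mul_abs_heat_sub_le_aux (h : IsRegular p) {l : ℤ × ℤ →+ ℝ}
    (hl : ∀ z, |l z| ≤ enorm2 z) :
    ∃ C > 0, ∀ n : ℕ, 0 < n → ∀ u e, enorm2 e ≤ 1 →
      l u ^ 2 * |heat p n (u + e) - heat p n u| ≤ C / √n := by
  obtain ⟨c, hc, hφ⟩ := exists_abs_phi_le_exp h.symm h.aper h.cov h.mom
  obtain ⟨C₀, hC₀, hheat⟩ := exists_heat_le h
  have hpi := Real.pi_pos
  have hW := Real.exp_pos (4 * c * Real.pi ^ 2)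
  set W := Real.exp (4 * c * Real.pi ^ 2)
  have hT := torusConst_pos
  set m := ∑' z, pr p z * enorm2 z ^ 2 with hm
  have hm0 : 0 ≤ m := tsum_nonneg fun z => mul_nonneg (pr_nonneg z) (sq_nonneg _)
  have hs1 := h.summable_linear hl
  have hs2 := h.summable_quadratic hl
  have hft1 := norm_ft_linear_le h.symm hl hs1 h.summable_sq
  have hft2 : ∀ θ, ‖ft (fun z => pr p z * l z ^ 2) θ‖ ≤ m := fun θ =>
    (norm_ft_le hs2 θ).trans (hs2.tsum_le_tsum (fun z => by
      rw [abs_mul, abs_of_nonneg (pr_nonneg z), abs_pow]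
      exact mul_le_mul_of_nonneg_left (pow_le_pow_left₀ (abs_nonneg _) (hl z) 2) (pr_nonneg z))
      h.summable_sq)
  rw [← hm] at hft1
  have hlin : ∀ n : ℕ, 0 < n → ∀ u, |l u * heat p n u|
      ≤ torusConst * W * m * (8 * Real.pi / (c * √c)) / √n := fun n hn u => by
    have hn' : (0 : ℝ) < n := by exact_mod_cast hn
    have h1 := (linear_heat_isInverseFT hs1 n).abs_le
      (k := fun θ => torusConst * W * m * n * gm 1 (c * n) θ)
      (continuous_const.mul (continuous_gm _ _)) (fun θ hθ => by
        rw [norm_mul, norm_mul, norm_mul, norm_pow, Complex.norm_real, Real.norm_of_nonneg hT.le,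
          Complex.norm_natCast]
        calc _ ≤ torusConst * (n * (W * Real.exp (-(c * n) * sqn θ)) * (m * √(sqn θ))) := by
              gcongr
              · exact norm_ft_pow_le h.symm hφ hc (by omega : n ≤ n - 1 + 2) hθ
              · exact hft1 θ
          _ = _ := by simp only [gm, pow_one]; ring) u
    rw [integral_const_mul] at h1
    have h2 := integral_gm_le (j := 1) (by norm_num) (mul_pos hc hn')
    calc _ ≤ _ := h1
      _ ≤ torusConst * W * m * n * (8 * Real.pi / (c * n * √(c * n) ^ 1)) := by gcongr
      _ = _ := by rw [pow_one, Real.sqrt_mul hc.le]; field_simp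
  have hquad : ∀ n : ℕ, 0 < n → ∀ u e, enorm2 e ≤ 1 →
      |l (u + e) ^ 2 * heat p n (u + e) - l u ^ 2 * heat p n u|
      ≤ (torusConst * W * m * (8 * Real.pi / (c * √c))
        + torusConst * W * m ^ 2 * (8 * Real.pi / (c * √c ^ 3))) / √n := fun n hn u e he => by
    have hn' : (0 : ℝ) < n := by exact_mod_cast hn
    have h1 := (quadratic_heat_isInverseFT hs1 hs2 n).abs_sub_le
      (k := fun θ => torusConst * W * m * n * gm 1 (c * n) θ
        + torusConst * W * m ^ 2 * n ^ 2 * gm 3 (c * n) θ)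
      ((continuous_const.mul (continuous_gm _ _)).add (continuous_const.mul (continuous_gm _ _)))
      (u + e) u (fun θ hθ => by
        rw [add_sub_cancel_left, norm_mul, Complex.norm_real, Real.norm_of_nonneg hT.le]
        have hn1 : ‖(n : ℂ) - 1‖ ≤ n := by
          have : ((n : ℂ) - 1) = ((n - 1 : ℕ) : ℂ) := by
            rw [Nat.cast_sub hn]; simp
          rw [this, Complex.norm_natCast]
          exact_mod_cast Nat.sub_le n 1
        have hang : |ang e θ| ≤ √(sqn θ) :=
          (abs_ang_le e θ).trans (mul_le_of_le_one_left (Real.sqrt_nonneg _) he)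
        have ha : ‖(n : ℂ) * ft (pr p) θ ^ (n - 1) * ft (fun z => pr p z * l z ^ 2) θ‖
            ≤ n * (W * Real.exp (-(c * n) * sqn θ)) * m := by
          rw [norm_mul, norm_mul, norm_pow, Complex.norm_natCast]
          gcongr
          · exact norm_ft_pow_le h.symm hφ hc (by omega : n ≤ n - 1 + 2) hθ
          · exact hft2 θ
        have hb : ‖(n : ℂ) * (n - 1 : ℂ) * ft (pr p) θ ^ (n - 2)
              * ft (fun z => pr p z * l z) θ ^ 2‖
            ≤ n * n * (W * Real.exp (-(c * n) * sqn θ)) * (m * √(sqn θ)) ^ 2 := by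
          rw [norm_mul, norm_mul, norm_mul, norm_pow, norm_pow, Complex.norm_natCast]
          gcongr
          · exact norm_ft_pow_le h.symm hφ hc (by omega : n ≤ n - 2 + 2) hθ
          · exact hft1 θ
        calc _ ≤ torusConst * (n * (W * Real.exp (-(c * n) * sqn θ)) * m
              + n * n * (W * Real.exp (-(c * n) * sqn θ)) * (m * √(sqn θ)) ^ 2) * √(sqn θ) := by
              gcongr
              refine (norm_add_le _ _).trans (add_le_add ha ?_)
              simpa using hb
          _ = _ := by simp only [gm, pow_one]; ring)
    rw [integral_add ((integrableOn_gm _ _).const_mul _) ((integrableOn_gm _ _).const_mul _),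
      integral_const_mul, integral_const_mul] at h1
    have h2 := integral_gm_le (j := 1) (by norm_num) (mul_pos hc hn')
    have h3 := integral_gm_le (j := 3) (by norm_num) (mul_pos hc hn')
    calc _ ≤ _ := h1
      _ ≤ torusConst * W * m * n * (8 * Real.pi / (c * n * √(c * n) ^ 1))
          + torusConst * W * m ^ 2 * n ^ 2 * (8 * Real.pi / (c * n * √(c * n) ^ 3)) := by gcongr
      _ = _ := by
        rw [pow_one, Real.sqrt_mul hc.le]
        have hsn : √(n : ℝ) ^ 2 = n := Real.sq_sqrt hn'.le
        have hsn0 : 0 < √(n : ℝ) := Real.sqrt_pos.2 hn'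
        have hsc0 : 0 < √c := Real.sqrt_pos.2 hc
        rw [mul_pow, show √(n : ℝ) ^ 3 = n * √n by rw [pow_succ, hsn]]
        field_simp
  refine ⟨(torusConst * W * m * (8 * Real.pi / (c * √c))
        + torusConst * W * m ^ 2 * (8 * Real.pi / (c * √c ^ 3)))
        + 2 * (torusConst * W * m * (8 * Real.pi / (c * √c))) + C₀, by positivity,
    fun n hn u e he => ?_⟩
  have hn' : (1 : ℝ) ≤ n := by exact_mod_cast hn
  have hle := (hl e).trans he
  -- The weight is recentred at `u + e`, which leaves an exact difference of `l² p_n` and two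
  -- corrections bounded by the linear estimate and by the sup bound.
  have e1 : l u ^ 2 * (heat p n (u + e) - heat p n u)
      = (l (u + e) ^ 2 * heat p n (u + e) - l u ^ 2 * heat p n u)
        + -(2 * l e) * (l (u + e) * heat p n (u + e)) + l e ^ 2 * heat p n (u + e) := by
    rw [map_add]; ring
  have e2 : l u ^ 2 * |heat p n (u + e) - heat p n u|
      = |l u ^ 2 * (heat p n (u + e) - heat p n u)| := by
    rw [abs_mul, abs_of_nonneg (sq_nonneg (l u))]
  rw [e2, e1, add_div, add_div]
  refine (abs_add_three _ _ _).trans (add_le_add (add_le_add (hquad n hn u e he) ?_) ?_)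
  · rw [abs_mul, abs_neg, abs_mul, abs_two, mul_div_assoc]
    calc 2 * |l e| * |l (u + e) * heat p n (u + e)|
        ≤ 2 * 1 * (torusConst * W * m * (8 * Real.pi / (c * √c)) / √n) := by
          gcongr
          exact hlin n hn _
      _ = _ := by ring
  · rw [abs_mul, abs_pow, abs_of_nonneg (heat_nonneg _ _)]
    calc |l e| ^ 2 * heat p n (u + e) ≤ 1 ^ 2 * (C₀ / n) := by
          gcongr
          · exact heat_nonneg _ _
          · exact hheat n hn _
      _ ≤ C₀ / √n := by
          rw [one_pow, one_mul]
          gcongr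
          exact Real.sqrt_le_iff.2 ⟨by positivity, by nlinarith⟩

theorem exists_sq_mul_abs_heat_sub_le (h : IsRegular p) :
    ∃ C > 0, ∀ n : ℕ, 0 < n → ∀ u e, enorm2 e ≤ 1 →
      enorm2 u ^ 2 * |heat p n (u + e) - heat p n u| ≤ C / √n := by
  let l₁ : ℤ × ℤ →+ ℝ := (Int.castAddHom ℝ).comp (AddMonoidHom.fst ℤ ℤ)
  let l₂ : ℤ × ℤ →+ ℝ := (Int.castAddHom ℝ).comp (AddMonoidHom.snd ℤ ℤ)
  obtain ⟨C₁, hC₁, h₁⟩ := exists_sq_mul_abs_heat_sub_le_aux h (l := l₁) fun z => abs_fst_le z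
  obtain ⟨C₂, hC₂, h₂⟩ := exists_sq_mul_abs_heat_sub_le_aux h (l := l₂) fun z => abs_snd_le z
  refine ⟨C₁ + C₂, by positivity, fun n hn u e he => ?_⟩
  rw [enorm2_sq, add_mul, add_div]
  exact add_le_add (h₁ n hn u e he) (h₂ n hn u e he)

/-- Lower bound for return probabilities, by the Fourier formula on a small square. -/
theorem exists_le_heat_zero (h : IsRegular p) :
    ∃ c > 0, ∀ n : ℕ, 0 < n → c / n ≤ heat p (2 * n) 0 := by
  have hpi := Real.pi_pos
  have hT := torusConst_pos
  refine ⟨torusConst / 2, by positivity, fun n hn => ?_⟩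
  have hn' : (1 : ℝ) ≤ n := by exact_mod_cast hn
  have hcont : Continuous (phi p) := by
    refine Complex.continuous_re.comp (continuous_ft (summable_abs_pr (p := p))) |>.congr fun θ => ?_
    rw [Function.comp, ft_pr_eq h.symm, Complex.ofReal_re]
  have h1 : heat p (2 * n) 0 = ∫ θ in torus, torusConst * phi p θ ^ (2 * n) := by
    have h2 := (heat_isInverseFT (p := p) (2 * n)).2 0
    simp only [ft_pr_eq h.symm, neg_zero, chr_zero, mul_one] at h2
    have h3 : ∀ θ, (torusConst : ℂ) * (phi p θ : ℂ) ^ (2 * n)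
        = ((torusConst * phi p θ ^ (2 * n) : ℝ) : ℂ) := fun θ => by push_cast; rfl
    simp only [h3] at h2
    rw [integral_complex_ofReal] at h2
    exact_mod_cast h2
  -- On the square of half-side `s` one has `phi ≥ 1 - 1/(4n)`, so Bernoulli's inequality gives `phi
  -- ^ (2n) ≥ 1/2`, while the area is `1/n`. The even exponent makes the rest of the torus
  -- contribute nonnegatively.
  set s : ℝ := 1 / (2 * √n) with hs
  have hsn : 1 ≤ √(n : ℝ) := Real.one_le_sqrt.2 hn'
  have hs0 : 0 < s := by positivity
  have hs1 : s ≤ 1 := by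
    rw [hs, div_le_one (by positivity)]; linarith
  have hs2 : s ^ 2 = 1 / (4 * n) := by
    rw [hs, div_pow, mul_pow, Real.sq_sqrt (by positivity)]; norm_num
  let Q : Set (ℝ × ℝ) := Icc (-s) s ×ˢ Icc (-s) s
  have hQ : Q ⊆ torus := by
    have : s ≤ Real.pi := by linarith [Real.two_le_pi]
    exact prod_mono (Icc_subset_Icc (by linarith) this) (Icc_subset_Icc (by linarith) this)
  have hQm : MeasurableSet Q := measurableSet_Icc.prod measurableSet_Icc
  have hQc : IsCompact Q := isCompact_Icc.prod isCompact_Icc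
  have hcont' : Continuous fun θ => torusConst * phi p θ ^ (2 * n) :=
    continuous_const.mul (hcont.pow _)
  have hlow : ∀ θ ∈ Q, torusConst * (1 / 2) ≤ torusConst * phi p θ ^ (2 * n) := fun θ hθ => by
    have h3 := one_sub_phi_le (p := p) h.cov θ
    have h4 : θ.1 ^ 2 ≤ s ^ 2 := sq_le_sq' hθ.1.1 hθ.1.2
    have h5 : θ.2 ^ 2 ≤ s ^ 2 := sq_le_sq' hθ.2.1 hθ.2.2
    have h6 : sqn θ / 2 ≤ 1 / (4 * n) := by rw [sqn, ← hs2]; linarith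
    have h7 : 1 / (4 * (n : ℝ)) ≤ 1 := by rw [div_le_one (by positivity)]; linarith
    have h8 := one_add_mul_le_pow (a := -(1 / (4 * (n : ℝ)))) (by linarith) (2 * n)
    have h9 : (1 : ℝ) + ((2 * n : ℕ) : ℝ) * -(1 / (4 * n)) = 1 / 2 := by
      push_cast; field_simp; norm_num
    rw [h9] at h8
    have h10 : (1 + -(1 / (4 * (n : ℝ)))) ^ (2 * n) ≤ phi p θ ^ (2 * n) :=
      pow_le_pow_left₀ (by linarith) (by linarith) _
    exact mul_le_mul_of_nonneg_left (h8.trans h10) hT.le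
  have hvol : (volume : Measure (ℝ × ℝ)).real Q = 1 / n := by
    rw [Measure.volume_eq_prod, measureReal_prod_prod, Real.volume_real_Icc_of_le (by linarith)]
    have : (s - -s) * (s - -s) = 4 * s ^ 2 := by ring
    rw [this, hs2]; field_simp
  calc torusConst / 2 / n = ∫ _ in Q, torusConst * (1 / 2) := by
        rw [setIntegral_const, hvol, smul_eq_mul]; ring
    _ ≤ ∫ θ in Q, torusConst * phi p θ ^ (2 * n) :=
        setIntegral_mono_on (continuous_const.continuousOn.integrableOn_compact hQc)
          (hcont'.continuousOn.integrableOn_compact hQc) hQm hlow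
    _ ≤ ∫ θ in torus, torusConst * phi p θ ^ (2 * n) := by
        refine setIntegral_mono_set (hcont'.continuousOn.integrableOn_compact isCompact_torus)
          (Eventually.of_forall fun θ => ?_) (Eventually.of_forall hQ)
        have : 0 ≤ phi p θ ^ (2 * n) := by rw [pow_mul]; positivity
        exact mul_nonneg hT.le this
    _ = _ := h1.symm

end LatticeWalk

namespace LatticeWalk

/-! ### Differences of Green functions -/

variable {p : PMF (ℤ × ℤ)}

/-- `∑_n |p_n(u) - p_n(v)|`. -/
def greenGap (p : PMF (ℤ × ℤ)) (u v : ℤ × ℤ) : ℝ≥0∞ :=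
  ∑' n, ENNReal.ofReal |heat p n u - heat p n v|

theorem greenGap_comm (u v : ℤ × ℤ) : greenGap p u v = greenGap p v u := by
  simp only [greenGap, abs_sub_comm]

theorem greenGap_self (u : ℤ × ℤ) : greenGap p u u = 0 := by simp [greenGap]

theorem greenGap_triangle (u v w : ℤ × ℤ) :
    greenGap p u w ≤ greenGap p u v + greenGap p v w := by
  rw [greenGap, greenGap, greenGap, ← ENNReal.tsum_add]
  refine ENNReal.tsum_le_tsum fun n => ?_
  rw [← ENNReal.ofReal_add (abs_nonneg _) (abs_nonneg _)]
  exact ENNReal.ofReal_le_ofReal (abs_sub_le _ _ _)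

theorem stepPow_le_add (n : ℕ) (u v : ℤ × ℤ) :
    stepPow p n u ≤ stepPow p n v + ENNReal.ofReal |heat p n u - heat p n v| := by
  rw [← ENNReal.ofReal_toReal (stepPow_ne_top n u), ← ENNReal.ofReal_toReal (stepPow_ne_top n v),
    ← ENNReal.ofReal_add ENNReal.toReal_nonneg (abs_nonneg _)]
  refine ENNReal.ofReal_le_ofReal ?_
  have := le_abs_self (heat p n u - heat p n v)
  simp only [heat] at this ⊢
  linarith

/-- The sum behaves like `∫ dt / (√t (t + X²))`, of order `1/X`. Each term is at most a decrement of
`4 / (√n + X)`, so the bound telescopes. -/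
theorem sum_inv_sqrt_mul_le {X : ℝ} (hX : 0 < X) (M : ℕ) :
    ∑ n ∈ Finset.range M, 1 / (√(n + 1 : ℝ) * ((n + 1) + X ^ 2)) ≤ 4 / X := by
  have key : ∀ n : ℕ, 1 / (√(n + 1 : ℝ) * ((n + 1) + X ^ 2))
      ≤ 4 * (1 / (√(n : ℝ) + X)) - 4 * (1 / (√((n + 1 : ℕ) : ℝ) + X)) := fun n => by
    set a := √(n : ℝ)
    set b := √((n + 1 : ℕ) : ℝ) with hb
    have hb' : √(n + 1 : ℝ) = b := by rw [hb]; push_cast; rfl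
    have ha0 : 0 ≤ a := Real.sqrt_nonneg _
    have ha2 : a ^ 2 = n := Real.sq_sqrt (by positivity)
    have hb2 : b ^ 2 = n + 1 := by rw [hb, Real.sq_sqrt (by positivity)]; push_cast; rfl
    have hb0 : 0 < b := Real.sqrt_pos.2 (by positivity)
    have hab : a ≤ b := Real.sqrt_le_sqrt (by exact_mod_cast Nat.le_succ n)
    rw [hb', ← hb2, ← mul_sub, div_sub_div _ _ (by positivity) (by positivity), ← mul_div_assoc,
      div_le_div_iff₀ (by positivity) (by positivity)]
    have h1 : (b - a) * (b + a) = 1 := by nlinarith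
    have h2 : 1 ≤ (b - a) * (2 * b) := by nlinarith
    have h3 : (a + X) * (b + X) ≤ 2 * (b ^ 2 + X ^ 2) := by
      nlinarith [sq_nonneg (b - X)]
    nlinarith [mul_le_mul_of_nonneg_right h2 (by positivity : 0 ≤ 2 * (b ^ 2 + X ^ 2))]
  calc _ ≤ ∑ n ∈ Finset.range M,
        (4 * (1 / (√(n : ℝ) + X)) - 4 * (1 / (√((n + 1 : ℕ) : ℝ) + X))) :=
        Finset.sum_le_sum fun n _ => key n
    _ = 4 * (1 / (√((0 : ℕ) : ℝ) + X)) - 4 * (1 / (√(M : ℝ) + X)) :=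
        Finset.sum_range_sub' (fun n : ℕ => 4 * (1 / (√(n : ℝ) + X))) M
    _ ≤ 4 / X := by
        have : 0 ≤ 4 * (1 / (√(M : ℝ) + X)) := by positivity
        simp only [Nat.cast_zero, Real.sqrt_zero, zero_add]
        rw [mul_one_div]
        linarith

theorem tsum_ofReal_le {a : ℕ → ℝ} (ha : ∀ n, 0 ≤ a n) {B : ℝ}
    (h : ∀ M, ∑ n ∈ Finset.range M, a n ≤ B) : ∑' n, ENNReal.ofReal (a n) ≤ ENNReal.ofReal B := by
  refine ENNReal.tsum_le_of_sum_range_le fun M => ?_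
  rw [← ENNReal.ofReal_sum_of_nonneg fun n _ => ha n]
  exact ENNReal.ofReal_le_ofReal (h M)

theorem greenGap_le_of_le {u v : ℤ × ℤ} {X C : ℝ} (hX : 0 < X) (hC : 0 ≤ C)
    (h0 : |heat p 0 u - heat p 0 v| ≤ C / X)
    (h : ∀ n : ℕ, |heat p (n + 1) u - heat p (n + 1) v| ≤ C * (1 / (√(n + 1 : ℝ) * ((n + 1) + X ^ 2)))) :
    greenGap p u v ≤ ENNReal.ofReal (5 * C / X) := by
  rw [greenGap, tsum_eq_zero_add' ENNReal.summable]
  have h1 : ∑' n, ENNReal.ofReal |heat p (n + 1) u - heat p (n + 1) v|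
      ≤ ENNReal.ofReal (C * (4 / X)) := by
    refine tsum_ofReal_le (fun n => abs_nonneg _) fun M => ?_
    calc _ ≤ ∑ n ∈ Finset.range M, C * (1 / (√(n + 1 : ℝ) * ((n + 1) + X ^ 2))) :=
          Finset.sum_le_sum fun n _ => h n
      _ = C * ∑ n ∈ Finset.range M, 1 / (√(n + 1 : ℝ) * ((n + 1) + X ^ 2)) := by
          rw [Finset.mul_sum]
      _ ≤ _ := by gcongr; exact sum_inv_sqrt_mul_le hX M
  calc _ ≤ ENNReal.ofReal (C / X) + ENNReal.ofReal (C * (4 / X)) :=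
        add_le_add (ENNReal.ofReal_le_ofReal h0) h1
    _ = _ := by
        rw [← ENNReal.ofReal_add (by positivity) (by positivity)]
        congr 1; ring

theorem abs_heat_zero_sub_le (u v : ℤ × ℤ) : |heat p 0 u - heat p 0 v| ≤ 1 := by
  rw [heat_zero, heat_zero]
  split_ifs <;> simp

theorem exists_greenGap_le (h : IsRegular p) :
    ∃ C > 0, ∀ u v, greenGap p u v ≤ ENNReal.ofReal (C * enorm2 (u - v)) := by
  obtain ⟨C, hC, hh⟩ := exists_abs_heat_sub_le h
  refine ⟨5 * (2 * C + 1), by positivity, fun u v => ?_⟩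
  by_cases huv : u = v
  · subst huv; rw [greenGap_self]; exact zero_le
  have hd := one_le_enorm2 (sub_ne_zero.2 huv)
  have := greenGap_le_of_le (p := p) (u := u) (v := v) (X := 1) (C := (2 * C + 1) * enorm2 (u - v))
    one_pos (by positivity) ((abs_heat_zero_sub_le u v).trans (by rw [div_one]; nlinarith))
    (fun n => (hh (n + 1) n.succ_pos u v).trans ?_)
  · simpa [mul_assoc] using this
  · push_cast
    have hs : 0 < √(n + 1 : ℝ) := Real.sqrt_pos.2 (by positivity)
    have hn : (0 : ℝ) ≤ n := n.cast_nonneg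
    rw [mul_one_div, div_le_div_iff₀ (by positivity) (by positivity)]
    have h1 : C * ((n : ℝ) + 1 + 1 ^ 2) ≤ (2 * C + 1) * (n + 1) := by nlinarith
    calc C * enorm2 (u - v) * (√(n + 1 : ℝ) * (n + 1 + 1 ^ 2))
        = (C * ((n : ℝ) + 1 + 1 ^ 2)) * (enorm2 (u - v) * √(n + 1 : ℝ)) := by ring
      _ ≤ ((2 * C + 1) * (n + 1)) * (enorm2 (u - v) * √(n + 1 : ℝ)) := by gcongr
      _ = _ := by ring

/-- The bounds `n ^ (-3/2)` and `|u|⁻² n ^ (-1/2)` are added after clearing denominators, which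
gives `C / (√n (n + |u|²))`; summation over time yields `1/|u|`. -/
theorem exists_greenGap_step_le (h : IsRegular p) :
    ∃ C > 0, ∀ u e, u ≠ 0 → enorm2 e ≤ 1 →
      greenGap p (u + e) u ≤ ENNReal.ofReal (C / enorm2 u) := by
  obtain ⟨C₁, hC₁, h₁⟩ := exists_abs_heat_sub_le h
  obtain ⟨C₂, hC₂, h₂⟩ := exists_sq_mul_abs_heat_sub_le h
  refine ⟨5 * (C₁ + C₂ + 1), by positivity, fun u e hu he => ?_⟩
  have hX := one_le_enorm2 hu
  refine greenGap_le_of_le (by linarith) (by positivity) ?_ fun n => ?_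
  · rw [le_div_iff₀ (by linarith)]
    -- Since `u ≠ 0`, the time-zero term is nonzero only if `u + e = 0`, and then `|u| ≤ 1`.
    by_cases h0 : u + e = 0
    · have : enorm2 u ≤ 1 := by
        rw [eq_neg_of_add_eq_zero_left h0, enorm2_neg]; exact he
      have := abs_heat_zero_sub_le (p := p) (u + e) u
      calc _ ≤ (1 : ℝ) * 1 := by gcongr
        _ ≤ C₁ + C₂ + 1 := by linarith
    · rw [heat_zero, heat_zero]
      simp [hu, h0]; positivity
  · have h3 := h₁ (n + 1) n.succ_pos (u + e) u
    have h4 := h₂ (n + 1) n.succ_pos u e he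
    rw [add_sub_cancel_left] at h3
    push_cast at h3 h4
    set D := |heat p (n + 1) (u + e) - heat p (n + 1) u|
    have hD : 0 ≤ D := abs_nonneg _
    have hs : 0 < √(n + 1 : ℝ) := Real.sqrt_pos.2 (by positivity)
    have hn : (0 : ℝ) ≤ n := n.cast_nonneg
    rw [le_div_iff₀ (by positivity)] at h3 h4
    rw [mul_one_div, le_div_iff₀ (by positivity)]
    have h5 : C₁ * enorm2 e ≤ C₁ := mul_le_of_le_one_right hC₁.le he
    nlinarith

theorem greenGap_add_nsmul_le {C ρ : ℝ} (hρ : 0 < ρ) (hC : 0 ≤ C)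
    (h : ∀ u e, u ≠ 0 → enorm2 e ≤ 1 → greenGap p (u + e) u ≤ ENNReal.ofReal (C / enorm2 u))
    {u e : ℤ × ℤ} (he : enorm2 e ≤ 1) (k : ℕ) (hk : ∀ j < k, ρ ≤ enorm2 (u + j • e)) :
    greenGap p (u + k • e) u ≤ ENNReal.ofReal (k * (C / ρ)) := by
  induction k with
  | zero => simp [greenGap_self]
  | succ k ih =>
    have h1 := ih fun j hj => hk j (by omega)
    have h2 := hk k (by omega)
    have h3 : u + k • e ≠ 0 := fun h0 => by rw [h0, enorm2_zero] at h2; linarith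
    have h4 := h (u + k • e) e h3 he
    rw [succ_nsmul, ← add_assoc]
    refine (greenGap_triangle _ (u + k • e) _).trans ((add_le_add h4 h1).trans ?_)
    rw [← ENNReal.ofReal_add (div_nonneg hC (enorm2_nonneg _)) (by positivity)]
    refine ENNReal.ofReal_le_ofReal ?_
    have : C / enorm2 (u + k • e) ≤ C / ρ := by gcongr
    push_cast; linarith

theorem greenGap_add_zsmul_le {C ρ : ℝ} (hρ : 0 < ρ) (hC : 0 ≤ C)
    (h : ∀ u e, u ≠ 0 → enorm2 e ≤ 1 → greenGap p (u + e) u ≤ ENNReal.ofReal (C / enorm2 u))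
    {u e : ℤ × ℤ} (he : enorm2 e ≤ 1) (s : ℤ)
    (hk : ∀ j : ℤ, min 0 s ≤ j → j ≤ max 0 s → ρ ≤ enorm2 (u + j • e)) :
    greenGap p (u + s • e) u ≤ ENNReal.ofReal (|(s : ℝ)| * (C / ρ)) := by
  rcases le_total 0 s with hs | hs
  · obtain ⟨k, rfl⟩ := Int.eq_ofNat_of_zero_le hs
    have := greenGap_add_nsmul_le hρ hC h he k fun j hj => by
      simpa using hk j (by omega) (by omega)
    simpa using this
  · obtain ⟨k, hk'⟩ := Int.eq_ofNat_of_zero_le (neg_nonneg.2 hs)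
    obtain rfl : s = -(k : ℤ) := by omega
    have := greenGap_add_nsmul_le hρ hC h (u := u) (e := -e) (by rwa [enorm2_neg]) k fun j hj => by
      have := hk (-(j : ℤ)) (by omega) (by omega)
      simpa using this
    simpa using this

theorem enorm2_le_abs_add_abs (z : ℤ × ℤ) : enorm2 z ≤ |(z.1 : ℝ)| + |(z.2 : ℝ)| := by
  rw [enorm2_eq_norm]; exact Complex.norm_le_abs_re_add_abs_im _

/-- One-step gaps are summed along a lattice path from `v` to `w`, horizontal and then vertical. Its
points have both coordinates at most `R/4` in absolute value, so they stay at distance at least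
`R/2` from `x`. -/
theorem exists_greenGap_far_le (h : IsRegular p) :
    ∃ C > 0, ∀ (R : ℝ) (x v w : ℤ × ℤ), 0 < R → R ≤ enorm2 x → enorm2 v ≤ R / 4 →
      enorm2 w ≤ R / 4 →
      greenGap p (x - w) (x - v) ≤ ENNReal.ofReal (C * enorm2 (w - v) / R) := by
  obtain ⟨C, hC, hstep⟩ := exists_greenGap_step_le h
  refine ⟨4 * C, by positivity, fun R x v w hR hx hv hw => ?_⟩
  have hfar : ∀ a : ℤ × ℤ, |(a.1 : ℝ)| ≤ R / 4 → |(a.2 : ℝ)| ≤ R / 4 → R / 2 ≤ enorm2 (x - a) := by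
    intro a h1 h2
    have h3 := enorm2_le_abs_add_abs a
    have h4 := enorm2_le_add_sub x a
    linarith
  have hv1 := (abs_fst_le v).trans hv
  have hv2 := (abs_snd_le v).trans hv
  have hw1 := (abs_fst_le w).trans hw
  have hw2 := (abs_snd_le w).trans hw
  have between : ∀ a b c : ℤ, |(a : ℝ)| ≤ R / 4 → |(b : ℝ)| ≤ R / 4 → min 0 (a - b) ≤ c →
      c ≤ max 0 (a - b) → |((a - c : ℤ) : ℝ)| ≤ R / 4 := by
    intro a b c ha hb h1 h2
    have h3 : min a b ≤ a - c := by omega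
    have h4 : a - c ≤ max a b := by omega
    have h3' : ((min a b : ℤ) : ℝ) ≤ ((a - c : ℤ) : ℝ) := by exact_mod_cast h3
    have h4' : ((a - c : ℤ) : ℝ) ≤ ((max a b : ℤ) : ℝ) := by exact_mod_cast h4
    rw [abs_le] at ha hb ⊢
    rw [Int.cast_min] at h3'
    rw [Int.cast_max] at h4'
    exact ⟨le_trans (le_min ha.1 hb.1) h3', h4'.trans (max_le ha.2 hb.2)⟩
  have he1 : enorm2 ((1, 0) : ℤ × ℤ) ≤ 1 := by simp [enorm2]
  have he2 : enorm2 ((0, 1) : ℤ × ℤ) ≤ 1 := by simp [enorm2]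
  have hR2 : 0 < R / 2 := by positivity
  have s1 := greenGap_add_zsmul_le hR2 hC.le hstep (u := x - v) he1 (v.1 - w.1) fun j h1 h2 => by
    have := hfar (v.1 - j, v.2) (between _ _ _ hv1 hw1 h1 h2) hv2
    convert this using 2
    ext <;> simp; ring
  have s2 := greenGap_add_zsmul_le hR2 hC.le hstep (u := x - (w.1, v.2)) he2 (v.2 - w.2)
    fun j h1 h2 => by
    have := hfar (w.1, v.2 - j) hw1 (between _ _ _ hv2 hw2 h1 h2)
    convert this using 2
    ext <;> simp; ring
  have e1 : x - v + (v.1 - w.1) • ((1, 0) : ℤ × ℤ) = x - (w.1, v.2) := by ext <;> simp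
  have e2 : x - (w.1, v.2) + (v.2 - w.2) • ((0, 1) : ℤ × ℤ) = x - w := by ext <;> simp
  rw [e1] at s1
  rw [e2] at s2
  refine (greenGap_triangle _ _ _).trans ((add_le_add s2 s1).trans ?_)
  rw [← ENNReal.ofReal_add (by positivity) (by positivity)]
  refine ENNReal.ofReal_le_ofReal ?_
  have a1 : |((v.1 - w.1 : ℤ) : ℝ)| ≤ enorm2 (w - v) := by
    rw [enorm2_sub_comm]; exact abs_fst_le (v - w)
  have a2 : |((v.2 - w.2 : ℤ) : ℝ)| ≤ enorm2 (w - v) := by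
    rw [enorm2_sub_comm]; exact abs_snd_le (v - w)
  calc _ ≤ enorm2 (w - v) * (C / (R / 2)) + enorm2 (w - v) * (C / (R / 2)) := by gcongr
    _ = _ := by field_simp; ring

/-! ### First-visit decomposition of the truncated Green function -/

/-- The free Green function truncated at time `N`. -/
def potSum (p : PMF (ℤ × ℤ)) (N : ℕ) (u : ℤ × ℤ) : ℝ≥0∞ := ∑ n ∈ Finset.range N, stepPow p n u

theorem potSum_ne_top (N : ℕ) (u : ℤ × ℤ) : potSum p N u ≠ ⊤ :=
  ENNReal.sum_ne_top.2 fun n _ => stepPow_ne_top n u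

theorem potSum_mono {M N : ℕ} (h : M ≤ N) (u : ℤ × ℤ) : potSum p M u ≤ potSum p N u :=
  Finset.sum_le_sum_of_subset (Finset.range_mono h)

theorem potSum_le_add_greenGap (N : ℕ) (u v : ℤ × ℤ) :
    potSum p N u ≤ potSum p N v + greenGap p u v := by
  refine (Finset.sum_le_sum fun n _ => stepPow_le_add n u v).trans ?_
  rw [Finset.sum_add_distrib]
  exact add_le_add_right (ENNReal.sum_le_tsum _) _

variable {A : Set (ℤ × ℤ)}

theorem firstHit_zero_fun (j : ℕ) (w : ℤ × ℤ) : firstHit p A j (fun _ => 0) w = 0 := by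
  simpa using firstHit_const_mul (p := p) (S := A) j 0 (fun _ => 0) w

theorem firstHit_sum {ι : Type*} (s : Finset ι) (f : ι → ℤ × ℤ → ℝ≥0∞) (j : ℕ) (w : ℤ × ℤ) :
    firstHit p A j (fun v => ∑ i ∈ s, f i v) w = ∑ i ∈ s, firstHit p A j (f i) w := by
  have := firstHit_tsum (p := p) (S := A) j (fun i : s => f i) w
  rw [Finset.tsum_subtype s fun i => firstHit p A j (f i) w,
    funext fun v => Finset.tsum_subtype s fun i => f i v] at this
  exact this

/-- The horizon `N` is kept because the free Green function of a recurrent walk is infinite. A visit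
to `A` at time `j` leaves the horizon `N - j`. -/
theorem potSum_eq (x w : ℤ × ℤ) (N : ℕ) :
    potSum p N (x - w) = ∑ n ∈ Finset.range N, survive p A n (pt x) w
      + ∑' j, firstHit p A j (fun v => potSum p (N - j) (x - v)) w := by
  have h1 : ∀ n, stepPow p n (x - w) = survive p A n (pt x) w
      + ∑ j ∈ Finset.range (n + 1), firstHit p A j (fun v => stepPow p (n - j) (x - v)) w := by
    intro n
    have := eq_survive_add_sum_firstHit (p := p) (S := A) (fun n => survive p ∅ n (pt x))
      (fun n y _ => survive_succ_of_notMem (by simp) n _) n w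
    have e0 : survive p ∅ 0 (pt x) = pt x := by simp [survive]
    have e1 : ∀ n, survive p ∅ n (pt x) = fun v => stepPow p n (x - v) := fun n =>
      funext fun v => survive_empty_eq n v x
    beta_reduce at this
    rw [e0] at this
    simpa only [e1] using this
  rw [potSum, Finset.sum_congr rfl fun n _ => h1 n, Finset.sum_add_distrib]
  congr 1
  rw [tsum_eq_sum (s := Finset.range N) fun j hj => by
    have : N - j = 0 := by simp at hj; omega
    simp only [this, potSum, Finset.range_zero, Finset.sum_empty]
    exact firstHit_zero_fun j w]
  rw [Finset.sum_comm' (t' := Finset.range N) (s' := fun j => Finset.Ico j N)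
    (fun n j => by simp only [Finset.mem_range, Finset.mem_Ico]; omega)]
  refine Finset.sum_congr rfl fun j _ => ?_
  rw [Finset.sum_Ico_eq_sum_range]
  simp only [potSum, firstHit_sum, Nat.add_sub_cancel_left]

/-- The walk is recurrent. -/
theorem hit_one_of_zero_mem (h : IsRegular p) (hA : (0 : ℤ × ℤ) ∈ A) (w : ℤ × ℤ) :
    hit p A 1 w = 1 := by
  -- If `q = P^w(T_0 < ∞) < 1`, the truncated Green function satisfies `g_N(0) ≤ g_N(-w) + C|w| ≤ q
  -- g_N(0) + C|w|` and stays bounded in `N`. The return probabilities at even times dominate a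
  -- harmonic series, a contradiction.
  have key : hit p {0} 1 w = 1 := by
    by_contra hne
    have hlt : hit p {0} 1 w < 1 := lt_of_le_of_ne (hit_one_le w) hne
    obtain ⟨C, hC, hgap⟩ := exists_greenGap_le h
    have h1 : ∀ N, potSum p N (0 - w) ≤ hit p {0} 1 w * potSum p N 0 := fun N => by
      rw [potSum_eq (A := {0}) 0 w N]
      have z : ∀ n, survive p {0} n (pt 0) w = 0 := fun n => by
        rw [survive_congr (g := fun _ => 0 * 0) (fun y hy => by
          simp only [mem_singleton_iff] at hy; simp [hy]) n w, survive_const_mul, zero_mul]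
      simp only [z, Finset.sum_const_zero, zero_add, hit]
      rw [← ENNReal.tsum_mul_right]
      refine ENNReal.tsum_le_tsum fun j => ?_
      rw [mul_comm, ← firstHit_const_mul]
      refine firstHit_mono (fun v hv => ?_) j w
      rw [mem_singleton_iff.1 hv]
      simpa using potSum_mono (Nat.sub_le N j) _
    have h2 : ∀ N, potSum p N 0 ≤ hit p {0} 1 w * potSum p N 0
        + ENNReal.ofReal (C * enorm2 w) := fun N => by
      refine (potSum_le_add_greenGap N 0 (0 - w)).trans (add_le_add (h1 N) ?_)
      simpa using hgap 0 (0 - w)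
    set q := (hit p {0} 1 w).toReal with hq
    have hq1 : q < 1 := by
      rw [hq, ← ENNReal.toReal_one]
      exact (ENNReal.toReal_lt_toReal hlt.ne_top ENNReal.one_ne_top).2 hlt
    have h3 : ∀ N, (potSum p N 0).toReal ≤ C * enorm2 w / (1 - q) := fun N => by
      have := ENNReal.toReal_mono (ENNReal.add_ne_top.2
        ⟨ENNReal.mul_ne_top hlt.ne_top (potSum_ne_top N 0), ENNReal.ofReal_ne_top⟩) (h2 N)
      rw [ENNReal.toReal_add (ENNReal.mul_ne_top hlt.ne_top (potSum_ne_top N 0))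
        ENNReal.ofReal_ne_top, ENNReal.toReal_mul, ENNReal.toReal_ofReal
        (mul_nonneg hC.le (enorm2_nonneg _)), ← hq] at this
      rw [le_div_iff₀ (by linarith)]; linarith
    obtain ⟨c, hc, hlow⟩ := exists_le_heat_zero h
    have h4 : ∀ M, ∑ n ∈ Finset.range M, c * (1 / ((n : ℝ) + 1)) ≤ C * enorm2 w / (1 - q) := by
      intro M
      refine le_trans ?_ (h3 (2 * M + 1))
      rw [potSum, ENNReal.toReal_sum fun n _ => stepPow_ne_top n 0]
      calc ∑ n ∈ Finset.range M, c * (1 / ((n : ℝ) + 1))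
          ≤ ∑ n ∈ Finset.range M, heat p (2 * (n + 1)) 0 := Finset.sum_le_sum fun n _ => by
            have := hlow (n + 1) n.succ_pos
            push_cast at this
            rwa [mul_one_div]
        _ = ∑ m ∈ (Finset.range M).image (fun n => 2 * (n + 1)), heat p m 0 := by
            rw [Finset.sum_image fun a _ b _ hab => by omega]
        _ ≤ ∑ m ∈ Finset.range (2 * M + 1), heat p m 0 := by
            refine Finset.sum_le_sum_of_subset_of_nonneg (fun m hm => ?_)
              fun m _ _ => heat_nonneg m 0
            obtain ⟨n, hn, rfl⟩ := Finset.mem_image.1 hm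
            rw [Finset.mem_range] at hn ⊢; omega
    have h5 := (tendsto_atTop.1 (Real.tendsto_sum_range_one_div_nat_succ_atTop.const_mul_atTop hc)
      (C * enorm2 w / (1 - q) + 1)).exists
    obtain ⟨M, hM⟩ := h5
    have := h4 M
    rw [← Finset.mul_sum] at this
    linarith
  refine le_antisymm (hit_one_le w) ?_
  calc 1 = hit p {0} 1 w := key.symm
    _ = hit p A (hit p {0} 1) w := hit_eq_hit_hit (by simpa using hA) 1 w
    _ ≤ hit p A 1 w := hit_mono (fun y _ => hit_one_le y) w

/-- Comparison of the Green functions of the killed walk at two targets. -/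
theorem green_pt_le (h : IsRegular p) {w : ℤ × ℤ} (hw : hit p A 1 w = 1) (x x' : ℤ × ℤ) :
    green p A (pt x) w ≤ green p A (pt x') w
      + hit p A (fun v => greenGap p (x - w) (x - v) + greenGap p (x' - w) (x' - v)) w := by
  obtain ⟨C, hC, hgap⟩ := exists_abs_heat_sub_le h
  let a : ℕ → ℝ := fun n => C * enorm2 (x - x') * (2 * (1 / (√(n + 1 : ℝ) * ((n + 1) + 1 ^ 2))))
  have hd := enorm2_nonneg (x - x')
  -- A summable bound for `|p_n(x-v) - p_n(x'-v)|`, uniform in `v`. Its tail `ρ` measures the cost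
  -- of changing the horizon.
  let t : ℕ → ℝ≥0∞ := fun n => if n = 0 then 1 else ENNReal.ofReal (a (n - 1))
  have ht : ∑' n, t n ≠ ⊤ := by
    rw [tsum_eq_zero_add' ENNReal.summable]
    refine ENNReal.add_ne_top.2 ⟨by simp [t], ?_⟩
    simp only [t, Nat.add_eq_zero_iff, one_ne_zero, and_false, if_false, Nat.add_sub_cancel]
    refine ne_top_of_le_ne_top ENNReal.ofReal_ne_top (tsum_ofReal_le (B := C * enorm2 (x - x') * (2 * (4 / 1)))
      (fun n => by positivity) fun M => ?_)
    simp only [a]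
    rw [← Finset.mul_sum, ← Finset.mul_sum]
    gcongr
    exact sum_inv_sqrt_mul_le one_pos M
  have hst : ∀ n v, stepPow p n (x - v) ≤ stepPow p n (x' - v) + t n := fun n v => by
    refine (stepPow_le_add n _ (x' - v)).trans (add_le_add_right ?_ _)
    rcases Nat.eq_zero_or_pos n with rfl | hn
    · simpa [t] using abs_heat_zero_sub_le (p := p) (x - v) (x' - v)
    · simp only [t, hn.ne', if_false]
      refine ENNReal.ofReal_le_ofReal ((hgap n hn _ _).trans ?_)
      obtain ⟨m, rfl⟩ := Nat.exists_eq_succ_of_ne_zero hn.ne'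
      simp only [sub_sub_sub_cancel_right, a, Nat.succ_eq_add_one, Nat.add_sub_cancel]
      push_cast
      have hs : 0 < √(m + 1 : ℝ) := Real.sqrt_pos.2 (by positivity)
      have hm : (0 : ℝ) ≤ m := m.cast_nonneg
      rw [div_eq_mul_one_div]
      refine mul_le_mul_of_nonneg_left ?_ (by positivity)
      rw [mul_one_div, div_le_div_iff₀ (by positivity) (by positivity)]
      nlinarith
  let ρ : ℕ → ℝ≥0∞ := fun M => ∑' n, t (n + M)
  have hρ0 : Tendsto ρ atTop (𝓝 0) := ENNReal.tendsto_sum_nat_add t ht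
  have hρle : ∀ M, ρ M ≤ ∑' n, t n := fun M =>
    ENNReal.tsum_comp_le_tsum_of_injective (add_left_injective M) t
  have hIco : ∀ M N, ∑ n ∈ Finset.Ico M N, t n ≤ ρ M := fun M N => by
    rw [Finset.sum_Ico_eq_sum_range]
    simp only [add_comm M]
    exact ENNReal.sum_le_tsum _
  -- Passing from `w` to `v` in both targets costs the two gaps. Lowering the horizon from `N` to `N
  -- - j` costs only the tail, since the difference between the two targets is summable in time.
  have point : ∀ N j v, potSum p N (x - w) + potSum p (N - j) (x' - v)
      ≤ potSum p (N - j) (x - v) + (potSum p N (x' - w)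
        + (greenGap p (x - w) (x - v) + greenGap p (x' - w) (x' - v)) + ρ (N - j)) := by
    intro N j v
    have e : ∀ u, potSum p N u = potSum p (N - j) u + ∑ n ∈ Finset.Ico (N - j) N, stepPow p n u :=
      fun u => (Finset.sum_range_add_sum_Ico _ (Nat.sub_le N j)).symm
    calc potSum p N (x - w) + potSum p (N - j) (x' - v)
        ≤ potSum p N (x - v) + greenGap p (x - w) (x - v) + potSum p (N - j) (x' - v) :=
          add_le_add_left (potSum_le_add_greenGap N _ _) _
      _ ≤ potSum p (N - j) (x - v) + (∑ n ∈ Finset.Ico (N - j) N, stepPow p n (x' - v) + ρ (N - j))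
          + greenGap p (x - w) (x - v) + potSum p (N - j) (x' - v) := by
          rw [e (x - v)]
          gcongr
          calc _ ≤ ∑ n ∈ Finset.Ico (N - j) N, (stepPow p n (x' - v) + t n) :=
                Finset.sum_le_sum fun n _ => hst n v
            _ ≤ _ := by rw [Finset.sum_add_distrib]; gcongr; exact hIco _ _
      _ = potSum p (N - j) (x - v) + (potSum p N (x' - v) + greenGap p (x - w) (x - v)
          + ρ (N - j)) := by rw [e (x' - v)]; ring
      _ ≤ potSum p (N - j) (x - v) + (potSum p N (x' - w) + greenGap p (x' - v) (x' - w)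
          + greenGap p (x - w) (x - v) + ρ (N - j)) := by
          gcongr; exact potSum_le_add_greenGap N _ _
      _ = _ := by rw [greenGap_comm (x' - v)]; ring
  set H := hit p A (fun v => greenGap p (x - w) (x - v) + greenGap p (x' - w) (x' - v)) w with hH
  let err : ℕ → ℝ≥0∞ := fun N => ∑' j, ρ (N - j) * firstHit p A j 1 w
  have const (c : ℝ≥0∞) : ∑' j, firstHit p A j (fun _ => c) w = c := by
    have : ∀ j, firstHit p A j (fun _ => c) w = c * firstHit p A j 1 w := fun j => by
      rw [← firstHit_const_mul]; simp
    simp only [this]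
    rw [ENNReal.tsum_mul_left, ← hit, hw, mul_one]
  have fin : ∀ N, ∑ n ∈ Finset.range N, survive p A n (pt x) w
      ≤ ∑ n ∈ Finset.range N, survive p A n (pt x') w + H + err N := by
    intro N
    have h1 : ∑' j, firstHit p A j ((fun _ => potSum p N (x - w))
          + fun v => potSum p (N - j) (x' - v)) w
        ≤ ∑' j, firstHit p A j ((fun v => potSum p (N - j) (x - v))
          + ((fun _ => potSum p N (x' - w))
          + (fun v => greenGap p (x - w) (x - v) + greenGap p (x' - w) (x' - v))
          + fun _ => ρ (N - j) * 1)) w :=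
      ENNReal.tsum_le_tsum fun j => firstHit_mono (fun v _ => by simpa using point N j v) j w
    simp only [firstHit_add, Pi.add_apply, ENNReal.tsum_add, const] at h1
    rw [← hit, ← hH] at h1
    have h2 : ∑' j, firstHit p A j (fun _ => ρ (N - j) * 1) w = err N :=
      tsum_congr fun j => firstHit_const_mul j _ (fun _ => 1) w
    rw [h2] at h1
    have e1 := potSum_eq (p := p) (A := A) x w N
    have e2 := potSum_eq (p := p) (A := A) x' w N
    set a₁ := ∑' j, firstHit p A j (fun v => potSum p (N - j) (x - v)) w
    set a₂ := ∑' j, firstHit p A j (fun v => potSum p (N - j) (x' - v)) w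
    have f1 : a₁ ≠ ⊤ := ne_top_of_le_ne_top (potSum_ne_top N (x - w)) (e1 ▸ le_add_self)
    have f2 : a₂ ≠ ⊤ := ne_top_of_le_ne_top (potSum_ne_top N (x' - w)) (e2 ▸ le_add_self)
    rw [e1, e2] at h1
    -- The averaged potentials `a₁` and `a₂` occur on both sides and cancel, being finite at a fixed
    -- horizon.
    refine (ENNReal.add_le_add_iff_right (ENNReal.add_ne_top.2 ⟨f1, f2⟩)).1 ?_
    calc _ = _ := (add_assoc _ _ _).symm
      _ ≤ _ := h1
      _ = _ := by ring
  -- The error is the mean of `ρ (N - T_A)`. As `T_A` is almost surely finite, dominated convergence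
  -- sends it to zero.
  have herr : Tendsto err atTop (𝓝 0) := by
    have := tendsto_lintegral_of_dominated_convergence (μ := Measure.count)
      (F := fun N j => ρ (N - j) * firstHit p A j 1 w) (f := fun _ => 0)
      (fun j => (∑' n, t n) * firstHit p A j 1 w) (fun N => measurable_from_top)
      (fun N => Eventually.of_forall fun j => mul_le_mul_left (hρle _) _) ?_
      (Eventually.of_forall fun j => ?_)
    · simpa only [lintegral_count, lintegral_zero] using this
    · rw [lintegral_count, ENNReal.tsum_mul_left, ← hit, hw, mul_one]; exact ht
    · have h1 : Tendsto (fun N => ρ (N - j)) atTop (𝓝 0) := hρ0.comp (tendsto_sub_atTop_nat j)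
      have h2 : firstHit p A j 1 w ≠ ⊤ := ne_top_of_le_ne_top ENNReal.one_ne_top
        (hw ▸ ENNReal.le_tsum j)
      simpa using ENNReal.Tendsto.mul_const h1 (Or.inr h2)
  have l1 := ENNReal.tendsto_nat_tsum fun n => survive p A n (pt x) w
  have l2 := herr.const_add (green p A (pt x') w + H)
  rw [add_zero] at l2
  refine le_of_tendsto_of_tendsto' l1 l2 fun N => (fin N).trans ?_
  gcongr
  exact ENNReal.sum_le_tsum _

end LatticeWalk

namespace LatticeWalk

/-! ### Optional stopping for explicit functions -/

variable {p : PMF (ℤ × ℤ)}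

theorem stepOp_ofReal_le {F B : ℤ × ℤ → ℝ} {b : ℝ} {x : ℤ × ℤ} (hF : ∀ z, 0 ≤ F (x + z))
    (h : ∀ z, F (x + z) ≤ B z) (hB : HasSum (fun z => pr p z * B z) b) :
    stepOp p (fun y => ENNReal.ofReal (F y)) x ≤ ENNReal.ofReal b := by
  have h0 : ∀ z, 0 ≤ pr p z * B z := fun z => mul_nonneg (pr_nonneg z) ((hF z).trans (h z))
  rw [← hB.tsum_eq, ENNReal.ofReal_tsum_of_nonneg h0 hB.summable]
  refine ENNReal.tsum_le_tsum fun z => ?_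
  rw [ENNReal.ofReal_mul (pr_nonneg z), ENNReal.ofReal_toReal (p.apply_ne_top z)]
  exact mul_le_mul_right (ENNReal.ofReal_le_ofReal (h z)) _

theorem ofReal_le_stepOp {F B : ℤ × ℤ → ℝ} {b : ℝ} {x : ℤ × ℤ}
    (h : ∀ z, B z ≤ F (x + z)) (hB : HasSum (fun z => pr p z * B z) b) :
    ENNReal.ofReal b ≤ stepOp p (fun y => ENNReal.ofReal (F y)) x := by
  -- The minorant may be negative and `ENNReal.ofReal` truncates; taking the positive part before
  -- summing can only raise the sum.
  have h0 : ∀ z, 0 ≤ pr p z * max (B z) 0 := fun z => mul_nonneg (pr_nonneg z) (le_max_right _ _)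
  have hs : Summable fun z => pr p z * max (B z) 0 := by
    refine Summable.of_nonneg_of_le h0 (fun z => ?_) hB.summable.abs
    rw [abs_mul, abs_of_nonneg (pr_nonneg z)]
    exact mul_le_mul_of_nonneg_left (max_le (le_abs_self _) (abs_nonneg _)) (pr_nonneg z)
  have h1 : b ≤ ∑' z, pr p z * max (B z) 0 := by
    rw [← hB.tsum_eq]
    exact hB.summable.tsum_le_tsum
      (fun z => mul_le_mul_of_nonneg_left (le_max_left _ _) (pr_nonneg z)) hs
  refine (ENNReal.ofReal_le_ofReal h1).trans ?_
  rw [ENNReal.ofReal_tsum_of_nonneg h0 hs]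
  refine ENNReal.tsum_le_tsum fun z => ?_
  rw [ENNReal.ofReal_mul (pr_nonneg z), ENNReal.ofReal_toReal (p.apply_ne_top z)]
  refine mul_le_mul_right ?_ _
  rcases le_total (B z) 0 with hz | hz
  · simp [max_eq_right hz]
  · rw [max_eq_left hz]; exact ENNReal.ofReal_le_ofReal (h z)

/-- The third absolute moment of the step distribution. -/
def mom3 (p : PMF (ℤ × ℤ)) : ℝ := ∑' z, pr p z * enorm2 z ^ 3

theorem mom3_nonneg : 0 ≤ mom3 p :=
  tsum_nonneg fun z => mul_nonneg (pr_nonneg z) (pow_nonneg (enorm2_nonneg z) 3)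

theorem IsRegular.hasSum_cube (h : IsRegular p) :
    HasSum (fun z => pr p z * enorm2 z ^ 3) (mom3 p) := h.mom.hasSum

theorem IsRegular.hasSum_sq (h : IsRegular p) : HasSum (fun z => pr p z * enorm2 z ^ 2) 2 := by
  have := h.cov.1.add h.cov.2.1
  rw [one_add_one_eq_two] at this
  have e : (fun z => pr p z * enorm2 z ^ 2)
      = fun z : ℤ × ℤ => pr p z * (z.1 : ℝ) ^ 2 + pr p z * (z.2 : ℝ) ^ 2 := by
    funext z; rw [enorm2_sq]; ring
  rw [e]; exact this

theorem IsRegular.hasSum_linear (h : IsRegular p) (c d : ℝ) :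
    HasSum (fun z : ℤ × ℤ => pr p z * (c * z.1 + d * z.2)) 0 := by
  refine hasSum_odd_zero h.symm (fun z => by simp; ring) ?_
  refine Summable.of_norm_bounded (h.summable_one.mul_left (|c| + |d|)) fun z => ?_
  rw [norm_mul, Real.norm_of_nonneg (pr_nonneg z), Real.norm_eq_abs]
  have h1 : |c * z.1 + d * z.2| ≤ (|c| + |d|) * enorm2 z := by
    refine (abs_add_le _ _).trans ?_
    rw [abs_mul, abs_mul, add_mul]
    gcongr
    · exact abs_fst_le z
    · exact abs_snd_le z
  calc _ ≤ pr p z * ((|c| + |d|) * enorm2 z) := mul_le_mul_of_nonneg_left h1 (pr_nonneg z)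
    _ = _ := by ring

theorem enorm2_add_sq (x z : ℤ × ℤ) :
    enorm2 (x + z) ^ 2 = enorm2 x ^ 2 + (2 * x.1 * z.1 + 2 * x.2 * z.2) + enorm2 z ^ 2 := by
  simp only [enorm2_sq, Prod.fst_add, Prod.snd_add]
  push_cast; ring

theorem IsRegular.hasSum_add_sq (h : IsRegular p) (x : ℤ × ℤ) :
    HasSum (fun z => pr p z * enorm2 (x + z) ^ 2) (enorm2 x ^ 2 + 2) := by
  have := ((hasSum_pr (p := p)).mul_right (enorm2 x ^ 2)).add
    ((h.hasSum_linear (2 * x.1) (2 * x.2)).add h.hasSum_sq)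
  rw [one_mul, zero_add] at this
  have e : (fun z => pr p z * enorm2 (x + z) ^ 2) = fun z : ℤ × ℤ => pr p z * enorm2 x ^ 2
      + (pr p z * (2 * x.1 * z.1 + 2 * x.2 * z.2) + pr p z * enorm2 z ^ 2) := by
    funext z; rw [enorm2_add_sq]; ring
  rw [e]; exact this

/-- A jump from within `(1 - κ) L` to beyond `L` has length at least `κ` times the norm of the
landing point. Hence the squared landing norm is paid for by the third moment. -/
theorem sq_le_cube_div {v z : ℤ × ℤ} {ρ L κ : ℝ} (hκ : 0 < κ) (hL : 0 < L) (hv : enorm2 v ≤ ρ)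
    (hρ : ρ ≤ (1 - κ) * L) (hvz : L ≤ enorm2 (v + z)) :
    enorm2 (v + z) ^ 2 ≤ enorm2 z ^ 3 * (1 / (κ ^ 3 * L)) := by
  have h1 := enorm2_add_le v z
  have h2 : κ * enorm2 (v + z) ≤ enorm2 z := by
    by_cases h : κ ≤ 1
    · nlinarith
    · push Not at h
      have := enorm2_nonneg v
      nlinarith
  have h3 := pow_le_pow_left₀ (mul_nonneg hκ.le (enorm2_nonneg _)) h2 3
  rw [mul_one_div, le_div_iff₀ (by positivity)]
  calc enorm2 (v + z) ^ 2 * (κ ^ 3 * L) ≤ enorm2 (v + z) ^ 2 * (κ ^ 3 * enorm2 (v + z)) := by gcongr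
    _ = (κ * enorm2 (v + z)) ^ 3 := by ring
    _ ≤ _ := h3

variable {S : Set (ℤ × ℤ)}

/-- The expected exit time of a disc of radius `ρ` is `O(ρ²)`. -/
theorem IsRegular.green_one_le (h : IsRegular p) {ρ : ℝ} (hρ1 : 1 ≤ ρ) (hρ : mom3 p ≤ ρ)
    (hS : ∀ y ∉ S, enorm2 y ≤ ρ) (x : ℤ × ℤ) : green p S 1 x ≤ ENNReal.ofReal (64 * ρ ^ 2) := by
  -- The complement of `|y|²`, truncated at radius `8ρ` to stay nonnegative. The exact drift is `-2`
  -- and the truncation costs at most `mom3 p / ρ ≤ 1`, so a drift of `-1` remains.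
  let F : ℤ × ℤ → ℝ := fun y => 64 * ρ ^ 2 - min (enorm2 y ^ 2) (64 * ρ ^ 2)
  have hF0 : ∀ y, 0 ≤ F y := fun y => sub_nonneg.2 (min_le_right _ _)
  have key : ∀ y ∉ S, stepOp p (fun y => ENNReal.ofReal (F y)) y + (1 : ℤ × ℤ → ℝ≥0∞) y
      ≤ ENNReal.ofReal (F y) + (0 : ℤ × ℤ → ℝ≥0∞) y := by
    intro y hy
    have hyρ := hS y hy
    have hy2 : enorm2 y ^ 2 ≤ ρ ^ 2 := pow_le_pow_left₀ (enorm2_nonneg y) hyρ 2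
    have hs := (((hasSum_pr (p := p)).mul_right (64 * ρ ^ 2)).sub (h.hasSum_add_sq y)).add
      (h.hasSum_cube.mul_right (1 / ρ))
    have hFy : F y = 64 * ρ ^ 2 - enorm2 y ^ 2 := by
      simp only [F]; rw [min_eq_left (by nlinarith)]
    have h1 := stepOp_ofReal_le (p := p) (F := F) (x := y)
      (B := fun z => 64 * ρ ^ 2 - enorm2 (y + z) ^ 2 + enorm2 z ^ 3 * (1 / ρ))
      (b := 1 * (64 * ρ ^ 2) - (enorm2 y ^ 2 + 2) + mom3 p * (1 / ρ)) (fun z => hF0 _)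
      (fun z => by
        have hz : 0 ≤ enorm2 z ^ 3 * (1 / ρ) := by have := enorm2_nonneg z; positivity
        simp only [F]
        rcases le_total (enorm2 (y + z) ^ 2) (64 * ρ ^ 2) with hle | hle
        · rw [min_eq_left hle]; linarith
        · rw [min_eq_right hle]
          have h8 : 8 * ρ ≤ enorm2 (y + z) :=
            le_of_sq_le_sq (by linarith) (enorm2_nonneg _)
          have := sq_le_cube_div (κ := 1 / 2) (by norm_num) (by positivity) hyρ
            (by linarith) h8
          rw [show (1 / 2 : ℝ) ^ 3 * (8 * ρ) = ρ by ring] at this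
          nlinarith [sq_nonneg ρ])
      (by
        have e : (fun z => pr p z * (64 * ρ ^ 2 - enorm2 (y + z) ^ 2 + enorm2 z ^ 3 * (1 / ρ)))
            = fun z => pr p z * (64 * ρ ^ 2) - pr p z * enorm2 (y + z) ^ 2
              + pr p z * enorm2 z ^ 3 * (1 / ρ) := by funext z; ring
        rw [e]; exact hs)
    have h2 : mom3 p * (1 / ρ) ≤ 1 := by
      rw [mul_one_div, div_le_one (by linarith)]; exact hρ
    calc _ ≤ ENNReal.ofReal (1 * (64 * ρ ^ 2) - (enorm2 y ^ 2 + 2) + mom3 p * (1 / ρ))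
          + ENNReal.ofReal 1 := by
          rw [ENNReal.ofReal_one]; exact add_le_add_left h1 _
      _ ≤ ENNReal.ofReal (F y - 1) + ENNReal.ofReal 1 := by
          gcongr
          linarith
      _ = _ := by
          rw [← ENNReal.ofReal_add (by rw [hFy]; nlinarith) zero_le_one]; simp
  have := hit_add_green_le key x
  refine le_add_self.trans (this.trans ?_)
  have h0 : green p S 0 x = 0 := by rw [green_eq_tsum]; simp
  rw [h0, add_zero]
  refine ENNReal.ofReal_le_ofReal ?_
  have : 0 ≤ min (enorm2 x ^ 2) (64 * ρ ^ 2) := by positivity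
  simp only [F]; linarith

/-- The squared norm cut off below the level `L`. -/
def farSq (L : ℝ) (y : ℤ × ℤ) : ℝ≥0∞ := if L ≤ enorm2 y then ENNReal.ofReal (enorm2 y ^ 2) else 0

theorem IsRegular.stepOp_farSq_le (h : IsRegular p) {ρ L κ : ℝ} (hκ : 0 < κ) (hL : 0 < L)
    (hρ : ρ ≤ (1 - κ) * L) {x : ℤ × ℤ} (hx : enorm2 x ≤ ρ) :
    stepOp p (farSq L) x ≤ ENNReal.ofReal (mom3 p / (κ ^ 3 * L)) := by
  have h1 := stepOp_ofReal_le (p := p) (x := x)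
    (F := fun y => if L ≤ enorm2 y then enorm2 y ^ 2 else 0)
    (B := fun z => enorm2 z ^ 3 * (1 / (κ ^ 3 * L))) (b := mom3 p * (1 / (κ ^ 3 * L)))
    (fun z => by split_ifs <;> positivity)
    (fun z => by
      split_ifs with hz
      · exact sq_le_cube_div hκ hL hx hρ hz
      · have := enorm2_nonneg z; positivity)
    (by
      have := h.hasSum_cube.mul_right (1 / (κ ^ 3 * L))
      simpa only [mul_assoc] using this)
  rw [mul_one_div] at h1
  convert h1 using 3 with y
  by_cases hy : L ≤ enorm2 y <;> simp [farSq, hy]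

/-- Overshoot estimate. -/
theorem IsRegular.hit_farSq_le (h : IsRegular p) {ρ L κ : ℝ} (hκ : 0 < κ) (hL : 0 < L)
    (hρ : ρ ≤ (1 - κ) * L) (hS : ∀ y ∉ S, enorm2 y ≤ ρ) {x : ℤ × ℤ} (hx : x ∉ S) :
    hit p S (farSq L) x ≤ ENNReal.ofReal (mom3 p / (κ ^ 3 * L)) * green p S 1 x := by
  -- The overshoot is charged to the last step, so every unit of time before the exit costs at most
  -- its one-step bound.
  rw [hit_eq_green hx]
  exact green_le_of_le (fun y hy => (stepOp_mono (indicator_le_self _ _) y).trans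
    (h.stepOp_farSq_le hκ hL hρ (hS y hy))) x

/-- The complement of the annulus `{a ≤ |y| < b}`. -/
def annc (a b : ℝ) : Set (ℤ × ℤ) := {y | enorm2 y < a ∨ b ≤ enorm2 y}

/-- The complement of the disc of radius `b`. -/
def outer (b : ℝ) : Set (ℤ × ℤ) := {y | b ≤ enorm2 y}

theorem notMem_annc {a b : ℝ} {y : ℤ × ℤ} : y ∉ annc a b ↔ a ≤ enorm2 y ∧ enorm2 y < b := by
  simp [annc]

/-- The probability that the walk started at `x` leaves the disc of radius `b` before it enters
the disc of radius `a`. -/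
def escape (p : PMF (ℤ × ℤ)) (a b : ℝ) (x : ℤ × ℤ) : ℝ≥0∞ :=
  hit p (annc a b) ((outer b).indicator 1) x

theorem escape_le_one (a b : ℝ) (x : ℤ × ℤ) : escape p a b x ≤ 1 :=
  (hit_mono (fun y _ => indicator_le_self _ _ y) x).trans (hit_one_le x)

theorem IsRegular.ofReal_sq_add_two_le (h : IsRegular p) (x : ℤ × ℤ) :
    ENNReal.ofReal (enorm2 x ^ 2) + 2
      ≤ stepOp p (fun y => ENNReal.ofReal (enorm2 y ^ 2)) x := by
  have := ofReal_le_stepOp (p := p) (F := fun y => enorm2 y ^ 2) (x := x) (fun z => le_rfl)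
    (h.hasSum_add_sq x)
  rwa [ENNReal.ofReal_add (sq_nonneg _) zero_le_two, ENNReal.ofReal_ofNat] at this

/-- The expected exit time from an annulus is controlled by the escape probability. -/
theorem IsRegular.green_one_le_escape (h : IsRegular p) {a b : ℝ} (hb1 : 1 ≤ b) (ha : 0 ≤ a)
    (hb : mom3 p ≤ b) {x : ℤ × ℤ} (hx : x ∉ annc a b) :
    green p (annc a b) 1 x ≤ ENNReal.ofReal (16 * b ^ 2) * escape p a b x := by
  have hS : ∀ y ∉ annc a b, enorm2 y ≤ b := fun y hy => (notMem_annc.1 hy).2.le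
  have hfin : green p (annc a b) 1 x ≠ ⊤ :=
    ne_top_of_le_ne_top ENNReal.ofReal_ne_top (h.green_one_le hb1 hb hS x)
  -- Since `|y|² - 2n` is a martingale, `|x|² + 2 E T` is at most the mean of `|X_T|²`. That mean is
  -- at most `a²`, plus `16 b²` times the escape probability, plus an overshoot part bounded by `E
  -- T`; since `|x| ≥ a`, the claim follows on cancelling one `E T`.
  have h1 := le_hit_add_green (p := p) (S := annc a b)
    (F := fun y => ENNReal.ofReal (enorm2 y ^ 2)) (e := fun _ => 2 * 1) (d := fun _ => 0 * 1)
    (B := ENNReal.ofReal (b ^ 2)) ENNReal.ofReal_ne_top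
    (fun y hy => ENNReal.ofReal_le_ofReal (pow_le_pow_left₀ (enorm2_nonneg y) (hS y hy) 2))
    (fun y _ => by simpa using h.ofReal_sq_add_two_le y) hfin
  rw [green_const_mul, green_const_mul, zero_mul, add_zero] at h1
  have h2 : hit p (annc a b) (fun y => ENNReal.ofReal (enorm2 y ^ 2)) x
      ≤ ENNReal.ofReal (a ^ 2) + ENNReal.ofReal (16 * b ^ 2) * escape p a b x
        + green p (annc a b) 1 x := by
    have h3 : hit p (annc a b) (fun y => ENNReal.ofReal (enorm2 y ^ 2)) x
        ≤ hit p (annc a b) ((fun _ => ENNReal.ofReal (a ^ 2) * 1)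
          + (fun y => ENNReal.ofReal (16 * b ^ 2) * (outer b).indicator 1 y) + farSq (4 * b)) x := by
      refine hit_mono (fun y hy => ?_) x
      simp only [Pi.add_apply]
      rcases hy with hy | hy
      · refine le_add_right (le_add_right ?_)
        rw [mul_one]
        exact ENNReal.ofReal_le_ofReal (pow_le_pow_left₀ (enorm2_nonneg y) hy.le 2)
      · by_cases h4 : 4 * b ≤ enorm2 y
        · refine le_add_left ?_
          rw [farSq, if_pos h4]
        · refine le_add_right (le_add_left ?_)
          rw [indicator_of_mem (show y ∈ outer b from hy), Pi.one_apply, mul_one]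
          refine ENNReal.ofReal_le_ofReal ?_
          push Not at h4
          nlinarith [enorm2_nonneg y]
    refine h3.trans ?_
    rw [hit_add, hit_add, Pi.add_apply, Pi.add_apply, hit_const_mul, hit_const_mul]
    gcongr
    · exact mul_le_of_le_one_right' (hit_one_le x)
    · exact le_rfl
    · refine (h.hit_farSq_le (κ := 3 / 4) (by norm_num) (by linarith : 0 < 4 * b)
        (by linarith) hS hx).trans ?_
      refine mul_le_of_le_one_left' ?_
      rw [ENNReal.ofReal_le_one, div_le_one (by positivity)]
      linarith
  have hxa : ENNReal.ofReal (a ^ 2) ≤ ENNReal.ofReal (enorm2 x ^ 2) :=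
    ENNReal.ofReal_le_ofReal (pow_le_pow_left₀ ha (notMem_annc.1 hx).1 2)
  have h4 : ENNReal.ofReal (enorm2 x ^ 2) + green p (annc a b) 1 x + green p (annc a b) 1 x
      ≤ ENNReal.ofReal (enorm2 x ^ 2) + ENNReal.ofReal (16 * b ^ 2) * escape p a b x
        + green p (annc a b) 1 x := by
    calc _ = ENNReal.ofReal (enorm2 x ^ 2) + 2 * green p (annc a b) 1 x := by ring
      _ ≤ _ := h1
      _ ≤ _ := h2
      _ ≤ _ := by gcongr
  rw [ENNReal.add_le_add_iff_right hfin,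
    ENNReal.add_le_add_iff_left ENNReal.ofReal_ne_top] at h4
  exact h4

theorem one_le_green_one {x : ℤ × ℤ} (hx : x ∉ S) : 1 ≤ green p S 1 x := by
  refine le_trans ?_ (ENNReal.le_tsum 0)
  rw [survive_zero_of_notMem hx]; rfl

/-! #### The logarithm -/

/-- The truncated logarithm `log (max(|y|, ρ) / ρ)`. -/
def tlog (ρ : ℝ) (y : ℤ × ℤ) : ℝ := Real.log (max (enorm2 y) ρ / ρ)

theorem tlog_nonneg {ρ : ℝ} (hρ : 0 < ρ) (y : ℤ × ℤ) : 0 ≤ tlog ρ y := by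
  refine Real.log_nonneg ?_
  rw [le_div_iff₀ hρ, one_mul]; exact le_max_right _ _

theorem tlog_of_le {ρ : ℝ} {y : ℤ × ℤ} (h : ρ ≤ enorm2 y) : tlog ρ y = Real.log (enorm2 y / ρ) := by
  rw [tlog, max_eq_left h]

theorem tlog_le_log {ρ a : ℝ} (hρ : 0 < ρ) (ha : ρ ≤ a) {y : ℤ × ℤ} (h : enorm2 y ≤ a) :
    tlog ρ y ≤ Real.log (a / ρ) := by
  have : 0 < max (enorm2 y) ρ := lt_max_of_lt_right hρ
  exact Real.log_le_log (by positivity) (by gcongr; exact max_le h ha)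

theorem tlog_le_add {ρ : ℝ} (hρ : 0 < ρ) (x y : ℤ × ℤ) :
    tlog ρ x ≤ tlog ρ y + |enorm2 x - enorm2 y| / ρ := by
  set s := max (enorm2 x) ρ with hs
  set t := max (enorm2 y) ρ with ht
  have hs0 : 0 < s := lt_max_of_lt_right hρ
  have ht0 : 0 < t := lt_max_of_lt_right hρ
  have htρ : ρ ≤ t := le_max_right _ _
  have h1 : |s - t| ≤ |enorm2 x - enorm2 y| := abs_max_sub_max_le_abs _ _ _
  have h2 : Real.log (s / ρ) - Real.log (t / ρ) = Real.log (s / t) := by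
    rw [Real.log_div hs0.ne' hρ.ne', Real.log_div ht0.ne' hρ.ne', Real.log_div hs0.ne' ht0.ne']
    ring
  have h3 := Real.log_le_sub_one_of_pos (div_pos hs0 ht0)
  have h4 : s / t - 1 = (s - t) / t := by field_simp
  have h5 : (s - t) / t ≤ |enorm2 x - enorm2 y| / ρ := by
    calc (s - t) / t ≤ |s - t| / t := by gcongr; exact le_abs_self _
      _ ≤ |enorm2 x - enorm2 y| / ρ := by gcongr
  have : tlog ρ x = Real.log (s / ρ) := rfl
  have : tlog ρ y = Real.log (t / ρ) := rfl
  linarith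

theorem abs_tlog_sub_le {ρ : ℝ} (hρ : 0 < ρ) (x z : ℤ × ℤ) :
    |tlog ρ (x + z) - tlog ρ x| ≤ enorm2 z / ρ := by
  have h1 := tlog_le_add hρ (x + z) x
  have h2 := tlog_le_add hρ x (x + z)
  have h3 : |enorm2 (x + z) - enorm2 x| ≤ enorm2 z := by
    have := abs_norm_sub_norm_le (toC (x + z)) (toC x)
    rw [← map_sub, add_sub_cancel_left] at this
    simpa only [enorm2_eq_norm] using this
  have h4 : |enorm2 (x + z) - enorm2 x| / ρ ≤ enorm2 z / ρ := by gcongr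
  rw [abs_sub_comm] at h2
  rw [abs_le]; constructor <;> linarith

/-- The real part of the second-order Taylor expansion of the complex logarithm, with the cubic
remainder that the third moment can absorb. -/
theorem abs_log_norm_one_add_sub_le {ζ : ℂ} (hζ : ‖ζ‖ ≤ 1 / 2) :
    |Real.log ‖1 + ζ‖ - (ζ.re - (ζ ^ 2).re / 2)| ≤ ‖ζ‖ ^ 3 := by
  have h1 := Complex.norm_log_sub_logTaylor_le 2 (z := ζ) (by linarith)
  have h2 : Complex.logTaylor (2 + 1) ζ = ζ - ζ ^ 2 / 2 := by
    simp [Complex.logTaylor_succ, Complex.logTaylor_zero]; ring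
  rw [h2] at h1
  have h3 := (Complex.abs_re_le_norm _).trans h1
  rw [Complex.sub_re, Complex.log_re, Complex.sub_re, Complex.div_ofNat_re] at h3
  refine h3.trans ?_
  have h4 : (1 - ‖ζ‖)⁻¹ ≤ 2 := by
    rw [inv_le_comm₀ (by linarith) (by norm_num)]; linarith
  have h5 : ‖ζ‖ ^ (2 + 1) * (1 - ‖ζ‖)⁻¹ ≤ ‖ζ‖ ^ 3 * 2 := by gcongr
  have h6 := pow_nonneg (norm_nonneg ζ) 3
  push_cast
  linarith

/-- Jumps with `|z| ≤ κ|x|` do not reach the truncation radius, and the Taylor expansion applies.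
For longer jumps no cancellation is needed: the increment and both Taylor terms are each bounded by
the cubic error. -/
theorem abs_tlog_sub_taylor_le {ρ κ : ℝ} (hρ : 0 < ρ) (hκ : 0 < κ) (hκ1 : κ ≤ 1 / 2) {x : ℤ × ℤ}
    (hx : ρ ≤ (1 - κ) * enorm2 x) (z : ℤ × ℤ) :
    |tlog ρ (x + z) - tlog ρ x - ((toC z / toC x).re - ((toC z / toC x) ^ 2).re / 2)|
      ≤ 3 / (κ ^ 2 * enorm2 x ^ 2 * ρ) * enorm2 z ^ 3 := by
  have hx0 : 0 < enorm2 x := by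
    by_contra! hle
    nlinarith
  have hρx : ρ ≤ enorm2 x := by nlinarith
  set ζ := toC z / toC x with hζ
  have hζn : ‖ζ‖ = enorm2 z / enorm2 x := by rw [hζ, norm_div, enorm2_eq_norm, enorm2_eq_norm]
  have hz0 := enorm2_nonneg z
  have hxC : toC x ≠ 0 := by rw [← norm_pos_iff, ← enorm2_eq_norm]; exact hx0
  by_cases hs : ‖ζ‖ ≤ κ
  · have h1 : toC (x + z) = toC x * (1 + ζ) := by rw [map_add, hζ]; field_simp
    have h2 : enorm2 (x + z) = enorm2 x * ‖1 + ζ‖ := by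
      rw [enorm2_eq_norm, h1, norm_mul, enorm2_eq_norm]
    have h3 : 1 - κ ≤ ‖1 + ζ‖ := by
      have := norm_sub_norm_le (1 : ℂ) (-ζ)
      rw [norm_one, norm_neg, sub_neg_eq_add] at this
      linarith
    have h4 : ρ ≤ enorm2 (x + z) := by rw [h2]; nlinarith
    have h5 : tlog ρ (x + z) - tlog ρ x = Real.log ‖1 + ζ‖ := by
      have : 0 < ‖1 + ζ‖ := by linarith
      rw [tlog_of_le h4, tlog_of_le hρx, h2, mul_div_right_comm,
        Real.log_mul (by positivity) this.ne']
      ring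
    rw [h5]
    refine (abs_log_norm_one_add_sub_le (hs.trans hκ1)).trans ?_
    rw [hζn, div_pow, div_mul_eq_mul_div, div_le_div_iff₀ (by positivity) (by positivity)]
    have h6 : κ ^ 2 ≤ 1 := by nlinarith
    have h7 : κ ^ 2 * enorm2 x ^ 2 * ρ ≤ 1 * enorm2 x ^ 2 * enorm2 x := by gcongr
    have h8 : κ ^ 2 * enorm2 x ^ 2 * ρ ≤ 3 * enorm2 x ^ 3 := by
      have := pow_pos hx0 3
      linarith
    calc enorm2 z ^ 3 * (κ ^ 2 * enorm2 x ^ 2 * ρ) ≤ enorm2 z ^ 3 * (3 * enorm2 x ^ 3) := by gcongr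
      _ = _ := by ring
  · push Not at hs
    have hκz : κ * enorm2 x ≤ enorm2 z := by
      rw [hζn, lt_div_iff₀ hx0] at hs; exact hs.le
    set T := enorm2 z ^ 3 / (κ ^ 2 * enorm2 x ^ 2 * ρ) with hT
    have hsq : (κ * enorm2 x) ^ 2 ≤ enorm2 z ^ 2 := pow_le_pow_left₀ (by positivity) hκz 2
    have a1 : enorm2 z / ρ ≤ T := by
      rw [hT, div_le_div_iff₀ hρ (by positivity)]
      calc enorm2 z * (κ ^ 2 * enorm2 x ^ 2 * ρ) = enorm2 z * ρ * (κ * enorm2 x) ^ 2 := by ring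
        _ ≤ enorm2 z * ρ * enorm2 z ^ 2 := by gcongr
        _ = _ := by ring
    have a2 : ‖ζ‖ ≤ T := by
      rw [hζn]
      exact (div_le_div_of_nonneg_left hz0 hρ hρx).trans a1
    have a3 : ‖ζ‖ ^ 2 ≤ T := by
      rw [hζn, div_pow, hT, div_le_div_iff₀ (by positivity) (by positivity)]
      calc enorm2 z ^ 2 * (κ ^ 2 * enorm2 x ^ 2 * ρ)
          = enorm2 z ^ 2 * enorm2 x ^ 2 * (κ * (κ * ρ)) := by ring
        _ ≤ enorm2 z ^ 2 * enorm2 x ^ 2 * (1 * enorm2 z) := by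
          gcongr
          · linarith
          · exact (mul_le_mul_of_nonneg_left hρx hκ.le).trans hκz
        _ = _ := by ring
    have b1 := abs_tlog_sub_le hρ x z
    have b2 := Complex.abs_re_le_norm ζ
    have b3 : |(ζ ^ 2).re| ≤ ‖ζ‖ ^ 2 := by rw [← norm_pow]; exact Complex.abs_re_le_norm _
    have e : 3 / (κ ^ 2 * enorm2 x ^ 2 * ρ) * enorm2 z ^ 3 = 3 * T := by rw [hT]; ring
    rw [e]
    have hT0 : 0 ≤ T := by positivity
    rw [abs_le] at *
    constructor <;> linarith [b1.1, b1.2, b2.1, b2.2, b3.1, b3.2]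

/-- This is the harmonicity of `log |y|`. The linear term has mean zero by symmetry, and `E (z₁ + i
z₂)² = 0` because the covariance matrix is the identity. -/
theorem IsRegular.hasSum_re (h : IsRegular p) (x : ℤ × ℤ) :
    HasSum (fun z => pr p z * ((toC z / toC x).re - ((toC z / toC x) ^ 2).re / 2)) 0 := by
  set w := (toC x)⁻¹ with hw
  have h1 := h.hasSum_linear w.re (-w.im)
  have h2 := (h.cov.1.sub h.cov.2.1).mul_left ((w ^ 2).re)
  have h3 := h.cov.2.2.mul_left (-2 * (w ^ 2).im)
  have h4 := h1.sub ((h2.add h3).div_const 2)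
  have e : (fun z => pr p z * ((toC z / toC x).re - ((toC z / toC x) ^ 2).re / 2))
      = fun z : ℤ × ℤ => pr p z * (w.re * z.1 + -w.im * z.2)
        - ((w ^ 2).re * (pr p z * (z.1 : ℝ) ^ 2 - pr p z * (z.2 : ℝ) ^ 2)
          + -2 * (w ^ 2).im * (pr p z * ((z.1 : ℝ) * z.2))) / 2 := by
    funext z
    rw [div_eq_mul_inv, ← hw, mul_pow]
    simp only [Complex.mul_re, Complex.mul_im, sq, toC_re, toC_im]
    ring
  rw [e]
  simpa using h4

/-- `tlog` is almost harmonic. -/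
theorem IsRegular.tlog_almost_harmonic (h : IsRegular p) {ρ κ : ℝ} (hρ : 0 < ρ) (hκ : 0 < κ)
    (hκ1 : κ ≤ 1 / 2) {x : ℤ × ℤ} (hx : ρ ≤ (1 - κ) * enorm2 x) {ε : ℝ}
    (hε : 3 * mom3 p / (κ ^ 2 * ρ ^ 3) ≤ ε) :
    stepOp p (fun y => ENNReal.ofReal (tlog ρ y)) x ≤ ENNReal.ofReal (tlog ρ x) + ENNReal.ofReal ε ∧
    ENNReal.ofReal (tlog ρ x)
      ≤ stepOp p (fun y => ENNReal.ofReal (tlog ρ y)) x + ENNReal.ofReal ε := by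
  have hm := mom3_nonneg (p := p)
  have hε0 : 0 ≤ ε := le_trans (by positivity) hε
  set D := 3 / (κ ^ 2 * enorm2 x ^ 2 * ρ) with hD
  have hρx : ρ ≤ enorm2 x := by
    have := enorm2_nonneg x
    nlinarith
  have hDε : mom3 p * D ≤ ε := by
    refine le_trans ?_ hε
    rw [hD, mul_div_assoc', mul_comm (mom3 p)]
    refine div_le_div_of_nonneg_left (by positivity) (by positivity) ?_
    calc κ ^ 2 * ρ ^ 3 = κ ^ 2 * ρ ^ 2 * ρ := by ring
      _ ≤ κ ^ 2 * enorm2 x ^ 2 * ρ := by gcongr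
  have tay := abs_tlog_sub_taylor_le hρ hκ hκ1 hx
  have base := ((hasSum_pr (p := p)).mul_right (tlog ρ x)).add (h.hasSum_re x)
  rw [one_mul, add_zero] at base
  have cube := h.hasSum_cube.mul_right D
  constructor
  · have := stepOp_ofReal_le (p := p) (F := tlog ρ) (x := x) (fun z => tlog_nonneg hρ _)
      (B := fun z => tlog ρ x + ((toC z / toC x).re - ((toC z / toC x) ^ 2).re / 2)
        + D * enorm2 z ^ 3) (b := tlog ρ x + mom3 p * D)
      (fun z => by linarith [(abs_le.1 (tay z)).2])
      (by
        have e : (fun z => pr p z * (tlog ρ x + ((toC z / toC x).re - ((toC z / toC x) ^ 2).re / 2)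
            + D * enorm2 z ^ 3)) = fun z => pr p z * tlog ρ x
            + pr p z * ((toC z / toC x).re - ((toC z / toC x) ^ 2).re / 2)
            + pr p z * enorm2 z ^ 3 * D := by funext z; ring
        rw [e]; exact base.add cube)
    refine this.trans ?_
    rw [← ENNReal.ofReal_add (tlog_nonneg hρ x) hε0]
    exact ENNReal.ofReal_le_ofReal (by linarith)
  · have := ofReal_le_stepOp (p := p) (F := tlog ρ) (x := x)
      (B := fun z => tlog ρ x + ((toC z / toC x).re - ((toC z / toC x) ^ 2).re / 2)
        - D * enorm2 z ^ 3) (b := tlog ρ x - mom3 p * D)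
      (fun z => by linarith [(abs_le.1 (tay z)).1])
      (by
        have e : (fun z => pr p z * (tlog ρ x + ((toC z / toC x).re - ((toC z / toC x) ^ 2).re / 2)
            - D * enorm2 z ^ 3)) = fun z => pr p z * tlog ρ x
            + pr p z * ((toC z / toC x).re - ((toC z / toC x) ^ 2).re / 2)
            - pr p z * enorm2 z ^ 3 * D := by funext z; ring
        rw [e]; exact base.sub cube)
    calc ENNReal.ofReal (tlog ρ x) = ENNReal.ofReal ((tlog ρ x - mom3 p * D) + mom3 p * D) := by
          ring_nf
      _ ≤ ENNReal.ofReal (tlog ρ x - mom3 p * D) + ENNReal.ofReal (mom3 p * D) :=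
          ENNReal.ofReal_add_le
      _ ≤ _ := add_le_add this (ENNReal.ofReal_le_ofReal hDε)

/-! #### The squared distance to a disc -/

/-- The squared distance to the disc of radius `b`. -/
def distSq (b : ℝ) (y : ℤ × ℤ) : ℝ := max (enorm2 y - b) 0 ^ 2

/-- For the squared distance to a convex set, keeping the projection of `x` as competitor for `x +
z` gives at most `|x - πx + z|²`. Here `x - πx = k * x` with `k = (|x| - b)/|x|`; expanding the
square gives the bound. -/
theorem distSq_add_le {b : ℝ} (hb : 0 ≤ b) (x z : ℤ × ℤ) :
    distSq b (x + z) ≤ distSq b x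
      + (2 * (max (enorm2 x - b) 0 / enorm2 x * x.1) * z.1
        + 2 * (max (enorm2 x - b) 0 / enorm2 x * x.2) * z.2) + enorm2 z ^ 2 := by
  have h1 := enorm2_add_sq x z
  have hx := enorm2_nonneg x
  have hxz := enorm2_nonneg (x + z)
  have hz := enorm2_nonneg z
  simp only [distSq]
  rcases le_or_gt (enorm2 x) b with hxb | hxb
  · rw [max_eq_right (by linarith : enorm2 x - b ≤ 0)]
    have := enorm2_add_le x z
    have h2 : max (enorm2 (x + z) - b) 0 ≤ enorm2 z := max_le (by linarith) hz
    have h3 := pow_le_pow_left₀ (le_max_right _ _) h2 2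
    simpa using h3
  · have hx0 : 0 < enorm2 x := by linarith
    rw [max_eq_left (by linarith : 0 ≤ enorm2 x - b)]
    set k := (enorm2 x - b) / enorm2 x with hk
    have hk0 : 0 ≤ k := div_nonneg (by linarith) hx0.le
    have hk1 : k ≤ 1 := by rw [hk, div_le_one hx0]; linarith
    have hkx : k * enorm2 x = enorm2 x - b := by rw [hk]; field_simp
    have hnorm : enorm2 (x + z) ≤ b + √(((k * x.1 + z.1) ^ 2 + (k * x.2 + z.2) ^ 2)) := by
      have e1 : toC (x + z) = ((1 - k : ℝ) : ℂ) * toC x + (⟨k * x.1 + z.1, k * x.2 + z.2⟩ : ℂ) := by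
        apply Complex.ext
        · simp [toC_re]; ring
        · simp [toC_im]; ring
      rw [enorm2_eq_norm, e1]
      refine (norm_add_le _ _).trans (add_le_add ?_ ?_)
      · rw [norm_mul, Complex.norm_real, ← enorm2_eq_norm, Real.norm_of_nonneg (by linarith)]
        linarith
      · rw [Complex.norm_def, Complex.normSq_apply]
        simp only [sq]; exact le_rfl
    have h2 : max (enorm2 (x + z) - b) 0 ≤ √((k * x.1 + z.1) ^ 2 + (k * x.2 + z.2) ^ 2) :=
      max_le (by linarith) (Real.sqrt_nonneg _)
    have h3 := pow_le_pow_left₀ (le_max_right _ _) h2 2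
    rw [Real.sq_sqrt (by positivity)] at h3
    have h4 : (enorm2 x - b) ^ 2 = k ^ 2 * ((x.1 : ℝ) ^ 2 + (x.2 : ℝ) ^ 2) := by
      rw [← hkx, mul_pow, enorm2_sq]
    rw [h4, enorm2_sq z]
    linarith

theorem IsRegular.stepOp_distSq_le (h : IsRegular p) {b : ℝ} (hb : 0 ≤ b) (x : ℤ × ℤ) :
    stepOp p (fun y => ENNReal.ofReal (distSq b y)) x ≤ ENNReal.ofReal (distSq b x) + 2 := by
  have h0 : ∀ y, 0 ≤ distSq b y := fun y => by unfold distSq; positivity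
  have hs := (((hasSum_pr (p := p)).mul_right (distSq b x)).add
    (h.hasSum_linear (2 * (max (enorm2 x - b) 0 / enorm2 x * x.1))
      (2 * (max (enorm2 x - b) 0 / enorm2 x * x.2)))).add h.hasSum_sq
  rw [one_mul, add_zero] at hs
  have := stepOp_ofReal_le (p := p) (F := distSq b) (x := x) (fun z => h0 _)
    (fun z => distSq_add_le hb x z) (b := distSq b x + 2) (by
      have e : (fun z : ℤ × ℤ => pr p z * (distSq b x
          + (2 * (max (enorm2 x - b) 0 / enorm2 x * x.1) * z.1
          + 2 * (max (enorm2 x - b) 0 / enorm2 x * x.2) * z.2) + enorm2 z ^ 2))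
          = fun z : ℤ × ℤ => pr p z * distSq b x
          + pr p z * (2 * (max (enorm2 x - b) 0 / enorm2 x * x.1) * z.1
          + 2 * (max (enorm2 x - b) 0 / enorm2 x * x.2) * z.2) + pr p z * enorm2 z ^ 2 := by
        funext z; ring
      rw [e]; exact hs)
  rwa [ENNReal.ofReal_add (h0 x) zero_le_two, ENNReal.ofReal_ofNat] at this

theorem distSq_le_farSq {b : ℝ} (hb : 0 ≤ b) (y : ℤ × ℤ) :
    ENNReal.ofReal (distSq b y) ≤ farSq b y := by
  rw [farSq, distSq]
  split_ifs with hy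
  · refine ENNReal.ofReal_le_ofReal (pow_le_pow_left₀ (le_max_right _ _) ?_ 2)
    exact max_le (by linarith) (enorm2_nonneg y)
  · push Not at hy
    rw [max_eq_right (by linarith)]; simp

end LatticeWalk

namespace LatticeWalk

/-! ### Estimates at the scales of the annuli -/

variable {p : PMF (ℤ × ℤ)}

/-- `C` is a constant in the difference estimates for the potential kernel. -/
structure IsGapConst (p : PMF (ℤ × ℤ)) (C : ℝ) : Prop where
  pos : 0 < C
  near : ∀ u v, greenGap p u v ≤ ENNReal.ofReal (C * enorm2 (u - v))
  far : ∀ (R : ℝ) (x v w : ℤ × ℤ), 0 < R → R ≤ enorm2 x → enorm2 v ≤ R / 4 → enorm2 w ≤ R / 4 →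
    greenGap p (x - w) (x - v) ≤ ENNReal.ofReal (C * enorm2 (w - v) / R)

theorem IsRegular.exists_isGapConst (h : IsRegular p) : ∃ C, IsGapConst p C := by
  obtain ⟨C₁, h₁, H₁⟩ := exists_greenGap_le h
  obtain ⟨C₂, h₂, H₂⟩ := exists_greenGap_far_le h
  refine ⟨max C₁ C₂, lt_max_of_lt_left h₁, fun u v => (H₁ u v).trans ?_,
    fun R x v w hR hx hv hw => (H₂ R x v w hR hx hv hw).trans ?_⟩
  · have := enorm2_nonneg (u - v)
    exact ENNReal.ofReal_le_ofReal (by gcongr; exact le_max_left _ _)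
  · have := enorm2_nonneg (w - v)
    exact ENNReal.ofReal_le_ofReal (by gcongr; exact le_max_right _ _)

/-- The relations between the radii: `r` is huge compared with `N`, `R = N³ r`, and `a` is slightly
larger than `r`. -/
structure Scales (p : PMF (ℤ × ℤ)) (C N r a R : ℝ) : Prop where
  large : 10 ^ 6 ≤ N
  mom_le : mom3 p ≤ N
  gap_le : C ≤ N
  pow_le : N ^ 40 ≤ r
  R_eq : R = N ^ 3 * r
  le_a : r ≤ a
  a_le : a ≤ r + N ^ 4

section Scales

variable {C N r a R : ℝ}

theorem Scales.N_pos (s : Scales p C N r a R) : 0 < N := by have := s.large; linarith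

theorem Scales.one_le_N (s : Scales p C N r a R) : 1 ≤ N := by have := s.large; linarith

theorem Scales.one_le_r (s : Scales p C N r a R) : 1 ≤ r :=
  (one_le_pow₀ s.one_le_N).trans s.pow_le

theorem Scales.r_pos (s : Scales p C N r a R) : 0 < r := by have := s.one_le_r; linarith

theorem Scales.mul_pow_le (s : Scales p C N r a R) {k : ℕ} (hk : k ≤ 39) :
    10 ^ 6 * N ^ k ≤ r :=
  calc 10 ^ 6 * N ^ k ≤ N * N ^ k := by
        have := s.N_pos
        gcongr; exact s.large
    _ = N ^ (k + 1) := by ring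
    _ ≤ N ^ 40 := pow_le_pow_right₀ s.one_le_N (by lia)
    _ ≤ r := s.pow_le

theorem Scales.a_le_mul (s : Scales p C N r a R) : a ≤ 3 / 2 * r := by
  have := s.mul_pow_le (k := 4) (by norm_num)
  have := s.a_le
  have := pow_pos s.N_pos 4
  linarith

theorem Scales.a_pos (s : Scales p C N r a R) : 0 < a := s.r_pos.trans_le s.le_a

theorem Scales.mul_r_le (s : Scales p C N r a R) : 10 ^ 6 * r ≤ R := by
  rw [s.R_eq]
  have := s.r_pos
  have h1 := s.large
  have h2 := s.one_le_N
  gcongr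
  calc (10 : ℝ) ^ 6 ≤ N := h1
    _ = N ^ 1 := (pow_one N).symm
    _ ≤ N ^ 3 := pow_le_pow_right₀ h2 (by norm_num)

theorem Scales.R_pos (s : Scales p C N r a R) : 0 < R := by
  have := s.mul_r_le; have := s.r_pos; linarith

theorem Scales.one_le_log (s : Scales p C N r a R) : 1 ≤ Real.log N := by
  rw [Real.le_log_iff_exp_le s.N_pos]
  have := s.large
  have := Real.exp_one_lt_d9
  linarith

theorem Scales.log_le (s : Scales p C N r a R) : Real.log N ≤ N := by
  have := Real.log_le_sub_one_of_pos s.N_pos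
  linarith

theorem Scales.mom_le_r (s : Scales p C N r a R) : 10 ^ 6 * mom3 p ≤ r := by
  have := s.mul_pow_le (k := 1) (by norm_num)
  have := s.mom_le
  linarith

theorem Scales.green_one_le (s : Scales p C N r a R) (h : IsRegular p) {b : ℝ} (hb : r ≤ b)
    (a' : ℝ) (x : ℤ × ℤ) : green p (annc a' b) 1 x ≤ ENNReal.ofReal (64 * b ^ 2) := by
  have := s.one_le_r
  have := s.mom_le_r
  have := mom3_nonneg (p := p)
  exact h.green_one_le (by linarith) (by linarith) (fun y hy => (notMem_annc.1 hy).2.le) x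

/-- Beyond `L` the logarithm is dominated by a multiple of the squared norm, so the overshoot
estimate for `farSq` applies to it. -/
theorem tlog_le_farSq {ρ L : ℝ} (hρ : 0 < ρ) (hL : ρ ≤ L) {y : ℤ × ℤ} (hy : L ≤ enorm2 y) :
    ENNReal.ofReal (tlog ρ y) ≤ ENNReal.ofReal (1 / (L * ρ)) * farSq L y := by
  have hL0 : 0 < L := hρ.trans_le hL
  have hy0 : 0 < enorm2 y := hL0.trans_le hy
  rw [farSq, if_pos hy, ← ENNReal.ofReal_mul (by positivity), tlog_of_le (hL.trans hy)]
  refine ENNReal.ofReal_le_ofReal ?_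
  have h1 := Real.log_le_sub_one_of_pos (div_pos hy0 hρ)
  have h2 : enorm2 y / ρ ≤ 1 / (L * ρ) * enorm2 y ^ 2 := by
    rw [div_mul_eq_mul_div, one_mul, div_le_div_iff₀ hρ (by positivity)]
    calc enorm2 y * (L * ρ) = L * (enorm2 y * ρ) := by ring
      _ ≤ enorm2 y * (enorm2 y * ρ) := by gcongr
      _ = _ := by ring
  linarith

/-- From `3r ≤ |w|` the walk reaches the distance `4R` before it returns to the inner disc with
probability at least of order `1 / log N`. -/
theorem Scales.le_escape (s : Scales p C N r a R) (h : IsRegular p) {w : ℤ × ℤ}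
    (hw : 3 * r ≤ enorm2 w) (hw' : enorm2 w < 4 * R) :
    ENNReal.ofReal (1 / (8 * Real.log N)) ≤ escape p a (4 * R) w := by
  have hr := s.r_pos
  have hR := s.R_pos
  have hN := s.N_pos
  have hm := mom3_nonneg (p := p)
  have hrR := s.mul_r_le
  have haw : a ≤ enorm2 w := by have := s.a_le_mul; linarith
  -- Chosen so that `ρ ≤ (1 - 1/4)|y|` for all `|y| ≥ r`, as almost harmonicity with `κ = 1/4`
  -- requires.
  set ρ : ℝ := 3 / 4 * r with hρ
  have hρ0 : 0 < ρ := by positivity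
  set ε : ℝ := 3 * mom3 p / ((1 / 4) ^ 2 * ρ ^ 3) with hε
  have hε0 : 0 ≤ ε := by positivity
  set S := annc a (4 * R)
  have hS : ∀ y ∉ S, a ≤ enorm2 y ∧ enorm2 y < 4 * R := fun y hy => notMem_annc.1 hy
  have hwS : w ∉ S := notMem_annc.2 ⟨haw, hw'⟩
  have hE : green p S 1 w ≤ ENNReal.ofReal (64 * (4 * R) ^ 2) :=
    s.green_one_le h (by linarith) a w
  have hfin : green p S 1 w ≠ ⊤ := ne_top_of_le_ne_top ENNReal.ofReal_ne_top hE
  have h1 := le_hit_add_green (p := p) (S := S) (F := fun y => ENNReal.ofReal (tlog ρ y))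
    (e := 0) (d := fun _ => ENNReal.ofReal ε * 1) (B := ENNReal.ofReal (Real.log (4 * R / ρ)))
    ENNReal.ofReal_ne_top
    (fun y hy => ENNReal.ofReal_le_ofReal
      (tlog_le_log hρ0 (by rw [hρ]; linarith) (hS y hy).2.le))
    (fun y hy => by
      have hya := (hS y hy).1
      have := (h.tlog_almost_harmonic (κ := 1 / 4) hρ0 (by norm_num) (by norm_num)
        (x := y) (by have := s.le_a; rw [hρ]; linarith) le_rfl).2
      simpa only [Pi.zero_apply, add_zero, mul_one] using this) hfin
  rw [green_const_mul] at h1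
  replace h1 := le_self_add.trans h1
  set P := escape p a (4 * R) w with hP
  have h2 : hit p S (fun y => ENNReal.ofReal (tlog ρ y)) w
      ≤ ENNReal.ofReal (Real.log 2) * 1 + ENNReal.ofReal (Real.log (16 * R / ρ)) * P
        + ENNReal.ofReal (1 / (16 * R * ρ)) * (ENNReal.ofReal (mom3 p / ((3 / 4) ^ 3 * (16 * R)))
          * ENNReal.ofReal (64 * (4 * R) ^ 2)) := by
    have h3 : hit p S (fun y => ENNReal.ofReal (tlog ρ y)) w
        ≤ hit p S ((fun y => ENNReal.ofReal (Real.log 2) * (1 : ℤ × ℤ → ℝ≥0∞) y)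
          + (fun y => ENNReal.ofReal (Real.log (16 * R / ρ)) * (outer (4 * R)).indicator 1 y)
          + fun y => ENNReal.ofReal (1 / (16 * R * ρ)) * farSq (16 * R) y) w := by
      refine hit_mono (fun y hy => ?_) w
      simp only [Pi.add_apply]
      rcases hy with hy | hy
      · refine le_add_right (le_add_right ?_)
        rw [Pi.one_apply, mul_one]
        refine ENNReal.ofReal_le_ofReal ?_
        have e : Real.log 2 = Real.log (3 / 2 * r / ρ) := by
          congr 1; rw [hρ]; field_simp; norm_num
        rw [e]
        exact tlog_le_log hρ0 (by rw [hρ]; linarith) (hy.le.trans s.a_le_mul)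
      · by_cases h4 : 16 * R ≤ enorm2 y
        · exact le_add_left (tlog_le_farSq hρ0 (by rw [hρ]; linarith) h4)
        · refine le_add_right (le_add_left ?_)
          rw [indicator_of_mem (show y ∈ outer (4 * R) from hy), Pi.one_apply, mul_one]
          push Not at h4
          exact ENNReal.ofReal_le_ofReal (tlog_le_log hρ0 (by rw [hρ]; linarith) h4.le)
    refine h3.trans ?_
    rw [hit_add, hit_add, Pi.add_apply, Pi.add_apply, hit_const_mul, hit_const_mul, hit_const_mul]
    gcongr
    · exact hit_one_le w
    · exact le_rfl
    · refine (h.hit_farSq_le (κ := 3 / 4) (by norm_num) (by positivity : 0 < 16 * R)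
        (by linarith) (fun y hy => (hS y hy).2.le) hwS).trans ?_
      gcongr
  have h3 : ENNReal.ofReal (tlog ρ w) ≤ _ :=
    h1.trans (add_le_add h2 (mul_le_mul_right hE (ENNReal.ofReal ε)))
  have hPtop : P ≠ ⊤ := ne_top_of_le_ne_top ENNReal.one_ne_top (escape_le_one _ _ _)
  have hl2 : 0 ≤ Real.log 2 := Real.log_nonneg (by norm_num)
  have hl16 : 0 ≤ Real.log (16 * R / ρ) :=
    Real.log_nonneg (by rw [le_div_iff₀ hρ0, hρ]; linarith)
  rw [← ENNReal.ofReal_toReal hPtop] at h3 ⊢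
  have hP0 : 0 ≤ P.toReal := ENNReal.toReal_nonneg
  rw [mul_one, ← ENNReal.ofReal_mul hl16, ← ENNReal.ofReal_mul (by positivity),
    ← ENNReal.ofReal_mul (by positivity), ← ENNReal.ofReal_mul hε0,
    ← ENNReal.ofReal_add hl2 (by positivity), ← ENNReal.ofReal_add (by positivity) (by positivity),
    ← ENNReal.ofReal_add (by positivity) (by positivity),
    ENNReal.ofReal_le_ofReal_iff (by positivity)] at h3
  refine ENNReal.ofReal_le_ofReal ?_
  -- The starting value is at least `log 4`, while on the inner disc `tlog` is at most `log 2`. The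
  -- surplus `log 2`, less two errors of `1/16`, must come from the escapes, where the main value is
  -- at most `4 log N`.
  have hl4 : 2 * Real.log 2 ≤ tlog ρ w := by
    rw [tlog_of_le (by rw [hρ]; linarith), ← Real.log_rpow (by norm_num)]
    refine Real.log_le_log (by norm_num) ?_
    rw [le_div_iff₀ hρ0, hρ]
    norm_num
    linarith
  have e1 : 1 / (16 * R * ρ) * (mom3 p / ((3 / 4) ^ 3 * (16 * R)) * (64 * (4 * R) ^ 2)) ≤ 1 / 16 := by
    have e : 1 / (16 * R * ρ) * (mom3 p / ((3 / 4) ^ 3 * (16 * R)) * (64 * (4 * R) ^ 2))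
        = mom3 p * (4096 / 324) / r := by rw [hρ]; field_simp; ring
    rw [e, div_le_iff₀ hr]
    have := s.mom_le_r
    linarith
  have e2 : ε * (64 * (4 * R) ^ 2) ≤ 1 / 16 := by
    have e : ε * (64 * (4 * R) ^ 2) = (3145728 / 27) * (mom3 p * N ^ 6) / r := by
      rw [hε, hρ, s.R_eq]; field_simp; ring
    rw [e, div_le_iff₀ hr]
    have h5 : mom3 p * N ^ 6 ≤ N ^ 7 := by
      calc mom3 p * N ^ 6 ≤ N * N ^ 6 := by gcongr; exact s.mom_le
        _ = N ^ 7 := by ring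
    have h6 : 10 ^ 6 * N ^ 8 ≤ r := s.mul_pow_le (by norm_num)
    have h7 : 10 ^ 6 * N ^ 7 ≤ N ^ 8 := by
      calc 10 ^ 6 * N ^ 7 ≤ N * N ^ 7 := by gcongr; exact s.large
        _ = N ^ 8 := by ring
    linarith
  have e3 : Real.log (16 * R / ρ) ≤ 4 * Real.log N := by
    rw [show (4 : ℝ) * Real.log N = Real.log (N ^ 4) by rw [Real.log_pow]; norm_num]
    refine Real.log_le_log (by positivity) ?_
    have e : 16 * R / ρ = 64 / 3 * N ^ 3 := by rw [hρ, s.R_eq]; field_simp; norm_num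
    rw [e, show N ^ 4 = N * N ^ 3 by ring]
    have := s.large
    gcongr
    linarith
  have hlog := s.one_le_log
  have e4 : Real.log (16 * R / ρ) * P.toReal ≤ 4 * Real.log N * P.toReal := by gcongr
  have := Real.log_two_gt_d9
  rw [div_le_iff₀ (by positivity)]
  nlinarith

/-- The expected time spent in `{R ≤ |y| < 4R}` before the return to the inner disc. -/
theorem Scales.le_green_annulus (s : Scales p C N r a R) (h : IsRegular p) {w : ℤ × ℤ}
    (hw : 3 * r ≤ enorm2 w) (hw' : enorm2 w ≤ 12 * r) :
    ENNReal.ofReal (R ^ 2 / (8 * Real.log N))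
      ≤ green p (annc a (4 * R)) ({y | R ≤ enorm2 y ∧ enorm2 y < 4 * R}.indicator 1) w := by
  have hr := s.r_pos
  have hR := s.R_pos
  have hN := s.N_pos
  have hm := mom3_nonneg (p := p)
  have hrR := s.mul_r_le
  set S := annc a (4 * R)
  set Q : Set (ℤ × ℤ) := {y | R ≤ enorm2 y ∧ enorm2 y < 4 * R} with hQ
  have hS : ∀ y ∉ S, a ≤ enorm2 y ∧ enorm2 y < 4 * R := fun y hy => notMem_annc.1 hy
  have hE : green p S 1 w ≤ ENNReal.ofReal (64 * (4 * R) ^ 2) :=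
    s.green_one_le h (by linarith) a w
  have hP := s.le_escape h hw (by linarith)
  -- The function vanishes at `w` and is at least `(2R)²` on escape. Its drift is at most `2` in the
  -- annulus; closer to the centre only jumps past `2R` contribute. Hence `4R²` times the escape
  -- probability is at most twice the time in the annulus plus a small error.
  have h1 := hit_add_green_le (p := p) (S := S) (F := fun y => ENNReal.ofReal (distSq (2 * R) y))
    (e := 0) (d := (fun y => 2 * Q.indicator 1 y)
      + fun y => ENNReal.ofReal (mom3 p / ((1 / 2) ^ 3 * (2 * R))) * (1 : ℤ × ℤ → ℝ≥0∞) y)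
    (fun y hy => by
      simp only [Pi.zero_apply, add_zero, Pi.add_apply]
      by_cases hyR : R ≤ enorm2 y
      · rw [indicator_of_mem (show y ∈ Q from ⟨hyR, (hS y hy).2⟩), Pi.one_apply, mul_one]
        exact (h.stepOp_distSq_le (by positivity) y).trans
          (add_le_add_right le_self_add _)
      · refine le_add_left (le_add_left ?_)
        push Not at hyR
        rw [Pi.one_apply, mul_one]
        exact (stepOp_mono (fun z => distSq_le_farSq (by positivity) z) y).trans
          (h.stepOp_farSq_le (κ := 1 / 2) (by norm_num) (by positivity) (by linarith) hyR.le)) w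
  rw [green_add, Pi.add_apply, green_const_mul, green_const_mul] at h1
  replace h1 := le_self_add.trans h1
  have h2 : ENNReal.ofReal (4 * R ^ 2) * escape p a (4 * R) w
      ≤ hit p S (fun y => ENNReal.ofReal (distSq (2 * R) y)) w := by
    rw [escape, ← hit_const_mul]
    refine hit_mono (fun y _ => ?_) w
    by_cases hy : y ∈ outer (4 * R)
    · rw [indicator_of_mem hy, Pi.one_apply, mul_one]
      refine ENNReal.ofReal_le_ofReal ?_
      have hy' : 4 * R ≤ enorm2 y := hy
      have h3 : 2 * R ≤ max (enorm2 y - 2 * R) 0 := le_max_of_le_left (by linarith)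
      calc 4 * R ^ 2 = (2 * R) ^ 2 := by ring
        _ ≤ _ := pow_le_pow_left₀ (by positivity) h3 2
    · rw [indicator_of_notMem hy]; simp
  have h3 : distSq (2 * R) w = 0 := by
    rw [distSq, max_eq_right (by linarith)]; norm_num
  rw [h3, ENNReal.ofReal_zero, zero_add] at h1
  have h4 : ENNReal.ofReal (4 * R ^ 2) * ENNReal.ofReal (1 / (8 * Real.log N))
      ≤ 2 * green p S (Q.indicator 1) w
        + ENNReal.ofReal (mom3 p / ((1 / 2) ^ 3 * (2 * R))) * ENNReal.ofReal (64 * (4 * R) ^ 2) :=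
    (mul_le_mul_right hP _).trans (h2.trans (h1.trans (by gcongr)))
  have hgtop : green p S (Q.indicator 1) w ≠ ⊤ := ne_top_of_le_ne_top ENNReal.ofReal_ne_top
    ((green_mono (fun y _ => indicator_le_self _ _ y) w).trans hE)
  rw [← ENNReal.ofReal_toReal hgtop] at h4 ⊢
  set g := (green p S (Q.indicator 1) w).toReal
  have hg0 : 0 ≤ g := ENNReal.toReal_nonneg
  have hlog := s.one_le_log
  rw [← ENNReal.ofReal_mul (by positivity), ← ENNReal.ofReal_mul (by positivity),
    show (2 : ℝ≥0∞) = ENNReal.ofReal 2 by simp, ← ENNReal.ofReal_mul (by positivity),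
    ← ENNReal.ofReal_add (by positivity) (by positivity),
    ENNReal.ofReal_le_ofReal_iff (by positivity)] at h4
  refine ENNReal.ofReal_le_ofReal ?_
  have e1 : mom3 p / ((1 / 2) ^ 3 * (2 * R)) * (64 * (4 * R) ^ 2) = 4096 * (mom3 p * R) := by
    field_simp; ring
  have e2 : 4 * R ^ 2 * (1 / (8 * Real.log N)) = 4 * (R ^ 2 / (8 * Real.log N)) := by ring
  rw [e1, e2] at h4
  have e3 : 4096 * (mom3 p * R) ≤ 2 * (R ^ 2 / (8 * Real.log N)) := by
    rw [← mul_div_assoc, le_div_iff₀ (by positivity)]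
    have h5 : 10 ^ 6 * N ^ 2 ≤ r := s.mul_pow_le (by norm_num)
    have h6 : mom3 p * Real.log N ≤ N ^ 2 := by
      rw [sq]
      exact mul_le_mul s.mom_le s.log_le (by positivity) hN.le
    have h7 : 16384 * (mom3 p * Real.log N) ≤ R := by linarith
    calc 4096 * (mom3 p * R) * (8 * Real.log N) = 2 * R * (16384 * (mom3 p * Real.log N)) := by ring
      _ ≤ 2 * R * R := by gcongr
      _ = _ := by ring
  linarith

/-! ### Additive bounds for the Green function of the complement of the inner disc -/

theorem gap_hit_le (hC : IsGapConst p C) (hR : 0 < R) {x x' w : ℤ × ℤ} (haw : a ≤ enorm2 w)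
    (hx : R ≤ enorm2 x) (hx' : R ≤ enorm2 x') (hw : enorm2 w ≤ R / 4) :
    hit p (disc 0 a) (fun v => greenGap p (x - w) (x - v) + greenGap p (x' - w) (x' - v)) w
      ≤ ENNReal.ofReal (4 * C * enorm2 w / R) := by
  have hw0 := enorm2_nonneg w
  have hC0 := hC.pos
  refine (hit_le_of_le (fun v hv => ?_) w).trans (mul_le_of_le_one_right' (hit_one_le w))
  have hv' : enorm2 v < a := by simpa [disc] using hv
  have hwv : enorm2 (w - v) ≤ 2 * enorm2 w := by have := enorm2_sub_le w v; linarith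
  have e : ENNReal.ofReal (4 * C * enorm2 w / R) = ENNReal.ofReal (C * (2 * enorm2 w) / R)
      + ENNReal.ofReal (C * (2 * enorm2 w) / R) := by
    rw [← ENNReal.ofReal_add (by positivity) (by positivity)]; congr 1; ring
  rw [e]
  refine add_le_add ((hC.far R x v w hR hx (by linarith) hw).trans ?_)
    ((hC.far R x' v w hR hx' (by linarith) hw).trans ?_) <;>
  · exact ENNReal.ofReal_le_ofReal (by gcongr)

theorem gap_hit_le' (hC : IsGapConst p C) {x x' w : ℤ × ℤ} (haw : a ≤ enorm2 w) :
    hit p (disc 0 a) (fun v => greenGap p (x - w) (x - v) + greenGap p (x' - w) (x' - v)) w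
      ≤ ENNReal.ofReal (4 * C * enorm2 w) := by
  have hw0 := enorm2_nonneg w
  have hC0 := hC.pos
  refine (hit_le_of_le (fun v hv => ?_) w).trans (mul_le_of_le_one_right' (hit_one_le w))
  have hv' : enorm2 v < a := by simpa [disc] using hv
  have hwv : enorm2 (v - w) ≤ 2 * enorm2 w := by have := enorm2_sub_le v w; linarith
  have e : ENNReal.ofReal (4 * C * enorm2 w) = ENNReal.ofReal (C * (2 * enorm2 w))
      + ENNReal.ofReal (C * (2 * enorm2 w)) := by
    rw [← ENNReal.ofReal_add (by positivity) (by positivity)]; congr 1; ring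
  rw [e]
  refine add_le_add ((hC.near _ _).trans ?_) ((hC.near _ _).trans ?_) <;>
  · rw [sub_sub_sub_cancel_left]
    exact ENNReal.ofReal_le_ofReal (by gcongr)

theorem zero_mem_disc (ha : 0 < a) : (0 : ℤ × ℤ) ∈ disc 0 a := by
  simpa [disc, enorm2_zero] using ha

theorem green_pt_le_near (h : IsRegular p) (hC : IsGapConst p C) (ha : 0 < a) {w : ℤ × ℤ}
    (haw : a ≤ enorm2 w) (x x' : ℤ × ℤ) :
    green p (disc 0 a) (pt x) w
      ≤ green p (disc 0 a) (pt x') w + ENNReal.ofReal (4 * C * enorm2 w) :=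
  (green_pt_le h (hit_one_of_zero_mem h (zero_mem_disc ha) w) x x').trans
    (add_le_add_right (gap_hit_le' hC haw) _)

theorem green_pt_le_far (h : IsRegular p) (hC : IsGapConst p C) (ha : 0 < a) (hR : 0 < R)
    {x x' w : ℤ × ℤ} (haw : a ≤ enorm2 w) (hx : R ≤ enorm2 x) (hx' : R ≤ enorm2 x')
    (hw : enorm2 w ≤ R / 4) :
    green p (disc 0 a) (pt x) w
      ≤ green p (disc 0 a) (pt x') w + ENNReal.ofReal (4 * C * enorm2 w / R) :=
  (green_pt_le h (hit_one_of_zero_mem h (zero_mem_disc ha) w) x x').trans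
    (add_le_add_right (gap_hit_le hC hR haw hx hx' hw) _)

/-- The reference target is the origin, which lies in the killing set, so its Green function
vanishes. -/
theorem green_disc_le (h : IsRegular p) (hC : IsGapConst p C) (ha : 0 < a) {w : ℤ × ℤ}
    (haw : a ≤ enorm2 w) (x : ℤ × ℤ) :
    green p (disc 0 a) (pt x) w ≤ ENNReal.ofReal (4 * C * enorm2 w) := by
  have := green_pt_le_near h hC ha haw x 0
  rwa [green_pt_symm h.symm w 0, green_of_mem (zero_mem_disc ha), zero_add] at this

theorem tsum_indicator_le (hR : 1 ≤ R) {f : ℤ × ℤ → ℝ≥0∞} {c : ℝ≥0∞} {Q : Set (ℤ × ℤ)}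
    (hQ : ∀ y ∈ Q, enorm2 y ≤ 4 * R) (hf : ∀ y ∈ Q, f y ≤ c) :
    ∑' y, Q.indicator 1 y * f y ≤ ENNReal.ofReal (81 * R ^ 2) * c := by
  set m := ⌊4 * R⌋ with hm
  set B := Finset.Icc (-m) m ×ˢ Finset.Icc (-m) m with hB
  have hm0 : 0 ≤ m := Int.floor_nonneg.2 (by linarith)
  have hsub : ∀ y ∉ B, Q.indicator 1 y * f y = 0 := fun y hy => by
    rw [indicator_of_notMem, zero_mul]
    intro hyQ
    apply hy
    have h1 := (abs_fst_le y).trans (hQ y hyQ)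
    have h2 := (abs_snd_le y).trans (hQ y hyQ)
    rw [hB, Finset.mem_product, Finset.mem_Icc, Finset.mem_Icc, ← abs_le, ← abs_le]
    exact ⟨Int.le_floor.2 (by exact_mod_cast h1), Int.le_floor.2 (by exact_mod_cast h2)⟩
  rw [tsum_eq_sum (s := B) fun y hy => hsub y hy]
  have h1 : ∑ y ∈ B, Q.indicator 1 y * f y ≤ B.card • c := by
    refine Finset.sum_le_card_nsmul _ _ _ fun y _ => ?_
    by_cases hy : y ∈ Q
    · rw [indicator_of_mem hy, Pi.one_apply, one_mul]; exact hf y hy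
    · rw [indicator_of_notMem hy, zero_mul]; exact zero_le
  refine h1.trans ?_
  rw [nsmul_eq_mul]
  gcongr
  have hcard : (B.card : ℝ) = (2 * m + 1) ^ 2 := by
    have : (B.card : ℤ) = (2 * m + 1) ^ 2 := by
      rw [hB, Finset.card_product, Int.card_Icc]
      push_cast
      rw [Int.toNat_of_nonneg (by lia)]
      ring
    exact_mod_cast this
  rw [← ENNReal.ofReal_natCast, hcard]
  refine ENNReal.ofReal_le_ofReal ?_
  have h2 : (m : ℝ) ≤ 4 * R := Int.floor_le _
  have h3 : (0 : ℝ) ≤ m := by exact_mod_cast hm0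
  nlinarith

/-- Lower bound for the Green function of the complement of the inner disc. -/
theorem Scales.le_green (s : Scales p C N r a R) (h : IsRegular p) (hC : IsGapConst p C)
    {w x : ℤ × ℤ} (hw : 3 * r ≤ enorm2 w) (hw' : enorm2 w ≤ 12 * r) (hx : R ≤ enorm2 x) :
    ENNReal.ofReal (1 / (1296 * Real.log N)) ≤ green p (disc 0 a) (pt x) w := by
  have hr := s.r_pos
  have hR := s.R_pos
  have hN := s.N_pos
  have hrR := s.mul_r_le
  have hC0 := hC.pos
  have haw : a ≤ enorm2 w := by have := s.a_le_mul; linarith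
  have hlog := s.one_le_log
  set Q : Set (ℤ × ℤ) := {y | R ≤ enorm2 y ∧ enorm2 y < 4 * R} with hQ
  set G := green p (disc 0 a) (pt x) w with hG
  have hGtop : G ≠ ⊤ :=
    ne_top_of_le_ne_top ENNReal.ofReal_ne_top (green_disc_le h hC s.a_pos haw x)
  have h1 : green p (annc a (4 * R)) (Q.indicator 1) w ≤ green p (disc 0 a) (Q.indicator 1) w := by
    have hsub : disc 0 a ⊆ annc a (4 * R) := fun y hy => Or.inl (by simpa [disc] using hy)
    rw [green_eq_green_add_hit hsub]
    exact le_self_add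
  -- On the annulus the Green function exceeds its value at `x` by at most `48C/N³`, so the
  -- occupation time is at most the number of points times `G + 48C/N³`.
  have h2 : green p (disc 0 a) (Q.indicator 1) w
      ≤ ENNReal.ofReal (81 * R ^ 2) * (G + ENNReal.ofReal (48 * C / N ^ 3)) := by
    rw [green_eq_tsum]
    refine tsum_indicator_le (by have := s.one_le_r; linarith) (fun y hy => hy.2.le) fun y hy => ?_
    refine (green_pt_le_far h hC s.a_pos hR haw hy.1 hx (by linarith)).trans ?_
    refine add_le_add_right (ENNReal.ofReal_le_ofReal ?_) _
    rw [div_le_div_iff₀ hR (by positivity)]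
    calc 4 * C * enorm2 w * N ^ 3 ≤ 4 * C * (12 * r) * N ^ 3 := by gcongr
      _ = 48 * C * R := by rw [s.R_eq]; ring
  have h3 := (s.le_green_annulus h hw hw').trans (h1.trans h2)
  rw [← ENNReal.ofReal_toReal hGtop] at h3 ⊢
  have hG0 : 0 ≤ G.toReal := ENNReal.toReal_nonneg
  rw [← ENNReal.ofReal_add hG0 (by positivity), ← ENNReal.ofReal_mul (by positivity),
    ENNReal.ofReal_le_ofReal_iff (by positivity)] at h3
  refine ENNReal.ofReal_le_ofReal ?_
  -- The error is at most half of the averaged lower bound, as `C log N ≤ N²` is far below `N³`.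
  have e1 : 48 * C / N ^ 3 ≤ 1 / (1296 * Real.log N) := by
    rw [div_le_div_iff₀ (by positivity) (by positivity)]
    have h6 : C * Real.log N ≤ N ^ 2 := by
      rw [sq]
      exact mul_le_mul s.gap_le s.log_le (by positivity) hN.le
    have h7 : 10 ^ 6 * N ^ 2 ≤ N ^ 3 := by
      rw [show N ^ 3 = N * N ^ 2 by ring]
      gcongr; exact s.large
    nlinarith
  have e2 : R ^ 2 / (8 * Real.log N) = 81 * R ^ 2 * (2 * (1 / (1296 * Real.log N))) := by
    field_simp; norm_num
  rw [e2] at h3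
  have := le_of_mul_le_mul_left h3 (by positivity)
  linarith

end Scales

end LatticeWalk

/-! ### Comparison of Green functions inside the disc of radius 3r -/

namespace LatticeWalk

variable {p : PMF (ℤ × ℤ)} {C N r a R : ℝ}

theorem ofReal_mul_ofReal_mul {u v : ℝ} (hu : 0 ≤ u) (P : ℝ≥0∞) :
    ENNReal.ofReal u * (ENNReal.ofReal v * P) = ENNReal.ofReal (u * v) * P := by
  rw [ENNReal.ofReal_mul hu, mul_assoc]

theorem disc_subset_annc (a b : ℝ) : disc 0 a ⊆ annc a b :=
  fun y hy => Or.inl (by simpa [disc] using hy)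

/-- The target lies outside the annulus, so the walk makes no visit to it before leaving the
annulus; only the continuation after the exit remains. -/
theorem green_eq_hit_annc {b : ℝ} {x : ℤ × ℤ} (hx : b ≤ enorm2 x) (z : ℤ × ℤ) (hp : IsSymmetric p) :
    green p (disc 0 a) (pt x) z = hit p (annc a b) (green p (disc 0 a) (pt x)) z := by
  have hxS : x ∈ annc a b := Or.inr hx
  conv_lhs => rw [green_eq_green_add_hit (disc_subset_annc a b), green_pt_symm hp,
    green_of_mem hxS, zero_add]

/-- The mean exit time is itself at most `16 (3r)²` times the escape probability. Overshoot errors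
therefore carry the same factor as the main terms. -/
theorem Scales.hit_farSq_le_escape (s : Scales p C N r a R) (h : IsRegular p) {z : ℤ × ℤ}
    (hz : z ∉ annc a (3 * r)) {κ L : ℝ} (hκ : 0 < κ) (hL : 0 < L) (hκL : 3 * r ≤ (1 - κ) * L) :
    hit p (annc a (3 * r)) (farSq L) z
      ≤ ENNReal.ofReal (mom3 p / (κ ^ 3 * L) * (144 * r ^ 2)) * escape p a (3 * r) z := by
  have hm := mom3_nonneg (p := p)
  have h1 := s.one_le_r
  have h2 := s.mom_le_r
  refine (h.hit_farSq_le hκ hL hκL (fun y hy => (notMem_annc.1 hy).2.le) hz).trans ?_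
  have h3 := h.green_one_le_escape (b := 3 * r) (by linarith) s.a_pos.le (by linarith) hz
  rw [ENNReal.ofReal_mul (by positivity), mul_assoc,
    show 144 * r ^ 2 = 16 * (3 * r) ^ 2 by ring]
  exact mul_le_mul_right h3 _

/-- Inside the disc of radius `3r`, the Green functions at two distant targets differ by little,
compared to the escape probability. -/
theorem Scales.green_le_add_escape (s : Scales p C N r a R) (h : IsRegular p)
    (hC : IsGapConst p C) {z x x' : ℤ × ℤ} (hz : z ∉ annc a (3 * r)) (hx : R ≤ enorm2 x)
    (hx' : R ≤ enorm2 x') :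
    green p (disc 0 a) (pt x) z ≤ green p (disc 0 a) (pt x') z
      + ENNReal.ofReal (50 * C / N ^ 3) * escape p a (3 * r) z := by
  have hr := s.r_pos
  have hR := s.R_pos
  have hN := s.N_pos
  have hrR := s.mul_r_le
  have hC0 := hC.pos
  have hm := mom3_nonneg (p := p)
  have har := s.a_le_mul
  rw [green_eq_hit_annc (b := 3 * r) (by linarith : 3 * r ≤ enorm2 x) z h.symm,
    green_eq_hit_annc (b := 3 * r) (by linarith : 3 * r ≤ enorm2 x') z h.symm]
  -- Three ranges of the exit point: up to `12r` the far estimate gives `48C/N³`; from `12r` to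
  -- `R/4` the same estimate is majorized by a squared norm; beyond `R/4` only the near estimate is
  -- available, again majorized by a squared norm.
  have h1 : hit p (annc a (3 * r)) (green p (disc 0 a) (pt x)) z
      ≤ hit p (annc a (3 * r)) (green p (disc 0 a) (pt x')
        + (fun v => ENNReal.ofReal (48 * C / N ^ 3) * (outer (3 * r)).indicator 1 v)
        + (fun v => ENNReal.ofReal (C / (3 * r * R)) * farSq (12 * r) v)
        + fun v => ENNReal.ofReal (16 * C / R) * farSq (R / 4) v) z := by
    refine hit_mono (fun v hv => ?_) z
    simp only [Pi.add_apply, add_assoc]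
    rcases hv with hv | hv
    · rw [green_of_mem (by simpa [disc] using hv)]; exact zero_le
    have hav : a ≤ enorm2 v := by linarith
    by_cases h4 : R / 4 ≤ enorm2 v
    · refine (green_pt_le_near h hC s.a_pos hav x x').trans (add_le_add_right ?_ _)
      refine le_add_left (le_add_left ?_)
      rw [farSq, if_pos h4, ← ENNReal.ofReal_mul (by positivity)]
      refine ENNReal.ofReal_le_ofReal ?_
      rw [div_mul_eq_mul_div, le_div_iff₀ hR]
      have := enorm2_nonneg v
      calc 4 * C * enorm2 v * R = 16 * C * enorm2 v * (R / 4) := by ring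
        _ ≤ 16 * C * enorm2 v * enorm2 v := by gcongr
        _ = _ := by ring
    push Not at h4
    refine (green_pt_le_far h hC s.a_pos hR hav hx hx' h4.le).trans (add_le_add_right ?_ _)
    by_cases h5 : 12 * r ≤ enorm2 v
    · refine le_add_left (le_add_right ?_)
      rw [farSq, if_pos h5, ← ENNReal.ofReal_mul (by positivity)]
      refine ENNReal.ofReal_le_ofReal ?_
      rw [div_mul_eq_mul_div, div_le_div_iff₀ hR (by positivity)]
      have := enorm2_nonneg v
      calc 4 * C * enorm2 v * (3 * r * R) = C * enorm2 v * (12 * r) * R := by ring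
        _ ≤ C * enorm2 v * enorm2 v * R := by gcongr
        _ = _ := by ring
    · refine le_add_right ?_
      push Not at h5
      rw [indicator_of_mem (show v ∈ outer (3 * r) from hv), Pi.one_apply, mul_one]
      refine ENNReal.ofReal_le_ofReal ?_
      rw [div_le_div_iff₀ hR (by positivity)]
      calc 4 * C * enorm2 v * N ^ 3 ≤ 4 * C * (12 * r) * N ^ 3 := by gcongr
        _ = 48 * C * R := by rw [s.R_eq]; ring
  refine h1.trans ?_
  rw [hit_add, hit_add, hit_add, Pi.add_apply, Pi.add_apply, Pi.add_apply, hit_const_mul,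
    hit_const_mul, hit_const_mul, add_assoc, add_assoc]
  refine add_le_add_right ?_ _
  have f1 := s.hit_farSq_le_escape h hz (κ := 3 / 4) (L := 12 * r) (by norm_num) (by positivity)
    (by linarith)
  have f2 := s.hit_farSq_le_escape h hz (κ := 1 / 2) (L := R / 4) (by norm_num) (by positivity)
    (by linarith)
  refine (add_le_add_right (add_le_add (mul_le_mul_right f1 _) (mul_le_mul_right f2 _)) _).trans ?_
  rw [ofReal_mul_ofReal_mul (by positivity), ofReal_mul_ofReal_mul (by positivity), ← escape, ← add_mul, ← add_mul,
    ← ENNReal.ofReal_add (by positivity) (by positivity),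
    ← ENNReal.ofReal_add (by positivity) (by positivity)]
  refine mul_le_mul_left (ENNReal.ofReal_le_ofReal ?_) _
  have hmr := s.mom_le_r
  have e1 : C / (3 * r * R) * (mom3 p / ((3 / 4) ^ 3 * (12 * r)) * (144 * r ^ 2)) ≤ C / N ^ 3 := by
    have e : C / (3 * r * R) * (mom3 p / ((3 / 4) ^ 3 * (12 * r)) * (144 * r ^ 2))
        = C / N ^ 3 * (256 / 27 * mom3 p / r) := by rw [s.R_eq]; field_simp; ring
    rw [e]
    refine mul_le_of_le_one_right (by positivity) ?_
    rw [div_le_one hr]; linarith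
  have e2 : 16 * C / R * (mom3 p / ((1 / 2) ^ 3 * (R / 4)) * (144 * r ^ 2)) ≤ C / N ^ 3 := by
    have e : 16 * C / R * (mom3 p / ((1 / 2) ^ 3 * (R / 4)) * (144 * r ^ 2))
        = C / N ^ 3 * (73728 * mom3 p / N ^ 3) := by rw [s.R_eq]; field_simp; ring
    rw [e]
    refine mul_le_of_le_one_right (by positivity) ?_
    rw [div_le_one (by positivity)]
    have := s.mom_le
    have hl := s.large
    calc 73728 * mom3 p ≤ N * N := by gcongr; linarith
      _ = N ^ 2 := by ring
      _ ≤ N ^ 3 := pow_le_pow_right₀ s.one_le_N (by norm_num)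
  have e3 : 48 * C / N ^ 3 + (C / N ^ 3 + C / N ^ 3) = 50 * C / N ^ 3 := by ring
  linarith

/-- At least half of the escape probability lands in `3r ≤ |v| ≤ 12r`, since a longer overshoot is
unlikely given an escape. There the uniform lower bound of `Scales.le_green` holds. -/
theorem Scales.escape_le_green (s : Scales p C N r a R) (h : IsRegular p)
    (hC : IsGapConst p C) {z x : ℤ × ℤ} (hz : z ∉ annc a (3 * r)) (hx : R ≤ enorm2 x) :
    ENNReal.ofReal (1 / (2592 * Real.log N)) * escape p a (3 * r) z
      ≤ green p (disc 0 a) (pt x) z := by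
  have hr := s.r_pos
  have hR := s.R_pos
  have hN := s.N_pos
  have hrR := s.mul_r_le
  have hlog := s.one_le_log
  have hm := mom3_nonneg (p := p)
  set Q : Set (ℤ × ℤ) := {v | 3 * r ≤ enorm2 v ∧ enorm2 v ≤ 12 * r} with hQ
  rw [green_eq_hit_annc (b := 3 * r) (by linarith : 3 * r ≤ enorm2 x) z h.symm]
  have h1 : ENNReal.ofReal (1 / (1296 * Real.log N)) * hit p (annc a (3 * r)) (Q.indicator 1) z
      ≤ hit p (annc a (3 * r)) (green p (disc 0 a) (pt x)) z := by
    rw [← hit_const_mul]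
    refine hit_mono (fun v _ => ?_) z
    by_cases hv : v ∈ Q
    · rw [indicator_of_mem hv, Pi.one_apply, mul_one]
      exact s.le_green h hC hv.1 hv.2 hx
    · rw [indicator_of_notMem hv, mul_zero]; exact zero_le
  have h2 : escape p a (3 * r) z ≤ hit p (annc a (3 * r)) (Q.indicator 1) z
      + ENNReal.ofReal (1 / 2) * escape p a (3 * r) z := by
    have h3 : escape p a (3 * r) z ≤ hit p (annc a (3 * r)) (Q.indicator 1
        + fun v => ENNReal.ofReal (1 / (12 * r) ^ 2) * farSq (12 * r) v) z := by
      refine hit_mono (fun v _ => ?_) z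
      rw [Pi.add_apply]
      by_cases hv : v ∈ outer (3 * r)
      · rw [indicator_of_mem hv]
        by_cases h4 : enorm2 v ≤ 12 * r
        · rw [indicator_of_mem (show v ∈ Q from ⟨hv, h4⟩)]
          exact le_self_add
        · push Not at h4
          refine le_add_left ?_
          rw [farSq, if_pos h4.le, ← ENNReal.ofReal_mul (by positivity), Pi.one_apply,
            ENNReal.one_le_ofReal, one_div_mul_eq_div, one_le_div (by positivity)]
          gcongr
      · rw [indicator_of_notMem hv]; exact zero_le
    refine h3.trans ?_
    rw [hit_add, Pi.add_apply, hit_const_mul]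
    refine add_le_add_right ?_ _
    refine (mul_le_mul_right (s.hit_farSq_le_escape h hz (κ := 3 / 4) (L := 12 * r) (by norm_num)
      (by positivity) (by linarith)) _).trans ?_
    rw [← mul_assoc, ← ENNReal.ofReal_mul (by positivity)]
    refine mul_le_mul_left (ENNReal.ofReal_le_ofReal ?_) _
    have e : 1 / (12 * r) ^ 2 * (mom3 p / ((3 / 4) ^ 3 * (12 * r)) * (144 * r ^ 2))
        = 16 / 81 * mom3 p / r := by field_simp; ring
    rw [e, div_le_iff₀ hr]
    have := s.mom_le_r
    linarith
  refine le_trans ?_ h1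
  have hPtop : escape p a (3 * r) z ≠ ⊤ :=
    ne_top_of_le_ne_top ENNReal.one_ne_top (escape_le_one _ _ _)
  have hQtop : hit p (annc a (3 * r)) (Q.indicator 1) z ≠ ⊤ :=
    ne_top_of_le_ne_top ENNReal.one_ne_top
      ((hit_mono (fun v _ => indicator_le_self _ _ v) z).trans (hit_one_le z))
  rw [← ENNReal.ofReal_toReal hPtop, ← ENNReal.ofReal_toReal hQtop] at h2 ⊢
  set P := (escape p a (3 * r) z).toReal
  set q := (hit p (annc a (3 * r)) (Q.indicator 1) z).toReal
  have hP0 : 0 ≤ P := ENNReal.toReal_nonneg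
  have hq0 : 0 ≤ q := ENNReal.toReal_nonneg
  rw [← ENNReal.ofReal_mul (by norm_num), ← ENNReal.ofReal_add hq0 (by positivity),
    ENNReal.ofReal_le_ofReal_iff (by positivity)] at h2
  rw [← ENNReal.ofReal_mul (by positivity), ← ENNReal.ofReal_mul (by positivity)]
  refine ENNReal.ofReal_le_ofReal ?_
  have e : 1 / (2592 * Real.log N) * P = 1 / (1296 * Real.log N) * (P / 2) := by field_simp; ring
  rw [e]
  gcongr
  linarith

/-- The Green functions at two distant targets are comparable inside the disc of radius `3r`. -/
theorem Scales.green_le_mul (s : Scales p C N r a R) (h : IsRegular p)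
    (hC : IsGapConst p C) {z x x' : ℤ × ℤ} (hz : z ∉ annc a (3 * r)) (hx : R ≤ enorm2 x)
    (hx' : R ≤ enorm2 x') :
    green p (disc 0 a) (pt x) z
      ≤ ENNReal.ofReal (1 + 129600 * C * (Real.log N / N ^ 3)) * green p (disc 0 a) (pt x') z := by
  have hN := s.N_pos
  have hlog := s.one_le_log
  have hC0 := hC.pos
  refine (s.green_le_add_escape h hC hz hx hx').trans ?_
  rw [ENNReal.ofReal_add zero_le_one (by positivity), ENNReal.ofReal_one, add_mul, one_mul]
  refine add_le_add_right ?_ _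
  -- Additive error `50C/N³` against lower bound `1/(2592 log N)`: the common escape probability
  -- cancels and `50 * 2592 = 129600`.
  have e : 50 * C / N ^ 3
      = 129600 * C * (Real.log N / N ^ 3) * (1 / (2592 * Real.log N)) := by field_simp; norm_num
  rw [e, ENNReal.ofReal_mul (by positivity), mul_assoc]
  exact mul_le_mul_right (s.escape_le_green h hC hz hx') _

/-- The walk spends at least one unit of time in the annulus, so the exit time bound forces the
escape probability to be at least `1/(16 (3r)²)`. This crude bound is needed only against long
jumps. -/
theorem Scales.const_le_green (s : Scales p C N r a R) (h : IsRegular p)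
    (hC : IsGapConst p C) {z x : ℤ × ℤ} (hz : z ∉ annc a (3 * r)) (hx : R ≤ enorm2 x) :
    ENNReal.ofReal (1 / (373248 * r ^ 2 * Real.log N)) ≤ green p (disc 0 a) (pt x) z := by
  have hr := s.r_pos
  have hlog := s.one_le_log
  have hm := mom3_nonneg (p := p)
  have h1 := s.one_le_r
  have h2 := s.mom_le_r
  have h3 := (one_le_green_one hz).trans
    (h.green_one_le_escape (b := 3 * r) (by linarith) s.a_pos.le (by linarith) hz)
  refine le_trans ?_ (s.escape_le_green h hC hz hx)
  have e : 1 / (373248 * r ^ 2 * Real.log N)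
      = 1 / (2592 * Real.log N) * (1 / (16 * (3 * r) ^ 2)) := by field_simp; norm_num
  rw [e, ENNReal.ofReal_mul (by positivity)]
  refine mul_le_mul_right ?_ _
  rw [one_div, ENNReal.ofReal_inv_of_pos (by positivity)]
  exact ENNReal.inv_le_iff_le_mul (fun _ => (ENNReal.ofReal_pos.2 (by positivity)).ne')
    (fun he => absurd he ENNReal.ofReal_ne_top) |>.2 h3

end LatticeWalk

namespace LatticeWalk

/-! ### The hitting distribution of the inner disc -/

variable {p : PMF (ℤ × ℤ)} {C N r a R : ℝ}

theorem stepOp_pt (y z : ℤ × ℤ) : stepOp p (pt y) z = p (y - z) := by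
  rw [stepOp, tsum_eq_single (y - z)]
  · rw [add_sub_cancel, pt, Pi.single_eq_same, mul_one]
  · intro u hu
    rw [pt, Pi.single_apply, if_neg, mul_zero]
    rintro rfl
    exact hu (by abel)

theorem mem_disc {y : ℤ × ℤ} : y ∈ disc 0 a ↔ enorm2 y < a := by simp [disc]

/-- Last-exit decomposition followed by reversal of time: hitting from the distant point `x` is
expressed by Green functions started next to the disc. -/
theorem hit_pt_eq_tsum (hp : IsSymmetric p) {x y : ℤ × ℤ} (hx : a ≤ enorm2 x)
    (hy : enorm2 y < a) :
    hit p (disc 0 a) (pt y) x = ∑' z, p (y - z) * green p (disc 0 a) (pt x) z := by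
  have hxA : x ∉ disc 0 a := by rw [mem_disc]; exact hx.not_gt
  have hyA : y ∈ disc 0 a := mem_disc.2 hy
  have e : (disc 0 a).indicator (pt y) = pt y := by
    refine indicator_eq_self.2 fun z hz => ?_
    rw [Function.mem_support, pt, Pi.single_apply] at hz
    have : z = y := by by_contra hne; simp [hne] at hz
    rwa [this]
  rw [hit_eq_green hxA, e, green_eq_tsum]
  exact tsum_congr fun z => by rw [stepOp_pt, green_pt_symm hp]

/-- The contribution of long jumps to the hitting distribution. -/
def longJump (p : PMF (ℤ × ℤ)) (r : ℝ) (y : ℤ × ℤ) : ℝ≥0∞ :=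
  ∑' z, (outer (3 * r)).indicator (fun z => p (y - z) * ENNReal.ofReal (enorm2 z)) z

/-- The ratio estimate holds term by term for `a ≤ |z| < 3r`. For `|z| ≥ 3r` the Green function is
bounded by `4C|z|`, and these terms form the long-jump sum. -/
theorem Scales.hit_pt_le_add (s : Scales p C N r a R) (h : IsRegular p) (hC : IsGapConst p C)
    {x x' y : ℤ × ℤ} (hx : R ≤ enorm2 x) (hx' : R ≤ enorm2 x') (hy : enorm2 y < a) :
    hit p (disc 0 a) (pt y) x
      ≤ ENNReal.ofReal (1 + 129600 * C * (Real.log N / N ^ 3)) * hit p (disc 0 a) (pt y) x'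
        + ENNReal.ofReal (4 * C) * longJump p r y := by
  have har := s.a_le_mul
  have hrR := s.mul_r_le
  have hr := s.r_pos
  have hC0 := hC.pos
  rw [hit_pt_eq_tsum h.symm (by linarith) hy, hit_pt_eq_tsum h.symm (by linarith) hy, longJump,
    ← ENNReal.tsum_mul_left, ← ENNReal.tsum_mul_left, ← ENNReal.tsum_add]
  refine ENNReal.tsum_le_tsum fun z => ?_
  by_cases hza : enorm2 z < a
  · rw [green_of_mem (mem_disc.2 hza), mul_zero]; exact zero_le
  push Not at hza
  by_cases hz : z ∈ outer (3 * r)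
  · refine le_add_left ?_
    rw [indicator_of_mem hz, mul_left_comm, ← ENNReal.ofReal_mul (by positivity)]
    exact mul_le_mul_right (green_disc_le h hC s.a_pos hza x) _
  · refine le_add_right ?_
    rw [mul_left_comm]
    have hz' : enorm2 z < 3 * r := by simpa [outer] using hz
    exact mul_le_mul_right (s.green_le_mul h hC (notMem_annc.2 ⟨hza, hz'⟩) hx hx') _

theorem Scales.hit_pt_le (s : Scales p C N r a R) (h : IsRegular p) (hC : IsGapConst p C)
    {x x' y : ℤ × ℤ} (hx : R ≤ enorm2 x) (hx' : R ≤ enorm2 x') (hy : enorm2 y < a)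
    (hJ : ENNReal.ofReal (4 * C) * longJump p r y
      ≤ ENNReal.ofReal (1 / N ^ 3) * hit p (disc 0 a) (pt y) x') :
    hit p (disc 0 a) (pt y) x
      ≤ ENNReal.ofReal (1 + (129600 * C + 1) * (Real.log N / N ^ 3))
        * hit p (disc 0 a) (pt y) x' := by
  have hN := s.N_pos
  have hC0 := hC.pos
  have hlog := s.one_le_log
  refine (s.hit_pt_le_add h hC hx hx' hy).trans ((add_le_add_right hJ _).trans ?_)
  rw [← add_mul, ← ENNReal.ofReal_add (by positivity) (by positivity)]
  refine mul_le_mul_left (ENNReal.ofReal_le_ofReal ?_) _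
  have : 1 / N ^ 3 ≤ Real.log N / N ^ 3 := by gcongr
  linarith

/-- The lower bound on the Green function is known only for `|z| < 3r`; the remaining mass is at
most `longJump`, as `|z| ≥ 1` there, and is added on the right. -/
theorem Scales.le_hit_pt (s : Scales p C N r a R) (h : IsRegular p) (hC : IsGapConst p C)
    {x y : ℤ × ℤ} (hx : R ≤ enorm2 x) (hy : enorm2 y < a) {κ : ℝ}
    (hκ : ENNReal.ofReal κ ≤ ∑' z, (outer a).indicator (fun z => p (y - z)) z) :
    ENNReal.ofReal (1 / (373248 * r ^ 2 * Real.log N)) * ENNReal.ofReal κ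
      ≤ hit p (disc 0 a) (pt y) x
        + ENNReal.ofReal (1 / (373248 * r ^ 2 * Real.log N)) * longJump p r y := by
  have har := s.a_le_mul
  have hrR := s.mul_r_le
  have hr1 := s.one_le_r
  refine (mul_le_mul_right hκ _).trans ?_
  rw [hit_pt_eq_tsum h.symm (by linarith) hy, longJump,
    ← ENNReal.tsum_mul_left, ← ENNReal.tsum_mul_left, ← ENNReal.tsum_add]
  refine ENNReal.tsum_le_tsum fun z => ?_
  by_cases hza : z ∈ outer a
  · rw [indicator_of_mem hza]
    by_cases hz : z ∈ outer (3 * r)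
    · refine le_add_left ?_
      rw [indicator_of_mem hz]
      refine mul_le_mul_right (le_mul_of_one_le_right' ?_) _
      have hz' : 3 * r ≤ enorm2 z := hz
      rw [ENNReal.one_le_ofReal]; linarith
    · refine le_add_right ?_
      rw [mul_comm]
      have hz' : enorm2 z < 3 * r := by simpa [outer] using hz
      exact mul_le_mul_right (s.const_le_green h hC (notMem_annc.2 ⟨hza, hz'⟩) hx) _
  · rw [indicator_of_notMem hza, mul_zero]; exact zero_le

/-! ### Long jumps -/

theorem longJump_eq_zero {B : ℝ} (hB : ∀ u ∈ p.support, enorm2 u ≤ B) (hr : B < r) {y : ℤ × ℤ}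
    (hy : enorm2 y ≤ 3 / 2 * r) : longJump p r y = 0 := by
  refine ENNReal.tsum_eq_zero.2 fun z => ?_
  by_cases hz : z ∈ outer (3 * r)
  · have hz' : 3 * r ≤ enorm2 z := hz
    rw [indicator_of_mem hz]
    have : y - z ∉ p.support := fun hu => by
      have h1 := hB _ hu
      have h2 := enorm2_le_add_sub z y
      have h3 := enorm2_nonneg z
      rw [enorm2_sub_comm] at h2
      linarith
    rw [PMF.mem_support_iff, not_not] at this
    rw [this, zero_mul]
  · rw [indicator_of_notMem hz]

/-- With `|z| ≥ 3r` and `|y| ≤ 3r/2`, the jump `u = y - z` satisfies `|u| ≥ r` and `|z| ≤ 2|u|`;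
then `|u| ≤ r ^ (1 - q) |u| ^ q`. For `q = 3 + 2β` the bound is of order `r ^ (-2 - 2β)`. -/
theorem longJump_le {q : ℝ} (hq : 1 ≤ q) (hmom : HasFiniteMoment p q) (hr : 0 < r) {y : ℤ × ℤ}
    (hy : enorm2 y ≤ 3 / 2 * r) :
    longJump p r y ≤ ENNReal.ofReal (2 * r ^ (1 - q) * ∑' u, pr p u * enorm2 u ^ q) := by
  have h0 : ∀ u, 0 ≤ pr p u * enorm2 u ^ q := fun u =>
    mul_nonneg (pr_nonneg u) (Real.rpow_nonneg (enorm2_nonneg u) q)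
  rw [ENNReal.ofReal_mul (by positivity), ENNReal.ofReal_tsum_of_nonneg h0 hmom,
    ← ENNReal.tsum_mul_left, longJump]
  rw [← (Equiv.subLeft y).tsum_eq fun u =>
    ENNReal.ofReal (2 * r ^ (1 - q)) * ENNReal.ofReal (pr p u * enorm2 u ^ q)]
  refine ENNReal.tsum_le_tsum fun z => ?_
  by_cases hz : z ∈ outer (3 * r)
  · have hz' : 3 * r ≤ enorm2 z := hz
    rw [indicator_of_mem hz, Equiv.subLeft_apply, ENNReal.ofReal_mul (pr_nonneg _), pr,
      ENNReal.ofReal_toReal (p.apply_ne_top _), mul_left_comm, ← ENNReal.ofReal_mul (by positivity)]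
    refine mul_le_mul_right (ENNReal.ofReal_le_ofReal ?_) _
    have h2 := enorm2_le_add_sub z y
    rw [enorm2_sub_comm] at h2
    have hu : r ≤ enorm2 (y - z) := by linarith
    have hu0 : 0 < enorm2 (y - z) := hr.trans_le hu
    have h3 : enorm2 (y - z) = enorm2 (y - z) ^ (1 - q) * enorm2 (y - z) ^ q := by
      rw [← Real.rpow_add hu0, sub_add_cancel, Real.rpow_one]
    have h4 : enorm2 (y - z) ^ (1 - q) ≤ r ^ (1 - q) :=
      Real.rpow_le_rpow_of_nonpos hr hu (by linarith)
    calc enorm2 z ≤ 2 * enorm2 (y - z) := by linarith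
      _ = 2 * (enorm2 (y - z) ^ (1 - q) * enorm2 (y - z) ^ q) := by rw [← h3]
      _ ≤ 2 * (r ^ (1 - q) * enorm2 (y - z) ^ q) := by gcongr
      _ = _ := by ring
  · rw [indicator_of_notMem hz]; exact zero_le

/-- Condition A concerns jumps from `y` inwards, whereas the last step before the disc comes from
outside. The reflection `z ↦ 2y - z` exchanges them: if `|2y - z| < |y| - s`, then `|z| ≥ |y| + s ≥
a`. -/
theorem ofReal_le_tsum_outer {s κ : ℝ} {y : ℤ × ℤ}
    (hya : a ≤ enorm2 y + s) (hκ : κ ≤ ∑' z : disc 0 (enorm2 y - s), (p ((z : ℤ × ℤ) - y)).toReal) :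
    ENNReal.ofReal κ ≤ ∑' z, (outer a).indicator (fun z => p (y - z)) z := by
  refine (ENNReal.ofReal_le_ofReal hκ).trans ?_
  rw [← ENNReal.tsum_toReal_eq fun z => p.apply_ne_top _]
  refine ENNReal.ofReal_toReal_le.trans ?_
  rw [tsum_subtype (disc 0 (enorm2 y - s)) fun z => p (z - y),
    ← (Equiv.subLeft (y + y)).tsum_eq]
  refine ENNReal.tsum_le_tsum fun z => ?_
  rw [Equiv.subLeft_apply]
  by_cases hz : y + y - z ∈ disc 0 (enorm2 y - s)
  · have h1 : enorm2 (y + y - z) < enorm2 y - s := mem_disc.1 hz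
    have h2 : 2 * enorm2 y ≤ enorm2 z + enorm2 (y + y - z) := by
      have h3 := enorm2_le_add_sub (y + y) z
      have h4 : enorm2 (y + y) = 2 * enorm2 y := by
        rw [enorm2_eq_norm, map_add, ← two_mul, norm_mul, enorm2_eq_norm]; simp
      linarith
    have h5 : z ∈ outer a := by
      change a ≤ enorm2 z
      linarith
    rw [indicator_of_mem hz, indicator_of_mem h5]
    apply le_of_eq
    congr 1
    abel
  · rw [indicator_of_notMem hz]; exact zero_le

/-- Long jumps are negligible for the hitting distribution. -/
def LongJumpNegligible (p : PMF (ℤ × ℤ)) (C N r a R : ℝ) (y : ℤ × ℤ) : Prop :=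
  ∀ x, R ≤ enorm2 x → ENNReal.ofReal (4 * C) * longJump p r y
    ≤ ENNReal.ofReal (1 / N ^ 3) * hit p (disc 0 a) (pt y) x

/-- Since `r ≥ exp N`, the long jumps are of order at most `r⁻² exp (-2βN)`, while the hitting
probability is at least of order `r⁻² exp (-βN) / log N`. The spare factor `exp (-βN)` beats the
required powers of `N`, which is what `hN` records. -/
theorem Scales.longJumpNegligible (s : Scales p C N r a R) (h : IsRegular p)
    (hC : IsGapConst p C) {β c : ℝ} (hβ : 0 < β) (hmom : HasFiniteMoment p (3 + 2 * β))
    (hr : Real.exp N ≤ r)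
    (hN : (4 * 10 ^ 6 * (C + 1) * ∑' u, pr p u * enorm2 u ^ (3 + 2 * β)) * (N ^ 4 * Real.exp (-β * N))
      ≤ c)
    {y : ℤ × ℤ} (hy : enorm2 y < a)
    (hκ : ENNReal.ofReal (c * Real.exp (-β * N))
      ≤ ∑' z, (outer a).indicator (fun z => p (y - z)) z) :
    LongJumpNegligible p C N r a R y := by
  intro x hx
  have hN0 := s.N_pos
  have hN1 := s.one_le_N
  have hlog := s.one_le_log
  have hr0 := s.r_pos
  have hC0 := hC.pos
  set M := ∑' u, pr p u * enorm2 u ^ (3 + 2 * β) with hM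
  have hM0 : 0 ≤ M := tsum_nonneg fun u =>
    mul_nonneg (pr_nonneg u) (Real.rpow_nonneg (enorm2_nonneg u) _)
  have h1 := longJump_le (by linarith) hmom hr0 (hy.le.trans s.a_le_mul)
  rw [← hM] at h1
  have h2 := s.le_hit_pt h hC hx hy hκ
  have hJtop : longJump p r y ≠ ⊤ := ne_top_of_le_ne_top ENNReal.ofReal_ne_top h1
  have hHtop : hit p (disc 0 a) (pt y) x ≠ ⊤ := by
    refine ne_top_of_le_ne_top ENNReal.one_ne_top ((hit_mono (fun v _ => ?_) x).trans (hit_one_le x))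
    rw [pt, Pi.single_apply]; split_ifs <;> simp
  have hr2 : r ^ (1 - (3 + 2 * β)) ≤ Real.exp (-β * N) * Real.exp (-β * N) / r ^ 2 := by
    have e : (1 - (3 + 2 * β)) = -(2 * β) - (2 : ℕ) := by push_cast; ring
    rw [e, Real.rpow_sub_natCast hr0.ne']
    gcongr
    calc r ^ (-(2 * β)) ≤ (Real.exp N) ^ (-(2 * β)) :=
          Real.rpow_le_rpow_of_nonpos (Real.exp_pos _) hr (by linarith)
      _ = _ := by rw [← Real.exp_mul, ← Real.exp_add]; congr 1; ring
  set E := Real.exp (-β * N) with hE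
  have hE0 : 0 < E := Real.exp_pos _
  have hE1 : E ≤ 1 := Real.exp_le_one_iff.2 (by nlinarith)
  have h1' : longJump p r y ≤ ENNReal.ofReal (2 * (E * E / r ^ 2) * M) :=
    h1.trans (ENNReal.ofReal_le_ofReal (by gcongr))
  rw [← ENNReal.ofReal_toReal hJtop] at h1' h2 ⊢
  rw [← ENNReal.ofReal_toReal hHtop] at h2 ⊢
  set J := (longJump p r y).toReal
  set H := (hit p (disc 0 a) (pt y) x).toReal
  have hJ0 : 0 ≤ J := ENNReal.toReal_nonneg
  have hH0 : 0 ≤ H := ENNReal.toReal_nonneg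
  rw [ENNReal.ofReal_le_ofReal_iff (by positivity)] at h1'
  rw [← ENNReal.ofReal_mul (by positivity), ← ENNReal.ofReal_mul (by positivity),
    ← ENNReal.ofReal_add hH0 (by positivity), ENNReal.ofReal_le_ofReal_iff (by positivity)] at h2
  rw [← ENNReal.ofReal_mul (by positivity), ← ENNReal.ofReal_mul (by positivity)]
  refine ENNReal.ofReal_le_ofReal ?_
  set D := 373248 * r ^ 2 * Real.log N with hD
  have hD0 : 0 < D := by positivity
  have h3 : c * E - J ≤ D * H := by
    have : 1 / D * (c * E) - 1 / D * J ≤ H := by linarith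
    rw [← mul_sub, one_div, inv_mul_le_iff₀ hD0] at this
    exact this
  have h4 : J * r ^ 2 ≤ 2 * M * E * E := by
    calc J * r ^ 2 ≤ 2 * (E * E / r ^ 2) * M * r ^ 2 := by gcongr
      _ = _ := by field_simp
  rw [one_div, mul_comm (N ^ 3)⁻¹, ← div_eq_mul_inv, le_div_iff₀ (by positivity)]
  refine le_of_mul_le_mul_left ?_ hD0
  refine le_trans ?_ h3
  have h6 : D * (4 * C * J * N ^ 3) ≤ 2985984 * C * M * E * E * N ^ 4 := by
    calc D * (4 * C * J * N ^ 3) = 1492992 * C * (J * r ^ 2) * Real.log N * N ^ 3 := by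
          rw [hD]; ring
      _ ≤ 1492992 * C * (2 * M * E * E) * N * N ^ 3 := by gcongr; exact s.log_le
      _ = _ := by ring
  have h7 : J ≤ 2 * (M * E * E * N ^ 4) :=
    calc J ≤ J * r ^ 2 := le_mul_of_one_le_right hJ0 (one_le_pow₀ s.one_le_r)
      _ ≤ 2 * (M * E * E) := by linarith
      _ ≤ 2 * (M * E * E * N ^ 4) := by
        have := le_mul_of_one_le_right (show 0 ≤ M * E * E by positivity)
          (one_le_pow₀ (n := 4) hN1)
        linarith
  have h8 : 4 * 10 ^ 6 * (C + 1) * M * (N ^ 4 * E) * E ≤ c * E := by gcongr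
  have h9 : 0 ≤ M * E * E * N ^ 4 := by positivity
  have h10 : 0 ≤ C * (M * E * E * N ^ 4) := by positivity
  nlinarith

theorem band_disc {s : ℝ} {y : ℤ × ℤ} (hy : y ∈ band (disc 0 r) s) :
    r ≤ enorm2 y ∧ enorm2 y < r + s := by
  obtain ⟨h1, x, hx, hxy⟩ := hy
  rw [mem_disc] at h1 hx
  have := enorm2_le_add_sub y x
  exact ⟨not_lt.1 h1, by linarith⟩

end LatticeWalk

namespace LatticeWalk

/-! ### The escape probability from a large annulus -/

variable {p : PMF (ℤ × ℤ)} {C N r a R : ℝ}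

/-- Optional stopping of the almost harmonic `tlog`: it nearly vanishes on the inner disc and is
nearly the constant logarithm at the outer exit, so its starting value is nearly the escape
probability times that constant. -/
theorem Scales.abs_escape_mul_log_sub_le (s : Scales p C N r a R) (h : IsRegular p) {x : ℤ × ℤ}
    (hx : R ≤ enorm2 x) (hx' : enorm2 x < R + N ^ 4) :
    |(escape p a (N ^ 3 * R) x).toReal * Real.log (N ^ 3 * R / (a * (1 - 1 / N ^ 3)))
      - tlog (a * (1 - 1 / N ^ 3)) x| ≤ 5 * (1 / N ^ 3) := by
  have hr := s.r_pos
  have hR := s.R_pos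
  have hN := s.N_pos
  have hN1 := s.one_le_N
  have ha := s.a_pos
  have hm := mom3_nonneg (p := p)
  have hrR := s.mul_r_le
  have har := s.a_le_mul
  have hra := s.le_a
  have hlarge := s.large
  set δ : ℝ := 1 / N ^ 3 with hδ
  have hδ0 : 0 < δ := by positivity
  have hN3 : N ≤ N ^ 3 := le_self_pow₀ hN1 (by norm_num)
  have hδ1 : δ ≤ 1 / 10 ^ 6 := by rw [hδ]; gcongr; linarith
  -- Slightly below `a`: the room lets almost harmonicity hold with `κ = δ` throughout the annulus,
  -- while `tlog` is at most `2δ` on the inner disc. The resulting negative powers of `δ` are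
  -- absorbed by the size of `r`.
  set ρ : ℝ := a * (1 - δ) with hρ
  have hρa : a / 2 ≤ ρ := by rw [hρ]; nlinarith
  have hρa' : ρ ≤ a := by rw [hρ]; nlinarith
  have hρ0 : 0 < ρ := by linarith
  set b : ℝ := N ^ 3 * R with hb
  have hRb : 10 ^ 6 * R ≤ b := by rw [hb]; gcongr; linarith
  have hNR : N ^ 4 ≤ R := by
    have := s.mul_pow_le (k := 4) (by norm_num)
    have := pow_pos hN 4
    linarith
  set S := annc a b
  have hS : ∀ y ∉ S, a ≤ enorm2 y ∧ enorm2 y < b := fun y hy => notMem_annc.1 hy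
  have hxS : x ∉ S := notMem_annc.2 ⟨by linarith, by linarith⟩
  set ε : ℝ := 3 * mom3 p / (δ ^ 2 * ρ ^ 3) with hε
  have hε0 : 0 ≤ ε := by positivity
  have hE : green p S 1 x ≤ ENNReal.ofReal (64 * b ^ 2) := s.green_one_le h (by linarith) a x
  have hfin : green p S 1 x ≠ ⊤ := ne_top_of_le_ne_top ENNReal.ofReal_ne_top hE
  have hharm : ∀ y ∉ S, _ := fun y hy =>
    h.tlog_almost_harmonic (κ := δ) hρ0 hδ0 (by linarith) (x := y) (ε := ε)
      (by
        rw [hρ, mul_comm]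
        exact mul_le_mul_of_nonneg_left (hS y hy).1 (by linarith)) le_rfl
  set P := escape p a b x with hP
  have hPtop : P ≠ ⊤ := ne_top_of_le_ne_top ENNReal.one_ne_top (escape_le_one _ _ _)
  have hP0 : 0 ≤ P.toReal := ENNReal.toReal_nonneg
  have hP1 : P.toReal ≤ 1 := ENNReal.toReal_mono ENNReal.one_ne_top (escape_le_one _ _ _)
  set Λ := Real.log (b / ρ) with hΛ
  have hΛ0 : 0 ≤ Λ := Real.log_nonneg (by rw [le_div_iff₀ hρ0]; linarith)
  have hT0 := tlog_nonneg hρ0 x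
  have eE : ε * (64 * b ^ 2) ≤ δ := by
    have h1 : ε * (64 * b ^ 2) ≤ 3 * mom3 p / (δ ^ 2 * (r / 2) ^ 3) * (64 * b ^ 2) := by
      rw [hε]; gcongr; linarith
    refine h1.trans ?_
    have e : 3 * mom3 p / (δ ^ 2 * (r / 2) ^ 3) * (64 * b ^ 2) = 1536 * (mom3 p * N ^ 18) / r := by
      rw [hδ, hb, s.R_eq]; field_simp; ring
    rw [e, hδ, div_le_div_iff₀ hr (by positivity)]
    calc 1536 * (mom3 p * N ^ 18) * N ^ 3 ≤ 1536 * (N * N ^ 18) * N ^ 3 := by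
          gcongr; exact s.mom_le
      _ = 1536 * N ^ 22 := by ring
      _ ≤ 10 ^ 6 * N ^ 22 := by gcongr; norm_num
      _ ≤ 1 * r := by rw [one_mul]; exact s.mul_pow_le (by norm_num)
  have upper : P.toReal * Λ ≤ tlog ρ x + δ := by
    have h1 := hit_add_green_le (p := p) (S := S) (F := fun y => ENNReal.ofReal (tlog ρ y))
      (e := 0) (d := fun _ => ENNReal.ofReal ε * 1)
      (fun y hy => by
        simpa only [Pi.zero_apply, add_zero, mul_one] using (hharm y hy).1) x
    rw [green_const_mul] at h1
    replace h1 := (le_self_add.trans h1).trans (add_le_add_right (mul_le_mul_right hE _) _)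
    have h2 : ENNReal.ofReal Λ * P ≤ hit p S (fun y => ENNReal.ofReal (tlog ρ y)) x := by
      rw [hP, escape, ← hit_const_mul]
      refine hit_mono (fun y _ => ?_) x
      by_cases hy : y ∈ outer b
      · rw [indicator_of_mem hy, Pi.one_apply, mul_one]
        have hy' : b ≤ enorm2 y := hy
        refine ENNReal.ofReal_le_ofReal ?_
        rw [tlog_of_le (by linarith)]
        exact Real.log_le_log (by positivity) (by gcongr)
      · rw [indicator_of_notMem hy, mul_zero]; exact zero_le
    have h3 := h2.trans h1
    rw [← ENNReal.ofReal_toReal hPtop, ← ENNReal.ofReal_mul hΛ0, ← ENNReal.ofReal_mul hε0,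
      ← ENNReal.ofReal_add hT0 (by positivity), ENNReal.ofReal_le_ofReal_iff (by positivity)] at h3
    linarith
  -- An overshoot below `L` raises the logarithm by at most `δ`; larger overshoots are paid for by
  -- the third moment.
  set L := (1 + δ) * b with hL
  have hb0 : 0 < b := by linarith
  have hbL : b ≤ L := by rw [hL]; nlinarith
  have hL0 : 0 < L := by linarith
  have lower : tlog ρ x ≤ P.toReal * Λ + 5 * δ := by
    have h1 := le_hit_add_green (p := p) (S := S) (F := fun y => ENNReal.ofReal (tlog ρ y))
      (e := 0) (d := fun _ => ENNReal.ofReal ε * 1) (B := ENNReal.ofReal Λ)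
      ENNReal.ofReal_ne_top
      (fun y hy => ENNReal.ofReal_le_ofReal (tlog_le_log hρ0 (by linarith) (hS y hy).2.le))
      (fun y hy => by
        simpa only [Pi.zero_apply, add_zero, mul_one] using (hharm y hy).2) hfin
    rw [green_const_mul] at h1
    replace h1 := (le_self_add.trans h1).trans (add_le_add_right (mul_le_mul_right hE _) _)
    have h2 : hit p S (fun y => ENNReal.ofReal (tlog ρ y)) x
        ≤ ENNReal.ofReal (2 * δ) * 1 + ENNReal.ofReal (Λ + δ) * P
          + ENNReal.ofReal (1 / (L * ρ)) * (ENNReal.ofReal (mom3 p / ((δ / 2) ^ 3 * L))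
            * ENNReal.ofReal (64 * b ^ 2)) := by
      have h3 : hit p S (fun y => ENNReal.ofReal (tlog ρ y)) x
          ≤ hit p S ((fun y => ENNReal.ofReal (2 * δ) * (1 : ℤ × ℤ → ℝ≥0∞) y)
            + (fun y => ENNReal.ofReal (Λ + δ) * (outer b).indicator 1 y)
            + fun y => ENNReal.ofReal (1 / (L * ρ)) * farSq L y) x := by
        refine hit_mono (fun y hy => ?_) x
        simp only [Pi.add_apply]
        rcases hy with hy | hy
        · refine le_add_right (le_add_right ?_)
          rw [Pi.one_apply, mul_one]
          refine ENNReal.ofReal_le_ofReal ((tlog_le_log hρ0 hρa' hy.le).trans ?_)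
          have h4 := Real.log_le_sub_one_of_pos (div_pos ha hρ0)
          have h5 : a / ρ ≤ 1 + 2 * δ := by
            rw [div_le_iff₀ hρ0, hρ]
            have : 0 ≤ a * δ * (1 - 2 * δ) := by
              have : 0 ≤ 1 - 2 * δ := by linarith
              positivity
            linarith
          linarith
        · by_cases h4 : L ≤ enorm2 y
          · exact le_add_left (tlog_le_farSq hρ0 (by linarith) h4)
          · refine le_add_right (le_add_left ?_)
            rw [indicator_of_mem (show y ∈ outer b from hy), Pi.one_apply, mul_one]
            push Not at h4
            refine ENNReal.ofReal_le_ofReal ((tlog_le_log hρ0 (by linarith) h4.le).trans ?_)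
            have e : L / ρ = (1 + δ) * (b / ρ) := by rw [hL, mul_div_assoc]
            have h5 := Real.log_le_sub_one_of_pos (show 0 < 1 + δ by linarith)
            have hb1 : 0 < b / ρ := by positivity
            rw [e, Real.log_mul (by linarith) hb1.ne']
            linarith
      refine h3.trans ?_
      rw [hit_add, hit_add, Pi.add_apply, Pi.add_apply, hit_const_mul, hit_const_mul, hit_const_mul]
      gcongr
      · exact hit_one_le x
      · exact le_rfl
      · refine (h.hit_farSq_le (κ := δ / 2) (by positivity) hL0 ?_
          (fun y hy => (hS y hy).2.le) hxS).trans ?_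
        · rw [hL, ← mul_assoc]
          refine le_mul_of_one_le_left (by positivity) ?_
          nlinarith
        · gcongr
    have h3 := h1.trans (add_le_add_left h2 _)
    rw [← ENNReal.ofReal_toReal hPtop, mul_one, ← ENNReal.ofReal_mul (by positivity),
      ← ENNReal.ofReal_mul (by positivity), ← ENNReal.ofReal_mul (by positivity),
      ← ENNReal.ofReal_mul hε0, ← ENNReal.ofReal_add (by positivity) (by positivity),
      ← ENNReal.ofReal_add (by positivity) (by positivity),
      ← ENNReal.ofReal_add (by positivity) (by positivity),
      ENNReal.ofReal_le_ofReal_iff (by positivity)] at h3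
    have h4 : 1 / (L * ρ) * (mom3 p / ((δ / 2) ^ 3 * L) * (64 * b ^ 2)) ≤ δ := by
      calc 1 / (L * ρ) * (mom3 p / ((δ / 2) ^ 3 * L) * (64 * b ^ 2))
          ≤ 1 / (b * (r / 2)) * (mom3 p / ((δ / 2) ^ 3 * b) * (64 * b ^ 2)) := by
            gcongr
            linarith
        _ = 1024 * (mom3 p * N ^ 9) / r := by rw [hδ]; field_simp; ring
        _ ≤ δ := by
          rw [hδ, div_le_div_iff₀ hr (by positivity)]
          calc 1024 * (mom3 p * N ^ 9) * N ^ 3 ≤ 1024 * (N * N ^ 9) * N ^ 3 := by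
                gcongr; exact s.mom_le
            _ = 1024 * N ^ 13 := by ring
            _ ≤ 10 ^ 6 * N ^ 13 := by gcongr; norm_num
            _ ≤ 1 * r := by rw [one_mul]; exact s.mul_pow_le (by norm_num)
    have h5 : δ * P.toReal ≤ δ := mul_le_of_le_one_right hδ0.le hP1
    linarith
  rw [abs_le]
  constructor <;> linarith

/-- The probability to hit the inner disc before the exterior of the large disc. -/
def returnProb (p : PMF (ℤ × ℤ)) (a b : ℝ) (x : ℤ × ℤ) : ℝ≥0∞ :=
  hit p (annc a b) ((disc 0 a).indicator 1) x

theorem returnProb_add_escape {b : ℝ} (hab : a ≤ b) {x : ℤ × ℤ}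
    (hfin : green p (annc a b) 1 x ≠ ⊤) : returnProb p a b x + escape p a b x = 1 := by
  rw [returnProb, escape, ← Pi.add_apply, ← hit_add, ← hit_one_eq_one hfin]
  refine hit_congr (fun y hy => ?_) x
  rw [Pi.add_apply]
  rcases hy with hy | hy
  · rw [indicator_of_mem (mem_disc.2 hy), indicator_of_notMem, add_zero]
    exact (hy.trans_le hab).not_ge
  · rw [indicator_of_mem (show y ∈ outer b from hy), indicator_of_notMem, zero_add]
    rw [mem_disc]; exact (hab.trans hy).not_gt

theorem Scales.returnProb_toReal (s : Scales p C N r a R) (h : IsRegular p) (x : ℤ × ℤ) :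
    (returnProb p a (N ^ 3 * R) x).toReal = 1 - (escape p a (N ^ 3 * R) x).toReal := by
  have hr := s.r_pos
  have har := s.a_le_mul
  have hrR := s.mul_r_le
  have hR : R ≤ N ^ 3 * R := le_mul_of_one_le_left s.R_pos.le (one_le_pow₀ s.one_le_N)
  have h1 := returnProb_add_escape (p := p) (x := x) (show a ≤ N ^ 3 * R by linarith)
    (ne_top_of_le_ne_top ENNReal.ofReal_ne_top (s.green_one_le h (by linarith) a x))
  have hPtop : escape p a (N ^ 3 * R) x ≠ ⊤ :=
    ne_top_of_le_ne_top ENNReal.one_ne_top (escape_le_one _ _ _)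
  have hQtop : returnProb p a (N ^ 3 * R) x ≠ ⊤ :=
    ne_top_of_le_ne_top ENNReal.one_ne_top (by rw [← h1]; exact le_self_add)
  have := congrArg ENNReal.toReal h1
  rw [ENNReal.toReal_add hQtop hPtop, ENNReal.toReal_one] at this
  linarith

theorem Scales.le_log_ratio (s : Scales p C N r a R) :
    5 * Real.log N ≤ Real.log (N ^ 3 * R / (a * (1 - 1 / N ^ 3))) := by
  have hr := s.r_pos
  have hN := s.N_pos
  have ha := s.a_pos
  have hN1 := s.one_le_N
  have hlarge := s.large
  have hN3 : N ≤ N ^ 3 := le_self_pow₀ hN1 (by norm_num)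
  have hδ1 : 1 / N ^ 3 ≤ 1 / 10 ^ 6 := by gcongr; linarith
  have hδ0 : 0 < 1 / N ^ 3 := by positivity
  have h1 : 0 < 1 - 1 / N ^ 3 := by linarith
  rw [show (5 : ℝ) * Real.log N = Real.log (N ^ 5) by rw [Real.log_pow]; norm_num]
  refine Real.log_le_log (by positivity) ?_
  rw [le_div_iff₀ (by positivity), s.R_eq]
  have h2 : a * (1 - 1 / N ^ 3) ≤ 3 / 2 * r :=
    (mul_le_of_le_one_right ha.le (by linarith)).trans s.a_le_mul
  calc N ^ 5 * (a * (1 - 1 / N ^ 3)) ≤ N ^ 5 * (3 / 2 * r) := by gcongr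
    _ ≤ N ^ 5 * (N * r) := by gcongr; linarith
    _ = _ := by ring

/-- On the band `tlog` varies by at most `1/N³`, because the width `N^4` is tiny compared with `r`.
With two approximation errors of `5/N³` the total is `11/N³`; the factor `log (N³R/ρ)`, where `ρ` is
the truncation radius, is at least `1`. -/
theorem Scales.abs_returnProb_sub_le (s : Scales p C N r a R) (h : IsRegular p) {x x' : ℤ × ℤ}
    (hx : R ≤ enorm2 x) (hx1 : enorm2 x < R + N ^ 4) (hx' : R ≤ enorm2 x')
    (hx1' : enorm2 x' < R + N ^ 4) :
    |(returnProb p a (N ^ 3 * R) x).toReal - (returnProb p a (N ^ 3 * R) x').toReal|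
      ≤ 11 * (1 / N ^ 3) := by
  have hr := s.r_pos
  have hN := s.N_pos
  have ha := s.a_pos
  have hN1 := s.one_le_N
  have hlarge := s.large
  have hN3 : N ≤ N ^ 3 := le_self_pow₀ hN1 (by norm_num)
  have e1 := s.abs_escape_mul_log_sub_le h hx hx1
  have e2 := s.abs_escape_mul_log_sub_le h hx' hx1'
  have hΛ : 1 ≤ Real.log (N ^ 3 * R / (a * (1 - 1 / N ^ 3))) := by
    have := s.one_le_log; have := s.le_log_ratio; linarith
  rw [s.returnProb_toReal h, s.returnProb_toReal h]
  set Λ := Real.log (N ^ 3 * R / (a * (1 - 1 / N ^ 3)))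
  set δ : ℝ := 1 / N ^ 3 with hδ
  have hδ0 : 0 < δ := by positivity
  have hδ1 : δ ≤ 1 / 10 ^ 6 := by rw [hδ]; gcongr; linarith
  set ρ := a * (1 - δ) with hρ
  have hρr : r / 2 ≤ ρ := by have := s.le_a; rw [hρ]; nlinarith
  have hρ0 : 0 < ρ := by linarith
  have hdiv : ∀ u v : ℤ × ℤ, R ≤ enorm2 u → enorm2 u < R + N ^ 4 → R ≤ enorm2 v →
      enorm2 v < R + N ^ 4 → tlog ρ u ≤ tlog ρ v + δ := fun u v hu hu' hv hv' => by
    refine (tlog_le_add hρ0 u v).trans (add_le_add_right ?_ _)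
    have h1 : |enorm2 u - enorm2 v| ≤ N ^ 4 := by rw [abs_le]; constructor <;> linarith
    calc |enorm2 u - enorm2 v| / ρ ≤ N ^ 4 / (r / 2) := by gcongr
      _ ≤ δ := by
        rw [hδ, div_le_div_iff₀ (by positivity) (by positivity)]
        have := s.mul_pow_le (k := 7) (by norm_num)
        have := pow_pos hN 7
        calc N ^ 4 * N ^ 3 = N ^ 7 := by ring
          _ ≤ _ := by linarith
  have t1 := hdiv x x' hx hx1 hx' hx1'
  have t2 := hdiv x' x hx' hx1' hx hx1
  set P := (escape p a (N ^ 3 * R) x).toReal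
  set P' := (escape p a (N ^ 3 * R) x').toReal
  have key : |(P - P') * Λ| ≤ 11 * δ := by
    rw [abs_le] at e1 e2 ⊢
    constructor <;> linarith [e1.1, e1.2, e2.1, e2.2]
  rw [abs_mul, abs_of_nonneg (by linarith : 0 ≤ Λ)] at key
  have : |P - P'| ≤ |P - P'| * Λ := le_mul_of_one_le_right (abs_nonneg _) hΛ
  have e : 1 - P - (1 - P') = -(P - P') := by ring
  rw [e, abs_neg]
  linarith

/-- The starting value is at most `4 log N` and the exit value at least `5 log N`, so an escape
probability above `5/6` would contradict the approximation. -/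
theorem Scales.le_returnProb (s : Scales p C N r a R) (h : IsRegular p) {x : ℤ × ℤ}
    (hx : R ≤ enorm2 x) (hx1 : enorm2 x < R + N ^ 4) :
    1 / 6 ≤ (returnProb p a (N ^ 3 * R) x).toReal := by
  have hr := s.r_pos
  have hR := s.R_pos
  have hN := s.N_pos
  have ha := s.a_pos
  have hN1 := s.one_le_N
  have hlarge := s.large
  have hlog := s.one_le_log
  have hra := s.le_a
  have hN3 : N ≤ N ^ 3 := le_self_pow₀ hN1 (by norm_num)
  have e1 := s.abs_escape_mul_log_sub_le h hx hx1
  have hΛ := s.le_log_ratio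
  rw [s.returnProb_toReal h]
  set Λ := Real.log (N ^ 3 * R / (a * (1 - 1 / N ^ 3)))
  set δ : ℝ := 1 / N ^ 3 with hδ
  have hδ0 : 0 < δ := by positivity
  have hδ1 : δ ≤ 1 / 10 ^ 6 := by rw [hδ]; gcongr; linarith
  set ρ := a * (1 - δ) with hρ
  have hρr : r / 2 ≤ ρ := by rw [hρ]; nlinarith
  have hρ0 : 0 < ρ := by linarith
  have hρa : ρ ≤ a := by rw [hρ]; nlinarith
  have har := s.a_le_mul
  have hrR := s.mul_r_le
  have hNR : N ^ 4 ≤ R := by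
    have := s.mul_pow_le (k := 4) (by norm_num)
    have := pow_pos hN 4
    linarith
  have h1 : tlog ρ x ≤ 4 * Real.log N := by
    refine (tlog_le_log hρ0 (a := 2 * R) (by linarith) (by linarith)).trans ?_
    rw [show (4 : ℝ) * Real.log N = Real.log (N ^ 4) by rw [Real.log_pow]; norm_num]
    refine Real.log_le_log (by positivity) ?_
    rw [div_le_iff₀ hρ0, s.R_eq]
    calc 2 * (N ^ 3 * r) = 4 * N ^ 3 * (r / 2) := by ring
      _ ≤ N * N ^ 3 * ρ := by gcongr; linarith
      _ = _ := by ring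
  set P := (escape p a (N ^ 3 * R) x).toReal
  have h2 := (abs_le.1 e1).2
  by_contra! hlt
  have h3 : 5 / 6 * (5 * Real.log N) ≤ P * Λ := mul_le_mul (by linarith) hΛ (by linarith) (by linarith)
  linarith

end LatticeWalk

namespace LatticeWalk

/-! ### Comparison of the hitting distributions -/

variable {p : PMF (ℤ × ℤ)} {C N r a R : ℝ}

theorem disc_union_compl (a b : ℝ) : disc 0 a ∪ (disc 0 b)ᶜ = annc a b := by
  ext y
  simp [mem_disc, annc]

theorem hit_pt_le_one {S : Set (ℤ × ℤ)} (y x : ℤ × ℤ) : hit p S (pt y) x ≤ 1 := by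
  refine (hit_mono (fun v _ => ?_) x).trans (hit_one_le x)
  rw [pt, Pi.single_apply]; split_ifs <;> simp

theorem hit_pt_ne_top {S : Set (ℤ × ℤ)} (y x : ℤ × ℤ) : hit p S (pt y) x ≠ ⊤ :=
  ne_top_of_le_ne_top ENNReal.one_ne_top (hit_pt_le_one y x)

theorem abs_toReal_sub_le_of_comparable {u v : ℝ≥0∞} (hu : u ≠ ⊤) (hv : v ≠ ⊤) {ε : ℝ}
    (hε : 0 ≤ ε) (h1 : u ≤ ENNReal.ofReal (1 + ε) * v)
    (h2 : v ≤ ENNReal.ofReal (1 + ε) * u) : |u.toReal - v.toReal| ≤ 2 * ε * v.toReal := by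
  have f : ∀ {s t : ℝ≥0∞}, t ≠ ⊤ → s ≤ ENNReal.ofReal (1 + ε) * t →
      s.toReal ≤ (1 + ε) * t.toReal := fun ht hst => by
    have := ENNReal.toReal_mono (ENNReal.mul_ne_top ENNReal.ofReal_ne_top ht) hst
    rwa [ENNReal.toReal_mul, ENNReal.toReal_ofReal (by linarith)] at this
  have g1 := f hv h1
  have g2 := f hu h2
  have hv0 : 0 ≤ v.toReal := ENNReal.toReal_nonneg
  rw [abs_le]
  constructor <;> nlinarith [mul_nonneg hε hv0]

/-- Strong Markov property at the exit from the annulus, split according to the side of the exit. -/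
theorem hit_disc_eq_add {b : ℝ} (hab : a ≤ b) {y : ℤ × ℤ} (hy : enorm2 y < a) (x : ℤ × ℤ) :
    hit p (disc 0 a) (pt y) x = hit p (annc a b) (pt y) x
      + hit p (annc a b) ((outer b).indicator (hit p (disc 0 a) (pt y))) x := by
  rw [hit_eq_hit_hit (disc_subset_annc a b), ← Pi.add_apply, ← hit_add]
  refine hit_congr (fun v hv => ?_) x
  rw [Pi.add_apply]
  rcases hv with hv | hv
  · rw [hit_of_mem (mem_disc.2 hv), indicator_of_notMem, add_zero]
    exact (hv.trans_le hab).not_ge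
  · rw [indicator_of_mem (show v ∈ outer b from hv), pt, Pi.single_apply, if_neg, zero_add]
    rintro rfl
    exact (hy.trans_le (hab.trans hv)).false

/-- After an escape the walk sits at norm at least `R`, where the hitting probability of `y` is
comparable with that from `x`. The escaping part is thus `H * P` up to `2ε`; since `P ≤ 6 (1 - P)`,
the error becomes `12ε` relative to the returning part. -/
theorem Scales.abs_hit_annc_sub_le (s : Scales p C N r a R) (h : IsRegular p) {x y : ℤ × ℤ}
    (hx : R ≤ enorm2 x) (hx1 : enorm2 x < R + N ^ 4) (hy : enorm2 y < a) {ε : ℝ} (hε : 0 ≤ ε)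
    (hH : ∀ u v : ℤ × ℤ, R ≤ enorm2 u → R ≤ enorm2 v →
      hit p (disc 0 a) (pt y) u ≤ ENNReal.ofReal (1 + ε) * hit p (disc 0 a) (pt y) v) :
    |(hit p (annc a (N ^ 3 * R)) (pt y) x).toReal
        - (returnProb p a (N ^ 3 * R) x).toReal * (hit p (disc 0 a) (pt y) x).toReal|
      ≤ 12 * ε * ((returnProb p a (N ^ 3 * R) x).toReal
        * (hit p (disc 0 a) (pt y) x).toReal) := by
  have hr := s.r_pos
  have har := s.a_le_mul
  have hrR := s.mul_r_le
  have hR : R ≤ N ^ 3 * R := le_mul_of_one_le_left s.R_pos.le (one_le_pow₀ s.one_le_N)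
  have hQ := s.le_returnProb h hx hx1
  rw [s.returnProb_toReal h] at hQ ⊢
  have hadd := hit_disc_eq_add (p := p) (show a ≤ N ^ 3 * R by linarith) hy x
  set b := N ^ 3 * R
  set H := hit p (disc 0 a) (pt y) x with hHdef
  set W := hit p (annc a b) ((outer b).indicator (hit p (disc 0 a) (pt y))) x with hW
  have hHtop : H ≠ ⊤ := hit_pt_ne_top y x
  have hDtop : hit p (annc a b) (pt y) x ≠ ⊤ := hit_pt_ne_top y x
  have hWtop : W ≠ ⊤ := ne_top_of_le_ne_top hHtop (by rw [hadd]; exact le_add_self)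
  have hPtop : escape p a b x ≠ ⊤ :=
    ne_top_of_le_ne_top ENNReal.one_ne_top (escape_le_one _ _ _)
  have h1 : W ≤ ENNReal.ofReal (1 + ε) * (H * escape p a b x) := by
    rw [← mul_assoc, escape, ← hit_const_mul]
    refine hit_mono (fun v _ => ?_) x
    by_cases hv : v ∈ outer b
    · rw [indicator_of_mem hv, indicator_of_mem hv, Pi.one_apply, mul_one]
      exact hH v x (hR.trans hv) hx
    · rw [indicator_of_notMem hv]; exact zero_le
  have h2 : H * escape p a b x ≤ ENNReal.ofReal (1 + ε) * W := by
    rw [escape, ← hit_const_mul, hW, ← hit_const_mul]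
    refine hit_mono (fun v _ => ?_) x
    by_cases hv : v ∈ outer b
    · rw [indicator_of_mem hv, indicator_of_mem hv, Pi.one_apply, mul_one]
      exact hH x v hx (hR.trans hv)
    · rw [indicator_of_notMem hv, mul_zero]; exact zero_le
  have h3 := abs_toReal_sub_le_of_comparable hWtop (ENNReal.mul_ne_top hHtop hPtop) hε h1 h2
  have h4 : H.toReal = (hit p (annc a b) (pt y) x).toReal + W.toReal := by
    rw [hadd, ENNReal.toReal_add hDtop hWtop]
  rw [ENNReal.toReal_mul] at h3
  set P := (escape p a b x).toReal
  have hP0 : 0 ≤ P := ENNReal.toReal_nonneg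
  have hH0 : 0 ≤ H.toReal := ENNReal.toReal_nonneg
  have e : (hit p (annc a b) (pt y) x).toReal - (1 - P) * H.toReal
      = -(W.toReal - H.toReal * P) := by rw [h4]; ring
  rw [e, abs_neg]
  refine h3.trans ?_
  have h5 : P ≤ 6 * (1 - P) := by linarith
  calc 2 * ε * (H.toReal * P) ≤ 2 * ε * (H.toReal * (6 * (1 - P))) := by gcongr
    _ = _ := by ring

theorem abs_sub_le_of_approx {D D' b b' e : ℝ} (he : 0 ≤ e) (he1 : e ≤ 1 / 2) (hb' : 0 ≤ b')
    (h1 : |D - b| ≤ e * b) (h2 : |D' - b'| ≤ e * b') (h3 : |b - b'| ≤ e * b') :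
    |D - D'| ≤ 8 * e * D' := by
  rw [abs_le] at *
  have h4 : b ≤ 3 / 2 * b' := by nlinarith [h3.2]
  have h5 : b' ≤ 2 * D' := by nlinarith [h2.1]
  have h6 : e * b ≤ 3 / 2 * (e * b') := by nlinarith
  have h7 : e * b' ≤ 2 * (e * D') := by nlinarith
  constructor <;> nlinarith

/-- Both sides are close to products of return probability and hitting probability, and each factor
varies little over the band. The lower bound `1/6` turns the additive error `11/N³` into the
relative error `66ε`. -/
theorem Scales.abs_hit_annc_sub_hit_annc_le (s : Scales p C N r a R) (h : IsRegular p)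
    {x x' y : ℤ × ℤ} (hx : R ≤ enorm2 x) (hx1 : enorm2 x < R + N ^ 4) (hx' : R ≤ enorm2 x')
    (hx1' : enorm2 x' < R + N ^ 4) (hy : enorm2 y < a) {ε : ℝ} (hε : 1 / N ^ 3 ≤ ε)
    (hε1 : 400 * ε ≤ 1)
    (hH : ∀ u v : ℤ × ℤ, R ≤ enorm2 u → R ≤ enorm2 v →
      hit p (disc 0 a) (pt y) u ≤ ENNReal.ofReal (1 + ε) * hit p (disc 0 a) (pt y) v) :
    |(hit p (annc a (N ^ 3 * R)) (pt y) x).toReal - (hit p (annc a (N ^ 3 * R)) (pt y) x').toReal|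
      ≤ 1600 * ε * (hit p (annc a (N ^ 3 * R)) (pt y) x').toReal := by
  have hN := s.N_pos
  have hε0 : 0 ≤ ε := le_trans (by positivity) hε
  have h1 := s.abs_hit_annc_sub_le h hx hx1 hy hε0 hH
  have h2 := s.abs_hit_annc_sub_le h hx' hx1' hy hε0 hH
  have h3 := abs_toReal_sub_le_of_comparable (hit_pt_ne_top y x) (hit_pt_ne_top y x') hε0
    (hH x x' hx hx') (hH x' x hx' hx)
  have h4 := s.abs_returnProb_sub_le h hx hx1 hx' hx1'
  have h5 := s.le_returnProb h hx' hx1'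
  set Q := (returnProb p a (N ^ 3 * R) x).toReal
  set Q' := (returnProb p a (N ^ 3 * R) x').toReal
  set H := (hit p (disc 0 a) (pt y) x).toReal
  set H' := (hit p (disc 0 a) (pt y) x').toReal
  have hQ0 : 0 ≤ Q := ENNReal.toReal_nonneg
  have hH0 : 0 ≤ H := ENNReal.toReal_nonneg
  have hH0' : 0 ≤ H' := ENNReal.toReal_nonneg
  have hQH : 0 ≤ Q * H := by positivity
  have hQH' : 0 ≤ Q' * H' := by positivity
  have h6 : |Q * H - Q' * H'| ≤ 200 * ε * (Q' * H') := by
    have e : Q * H - Q' * H' = (Q - Q') * H + Q' * (H - H') := by ring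
    have h7 : H ≤ 2 * H' := by
      have := (abs_le.1 h3).2
      nlinarith
    have h8 : |(Q - Q') * H| ≤ 66 * ε * Q' * (2 * H') := by
      rw [abs_mul, abs_of_nonneg hH0]
      refine mul_le_mul ?_ h7 hH0 (by positivity)
      nlinarith
    have h9 : |Q' * (H - H')| ≤ Q' * (2 * ε * H') := by
      rw [abs_mul, abs_of_nonneg (by linarith : 0 ≤ Q')]
      exact mul_le_mul_of_nonneg_left h3 (by linarith)
    have h10 : 0 ≤ ε * (Q' * H') := by positivity
    rw [e]
    refine (abs_add_le _ _).trans ?_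
    linarith
  have := abs_sub_le_of_approx (e := 200 * ε) (by positivity) (by linarith) hQH'
    (h1.trans (by gcongr; norm_num)) (h2.trans (by gcongr; norm_num)) h6
  linarith

/-- With finite support there are no long jumps once `r` exceeds the range. Otherwise Condition A is
combined with the moment bound. -/
theorem exists_longJumpNegligible (h : IsRegular p) (hC : IsGapConst p C) {β : ℝ} (hβ : 0 < β)
    (hmom : HasFiniteMoment p (3 + 2 * β)) (hA : ConditionA p β) :
    ∀ᶠ n : ℕ in atTop, ∀ r R : ℝ, Scales p C n r (r + n ^ 4) R → Real.exp n ≤ r →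
      ∀ y ∈ band (disc 0 r) ((n : ℝ) ^ 4), LongJumpNegligible p C n r (r + n ^ 4) R y := by
  rcases hA with hfin | ⟨c, hc, s₀, hcond⟩
  · obtain ⟨B, hB⟩ := (hfin.image enorm2).bddAbove
    filter_upwards [tendsto_natCast_atTop_atTop.eventually_gt_atTop B] with n hn r R s hr y hy x hx
    have hBr : B < r := by
      have := Real.add_one_le_exp (n : ℝ)
      linarith
    rw [longJump_eq_zero (fun u hu => hB ⟨u, hu, rfl⟩) hBr
      ((band_disc hy).2.le.trans s.a_le_mul), mul_zero]
    exact zero_le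
  · have hlim : Tendsto (fun n : ℕ =>
        (4 * 10 ^ 6 * (C + 1) * ∑' u, pr p u * enorm2 u ^ (3 + 2 * β))
          * ((n : ℝ) ^ 4 * Real.exp (-β * n))) atTop (𝓝 0) := by
      have h1 := (tendsto_rpow_mul_exp_neg_mul_atTop_nhds_zero 4 β hβ).comp
        tendsto_natCast_atTop_atTop
      have h2 := h1.const_mul (4 * 10 ^ 6 * (C + 1) * ∑' u, pr p u * enorm2 u ^ (3 + 2 * β))
      rw [mul_zero] at h2
      refine h2.congr fun n => ?_
      simp only [Function.comp_apply]
      norm_cast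
    filter_upwards [hlim.eventually_le_const hc,
      tendsto_natCast_atTop_atTop.eventually_ge_atTop s₀] with n hn hs₀ r R s hr y hy
    obtain ⟨hy1, hy2⟩ := band_disc hy
    have h4 : (n : ℝ) ≤ (n : ℝ) ^ 4 := le_self_pow₀ s.one_le_N (by norm_num)
    have h5 := s.mul_pow_le (k := 4) (by norm_num)
    have h6 : (((n : ℝ) ^ 4) ^ (1 / 4 : ℝ)) = n := by
      rw [← Real.rpow_natCast, ← Real.rpow_mul (Nat.cast_nonneg n)]; norm_num
    have h7 := pow_pos s.N_pos 4
    -- The choice `s = n^4` gives `s^{1/4} = n`; the radius `|y| - n^4` puts `y` at the outer edge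
    -- of the band in Condition A, so the reflected point has norm at least `|y| + n^4 ≥ r + n^4`.
    have hκ := hcond ((n : ℝ) ^ 4) (enorm2 y - (n : ℝ) ^ 4) (hs₀.trans h4) (by linarith) y
      (by linarith) (by linarith)
    rw [h6] at hκ
    exact s.longJumpNegligible h hC hβ hmom hr hn hy2
      (ofReal_le_tsum_outer (by linarith) hκ)

theorem eventually_scales (p : PMF (ℤ × ℤ)) (C : ℝ) :
    ∀ᶠ n : ℕ in atTop, ∀ r R : ℝ, Real.exp n ≤ r → r = R / (n : ℝ) ^ 3 →
      Scales p C n r (r + n ^ 4) R := by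
  have hlim := (Real.tendsto_pow_mul_exp_neg_atTop_nhds_zero 40).comp tendsto_natCast_atTop_atTop
  filter_upwards [tendsto_natCast_atTop_atTop.eventually_ge_atTop ((10 : ℝ) ^ 6),
    tendsto_natCast_atTop_atTop.eventually_ge_atTop (mom3 p),
    tendsto_natCast_atTop_atTop.eventually_ge_atTop C,
    hlim.eventually_le_const one_pos] with n h1 h2 h3 h4 r R hr hrR
  have hn : (0 : ℝ) < n := by linarith
  have h5 : (n : ℝ) ^ 40 ≤ Real.exp n := by
    simp only [Function.comp_apply, Real.exp_neg] at h4
    rwa [← div_eq_mul_inv, div_le_one (Real.exp_pos _)] at h4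
  exact ⟨h1, h2, h3, h5.trans hr, by rw [hrR]; field_simp, by linarith [pow_pos hn 4], le_rfl⟩

end LatticeWalk

theorem lemma3p2 (p : PMF (ℤ × ℤ)) (β : ℝ) (hβ : 0 < β)
    (hsymm : LatticeWalk.IsSymmetric p)
    (haper : LatticeWalk.StronglyAperiodic p)
    (hcov : LatticeWalk.HasIdentityCovariance p)
    (hmom : LatticeWalk.HasFiniteMoment p (3 + 2 * β))
    (hA : LatticeWalk.ConditionA p β) :
    ∃ (C : ℝ) (n₀ : ℕ), ∀ n : ℕ, n₀ ≤ n → ∀ r R : ℝ,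
      Real.exp (n : ℝ) ≤ r → r = R / (n : ℝ) ^ 3 →
      (∀ x ∈ LatticeWalk.band (LatticeWalk.disc 0 R) ((n : ℝ) ^ 4),
        ∀ x' ∈ LatticeWalk.band (LatticeWalk.disc 0 R) ((n : ℝ) ^ 4),
        ∀ y ∈ LatticeWalk.band (LatticeWalk.disc 0 r) ((n : ℝ) ^ 4),
        |LatticeWalk.hitDist p (LatticeWalk.disc 0 (r + (n : ℝ) ^ 4)) x y
            - LatticeWalk.hitDist p (LatticeWalk.disc 0 (r + (n : ℝ) ^ 4)) x' y|
          ≤ C * (Real.log n / (n : ℝ) ^ 3)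
            * LatticeWalk.hitDist p (LatticeWalk.disc 0 (r + (n : ℝ) ^ 4)) x' y) ∧
      (∀ x ∈ LatticeWalk.band (LatticeWalk.disc 0 R) ((n : ℝ) ^ 4),
        ∀ y ∈ LatticeWalk.band (LatticeWalk.disc 0 r) ((n : ℝ) ^ 4),
        |LatticeWalk.hitDistBefore p (LatticeWalk.disc 0 (r + (n : ℝ) ^ 4))
              (LatticeWalk.disc 0 ((n : ℝ) ^ 3 * R))ᶜ x y
            - LatticeWalk.hitBefore p (LatticeWalk.disc 0 (r + (n : ℝ) ^ 4))
                (LatticeWalk.disc 0 ((n : ℝ) ^ 3 * R))ᶜ x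
              * LatticeWalk.hitDist p (LatticeWalk.disc 0 (r + (n : ℝ) ^ 4)) x y|
          ≤ C * (Real.log n / (n : ℝ) ^ 3)
            * (LatticeWalk.hitBefore p (LatticeWalk.disc 0 (r + (n : ℝ) ^ 4))
                (LatticeWalk.disc 0 ((n : ℝ) ^ 3 * R))ᶜ x
              * LatticeWalk.hitDist p (LatticeWalk.disc 0 (r + (n : ℝ) ^ 4)) x y)) ∧
      (∀ x ∈ LatticeWalk.band (LatticeWalk.disc 0 R) ((n : ℝ) ^ 4),
        ∀ x' ∈ LatticeWalk.band (LatticeWalk.disc 0 R) ((n : ℝ) ^ 4),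
        ∀ y ∈ LatticeWalk.band (LatticeWalk.disc 0 r) ((n : ℝ) ^ 4),
        |LatticeWalk.hitDistBefore p (LatticeWalk.disc 0 (r + (n : ℝ) ^ 4))
              (LatticeWalk.disc 0 ((n : ℝ) ^ 3 * R))ᶜ x y
            - LatticeWalk.hitDistBefore p (LatticeWalk.disc 0 (r + (n : ℝ) ^ 4))
              (LatticeWalk.disc 0 ((n : ℝ) ^ 3 * R))ᶜ x' y|
          ≤ C * (Real.log n / (n : ℝ) ^ 3)
            * LatticeWalk.hitDistBefore p (LatticeWalk.disc 0 (r + (n : ℝ) ^ 4))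
              (LatticeWalk.disc 0 ((n : ℝ) ^ 3 * R))ᶜ x' y) := by
  open LatticeWalk in
  have h : IsRegular p := ⟨hsymm, haper, hcov, summable_moment_nat (by push_cast; linarith) hmom⟩
  obtain ⟨C, hC⟩ := h.exists_isGapConst
  have hC0 := hC.pos
  obtain ⟨n₀, hn₀⟩ := eventually_atTop.1 ((eventually_scales p C).and
    ((exists_longJumpNegligible h hC hβ hmom hA).and
      (tendsto_natCast_atTop_atTop.eventually_ge_atTop (400 * (129600 * C + 1)))))
  refine ⟨1600 * (129600 * C + 1), n₀, fun n hn r R hr hrR => ?_⟩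
  obtain ⟨hs, hneg, hlarge⟩ := hn₀ n hn
  have s := hs r R hr hrR
  have hN := s.N_pos
  have hN1 := s.one_le_N
  have hlog := s.one_le_log
  set K : ℝ := 129600 * C + 1 with hK
  have hK1 : 1 ≤ K := by rw [hK]; linarith
  set ε : ℝ := K * (Real.log n / (n : ℝ) ^ 3) with hε
  have hε0 : 0 ≤ ε := by positivity
  have hεN : 1 / (n : ℝ) ^ 3 ≤ ε := by
    rw [hε, ← mul_div_assoc]
    gcongr
    nlinarith
  -- The choice of `n₀` ensures `400 * K ≤ n`, which with `log n ≤ n` leaves a spare factor `n`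
  -- against `n^3`.
  have hε1 : 400 * ε ≤ 1 := by
    rw [hε, ← mul_div_assoc, ← mul_div_assoc, div_le_one (by positivity), ← mul_assoc]
    calc 400 * K * Real.log n ≤ n * n := by gcongr; exact s.log_le
      _ = (n : ℝ) ^ 2 := by ring
      _ ≤ (n : ℝ) ^ 3 := pow_le_pow_right₀ hN1 (by norm_num)
  have hH : ∀ y ∈ band (disc 0 r) ((n : ℝ) ^ 4), ∀ u v : ℤ × ℤ, R ≤ enorm2 u → R ≤ enorm2 v →
      hit p (disc 0 (r + (n : ℝ) ^ 4)) (pt y) u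
        ≤ ENNReal.ofReal (1 + ε) * hit p (disc 0 (r + (n : ℝ) ^ 4)) (pt y) v :=
    fun y hy u v hu hv => s.hit_pt_le h hC hu hv (band_disc hy).2 (hneg r R s hr y hy v hv)
  have har := s.a_le_mul
  have hrR' := s.mul_r_le
  have hr0 := s.r_pos
  have hR : R ≤ (n : ℝ) ^ 3 * R := le_mul_of_one_le_left s.R_pos.le (one_le_pow₀ hN1)
  have hAB : Disjoint (disc 0 (r + (n : ℝ) ^ 4)) (disc 0 ((n : ℝ) ^ 3 * R))ᶜ := by
    rw [disjoint_compl_right_iff_subset]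
    intro y hy
    rw [mem_disc] at hy ⊢
    linarith
  have e1 : ∀ x y, y ∈ band (disc 0 r) ((n : ℝ) ^ 4) →
      hitDistBefore p (disc 0 (r + (n : ℝ) ^ 4)) (disc 0 ((n : ℝ) ^ 3 * R))ᶜ x y
        = (hit p (annc (r + (n : ℝ) ^ 4) ((n : ℝ) ^ 3 * R)) (pt y) x).toReal := fun x y hy => by
    rw [hitDistBefore_eq hAB x (mem_disc.2 (band_disc hy).2), disc_union_compl]
  have e2 : ∀ x, hitBefore p (disc 0 (r + (n : ℝ) ^ 4)) (disc 0 ((n : ℝ) ^ 3 * R))ᶜ x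
      = (returnProb p (r + (n : ℝ) ^ 4) ((n : ℝ) ^ 3 * R) x).toReal := fun x => by
    rw [hitBefore_eq hAB, disc_union_compl, returnProb]
  -- The three claims come with constants `2ε`, `12ε` and `1600ε`; the largest serves for all.
  have eε : 1600 * K * (Real.log n / (n : ℝ) ^ 3) = 1600 * ε := by rw [hε]; ring
  rw [eε]
  refine ⟨fun x hx x' hx' y hy => ?_, fun x hx y hy => ?_, fun x hx x' hx' y hy => ?_⟩
  · obtain ⟨hx1, hx2⟩ := band_disc hx
    obtain ⟨hx1', hx2'⟩ := band_disc hx'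
    rw [hitDist_eq, hitDist_eq]
    refine (abs_toReal_sub_le_of_comparable (hit_pt_ne_top y x) (hit_pt_ne_top y x') hε0
      (hH y hy x x' hx1 hx1') (hH y hy x' x hx1' hx1)).trans ?_
    gcongr
    norm_num
  · obtain ⟨hx1, hx2⟩ := band_disc hx
    rw [e1 x y hy, e2, hitDist_eq]
    refine (s.abs_hit_annc_sub_le h hx1 hx2 (band_disc hy).2 hε0 (hH y hy)).trans ?_
    gcongr
    norm_num
  · obtain ⟨hx1, hx2⟩ := band_disc hx
    obtain ⟨hx1', hx2'⟩ := band_disc hx'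
    rw [e1 x y hy, e1 x' y hy]
    exact s.abs_hit_annc_sub_hit_annc_le h hx1 hx2 hx1' hx2' (band_disc hy).2 hεN hε1 (hH y hy)

end
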